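/- **Setting.** Let $L,K\ge 0$. Let $\mathcal H_S=\Gamma(\mathbb C^L)$ and $\mathcal H_B=\Gamma(\mathbb C^K)$ be the fermionic Fock spaces (of dimensions $2^L$, $2^K$) with annihilation operators $c_i$, number operators $N_S$, $N_B$, and Majorana operators $\gamma_i=c_i+c_i^*$, $\gamma_{i+L}=-i(c_i-c_i^*)$ ($1\le i\le L$) on $\mathcal H_S$, written $\gamma^S_1,\dots,\gamma^S_{2L}$, and similarly $\gamma^B_1,\dots,\gamma^B_{2K}$ on $\mathcal H_B$. Realise both families on $\mathcal H_S\otimes\mathcal H_B$ as mutually anticommuting operators by one of the two identifications $$E_{SB}:\ \gamma^S_i\mapsto\gamma^S_i\otimes 1,\quad \gamma^B_j\mapsto(-1)^{N_S}\otimes\gamma^B_j,\qquad\text{or}\qquad E_{BS}:\ \gamma^S_i\mapsto\gamma^S_i\otimes(-1)^{N_B},\quad \gamma^B_j\mapsto 1\otimes\gamma^B_j .$$ Let $T_S=iR_S$, $T_B=iR_B$ and $\Theta=iW$, where $R_S\in\mathbb R^{2L\times 2L}$ and $R_B\in\mathbb R^{2K\times 2K}$ are antisymmetric and $W\in\mathbb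 R^{2L\times 2K}$ is arbitrary, and put $$H_S=\tfrac12\sum_{i,j}(T_S)_{ij}\gamma^S_i\gamma^S_j,\qquad H_B=\tfrac12\sum_{i,j}(T_B)_{ij}\gamma^B_i\gamma^B_j,\qquad V=\sum_{i,j}\Theta_{ij}\gamma^S_i\gamma^B_j .$$ A state is a positive operator of trace $1$. A Gaussian state is one of the form $e^{-\beta H}/\operatorname{Tr}e^{-\beta H}$ with $\beta\in\mathbb R$ and $H$ self-adjoint of the form $\sum_{i,j}T_{ij}\gamma_i\gamma_j$; a quasi-free state is a limit of Gaussian states. Let $\omega$ be a quasi-free state on $\mathcal H_B$. For $\tau>0$ put $$L_\tau(\rho)=\operatorname{Tr}_{\mathcal H_B}\!\left(e^{-i\tau(H_S+\tau^{-1/2}V+H_B)}(\rho\otimes\omega)\,e^{i\tau(H_S+\tau^{-1/2}V+H_B)}\right),\qquad \Lambda_\tau(t)=L_\tau^{\lfloor t/\tau\rfloor},$$ and $\Lambda^t(\rho)=\lim_{\tau\to0^+}\Lambda_\tau(t)(\rho)$ for $t\ge 0$. A state $\sigma$ on $\mathcal H_S$ is stationary if $\Lambda^t(\sigma)=\sigma$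 for all $t\ge0$. **Theorem.** For either identification, the limit defining $\Lambda^t(\rho)$ exists for every $t\ge0$ and every operator $\rho$ on $\mathcal H_S$, and the following assertions are equivalent. 1. There exists a unique stationary state $\rho_\infty$; moreover $\rho_\infty$ is quasi-free, and $\Lambda^t(\rho)\to\rho_\infty$ as $t\to\infty$ for every initial state $\rho$ on $\mathcal H_S$. 2. $\ker\Theta^*$ contains no eigenvector of $T_S$. 3. The linear span of $\bigcup_{k=0}^{2L}\operatorname{Ran}(T_S^k\,\Theta)$ is the whole of $\mathbb C^{2L}$. No faithfulness of $\omega$ or of any stationary state is assumed. -/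

import Mathlib

open scoped Kronecker Topology ComplexOrder

noncomputable section

/-- Operators on the fermionic space `Γ(ℂ^L)`, written as matrices in its orthonormal
occupation-number basis.  The basis vector `|u_1, …, u_L⟩` is indexed by the finite set
`{i | u_i = 1}` of occupied modes. -/
abbrev FockOp (L : ℕ) : Type := Matrix (Finset (Fin L)) (Finset (Fin L)) ℂ

/-- The annihilation operator `c_i`:
`c_i |u⟩ = δ_{u_i, 1} (∏_{k < i} (-1)^{u_k}) |u_1, …, u_i - 1, …, u_L⟩`. -/
def annihilation {L : ℕ} (i : Fin L) : FockOp L :=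
  Matrix.of fun s u =>
    if i ∈ u ∧ s = u.erase i then (-1 : ℂ) ^ (u.filter fun k => k < i).card else 0

/-- The parity operator `(-1)^N`, where `N` is the number operator. -/
def parityOp (L : ℕ) : FockOp L :=
  Matrix.diagonal fun u => (-1 : ℂ) ^ u.card

/-- The `2L` Majorana operators `γ_i = c_i + c_i^*` and `γ_{i+L} = -i (c_i - c_i^*)`. -/
def majorana {L : ℕ} : Fin L ⊕ Fin L → FockOp L
  | Sum.inl i => annihilation i + (annihilation i).conjTranspose
  | Sum.inr i => (-Complex.I) • (annihilation i - (annihilation i).conjTranspose)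

/-- A state: a positive operator of trace one. -/
def IsState {n : Type*} [Fintype n] (ρ : Matrix n n ℂ) : Prop :=
  ρ.PosSemidef ∧ ρ.trace = 1

/-- A quadratic Hamiltonian: a self-adjoint operator of the form `∑ T_{ij} γ_i γ_j`. -/
def IsQuadraticHamiltonian {L : ℕ} (H : FockOp L) : Prop :=
  H.IsHermitian ∧ ∃ T : Matrix (Fin L ⊕ Fin L) (Fin L ⊕ Fin L) ℂ,
    H = ∑ i, ∑ j, T i j • (majorana i * majorana j)

/-- A Gaussian state: `ρ = Z⁻¹ exp(-βH)` with `H` a quadratic Hamiltonian and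
`Z = Tr exp(-βH)`. -/
def IsGaussian {L : ℕ} (ρ : FockOp L) : Prop :=
  ∃ (β : ℝ) (H : FockOp L), IsQuadraticHamiltonian H ∧
    ρ = (NormedSpace.exp (-(β : ℂ) • H)).trace⁻¹ • NormedSpace.exp (-(β : ℂ) • H)

/-- A quasi-free state: a limit of Gaussian states. -/
def IsQuasiFree {L : ℕ} (ρ : FockOp L) : Prop :=
  ρ ∈ closure {σ : FockOp L | IsGaussian σ}

/-- Operators on the tensor product `Γ(ℂ^L) ⊗ Γ(ℂ^K)` of the system and one bath copy. -/
abbrev JointOp (L K : ℕ) : Type :=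
  Matrix (Finset (Fin L) × Finset (Fin K)) (Finset (Fin L) × Finset (Fin K)) ℂ

/-- The two natural identifications of `Γ(ℂ^L ⊕ ℂ^K)` with `Γ(ℂ^L) ⊗ Γ(ℂ^K)`. -/
inductive Identification : Type
  | SB
  | BS

/-- The image of the system Majorana operators in `Γ(ℂ^L) ⊗ Γ(ℂ^K)`:
`γ_i ⊗ 1` for `SB` and `γ_i ⊗ (-1)^{N_B}` for `BS`. -/
def systemField {L K : ℕ} : Identification → Fin L ⊕ Fin L → JointOp L K
  | Identification.SB, i => majorana i ⊗ₖ (1 : FockOp K)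
  | Identification.BS, i => majorana i ⊗ₖ parityOp K

/-- The image of the bath Majorana operators in `Γ(ℂ^L) ⊗ Γ(ℂ^K)`:
`(-1)^{N_S} ⊗ γ_j` for `SB` and `1 ⊗ γ_j` for `BS`. -/
def bathField {L K : ℕ} : Identification → Fin K ⊕ Fin K → JointOp L K
  | Identification.SB, j => parityOp L ⊗ₖ majorana j
  | Identification.BS, j => (1 : FockOp L) ⊗ₖ majorana j

/-- The matrix `i R` attached to a real matrix `R`. -/
def imagMatrix {m n : Type*} (R : Matrix m n ℝ) : Matrix m n ℂ :=
  Complex.I • R.map Complex.ofReal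

/-- The total Hamiltonian `H_S + lam V + H_B` during one interaction, with
`H_S = 1/2 F_S^* T_S F_S`, `H_B = 1/2 F_B^* T_B F_B` and `V = F_S^* Θ F_B`. -/
def totalHamiltonian {L K : ℕ} (E : Identification)
    (TS : Matrix (Fin L ⊕ Fin L) (Fin L ⊕ Fin L) ℂ)
    (TB : Matrix (Fin K ⊕ Fin K) (Fin K ⊕ Fin K) ℂ)
    (Θ : Matrix (Fin L ⊕ Fin L) (Fin K ⊕ Fin K) ℂ) (lam : ℝ) : JointOp L K :=
  (1 / 2 : ℂ) • (∑ i, ∑ j, TS i j • (systemField E i * systemField E j))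
    + (lam : ℂ) • (∑ i, ∑ j, Θ i j • (systemField E i * bathField E j))
    + (1 / 2 : ℂ) • (∑ i, ∑ j, TB i j • (bathField E i * bathField E j))

/-- The partial trace over the bath. -/
def traceBath {L K : ℕ} (X : JointOp L K) : FockOp L :=
  Matrix.of fun s u => ∑ b, X (s, b) (u, b)

/-- One interaction of duration `τ` with a fresh bath copy in the state `ω`:
`L_τ(ρ) = Tr_B (exp(-iτH) (ρ ⊗ ω) exp(iτH))`, where `H = H_S + lam V + H_B` and
`lam = 1/√τ`. -/
def interactionMap {L K : ℕ} (E : Identification)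
    (TS : Matrix (Fin L ⊕ Fin L) (Fin L ⊕ Fin L) ℂ)
    (TB : Matrix (Fin K ⊕ Fin K) (Fin K ⊕ Fin K) ℂ)
    (Θ : Matrix (Fin L ⊕ Fin L) (Fin K ⊕ Fin K) ℂ) (ω : FockOp K)
    (τ : ℝ) (ρ : FockOp L) : FockOp L :=
  let H : JointOp L K := totalHamiltonian E TS TB Θ (1 / √τ)
  traceBath
    (NormedSpace.exp (-(Complex.I * (τ : ℂ)) • H) * (ρ ⊗ₖ ω)
      * NormedSpace.exp ((Complex.I * (τ : ℂ)) • H))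

/-- The repeated interaction process at time `t`: `Λ_τ(t) = L_τ^⌊t/τ⌋`. -/
def repeatedInteraction {L K : ℕ} (E : Identification)
    (TS : Matrix (Fin L ⊕ Fin L) (Fin L ⊕ Fin L) ℂ)
    (TB : Matrix (Fin K ⊕ Fin K) (Fin K ⊕ Fin K) ℂ)
    (Θ : Matrix (Fin L ⊕ Fin L) (Fin K ⊕ Fin K) ℂ) (ω : FockOp K)
    (τ t : ℝ) (ρ : FockOp L) : FockOp L :=
  (interactionMap E TS TB Θ ω τ)^[⌊t / τ⌋₊] ρ

/-- The continuous-time evolution `Λ^t = lim_{τ → 0} Λ_τ(t)`. -/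
def evolution {L K : ℕ} (E : Identification)
    (TS : Matrix (Fin L ⊕ Fin L) (Fin L ⊕ Fin L) ℂ)
    (TB : Matrix (Fin K ⊕ Fin K) (Fin K ⊕ Fin K) ℂ)
    (Θ : Matrix (Fin L ⊕ Fin L) (Fin K ⊕ Fin K) ℂ) (ω : FockOp K)
    (t : ℝ) (ρ : FockOp L) : FockOp L :=
  Filter.limUnder (𝓝[>] (0 : ℝ)) fun τ => repeatedInteraction E TS TB Θ ω τ t ρ

/-- A stationary state of a one-parameter family of maps. -/
def IsStationaryState {L : ℕ} (Λ : ℝ → FockOp L → FockOp L) (ρ : FockOp L) : Prop :=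
  IsState ρ ∧ ∀ t : ℝ, 0 ≤ t → Λ t ρ = ρ

end

/-! Twisting one family by the parity and absorbing the factor i of Θ = iW puts the coupling, for
either identification, in the form Σ g_i ⊗ b_i: the g_i form a Majorana family on the system and the
b_i are real combinations of one on the bath. One interaction is then conjugation by exp(√τ A + τ C)
followed by a partial trace. Since ω is even, the term of order √τ averages to zero, and the terms
of order τ form a Lindblad generator G with Hamiltonian ½ Σ T_ij g_i g_j and rates M_ik = Tr(b_k b_i
ω). Iterates of 1 + τG + o(τ) converge to exp(tG) (`tendsto_pow_floor_exp`,
`tendsto_repeatedInteraction`). By the CAR, M + Mᵀ = 2ΘΘ* whatever ω is, which is why the criterion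
involves only T and Θ.

Convergence (2 ⇒ 1). With G' = PGP, where P acts by left multiplication, G[Y, g_p] = [G'Y, g_p] +
Σ_k B_pk [Y, g_k], where Bᵀ = -2iT - 2ΘΘ* (`lindbladian_commutator`). Under the Hautus condition all
eigenvalues of Bᵀ have negative real part, while exp(tG') stays bounded because exp(tG) is positive
and preserves the trace. So exp(tG) tends to 0 on commutators with the fields, and these span the
traceless operators by irreducibility. Any stationary state therefore attracts every state and is
unique.

Existence of a quasi-free stationary state. For positive definite M, a Lyapunov equation gives a
covariance C with -1 < C < 1, and the Gaussian operator with one-particle map F = (1 - C)(1 + C)⁻¹ =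
exp(2X) satisfies Gρ = (quadratic operator) ρ with a symmetric coefficient matrix. By the CAR that
operator is a scalar, and the scalar is 0 because Tr Gρ = 0. General M follows by adding ε·1 to the
rates and using compactness of the set of states.

Obstruction (1 ⇒ 2). If Tv = μv and Θ*v = 0, the functional ρ ↦ Tr(g(v)Pρ) is an eigenfunctional of
G with eigenvalue 2iμ, and μ is real. Its modulus is conserved. Since it vanishes on the maximally
mixed state, relaxation to a single state would force it to vanish identically, contradicting g(v) ≠
0.

The equivalence of 2 and 3 is the Hautus test: the orthogonal complement of the reachable space is
T-invariant, so it is nonzero exactly when it contains an eigenvector of T. -/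

/-! ### The CAR algebra in the occupation-number basis, and its irreducibility. -/

section FockAlgebra

/-- A self-adjoint family satisfying the canonical anticommutation relations together with a
self-adjoint unitary anticommuting with all its members. -/
structure IsMajoranaFamily {n ι : Type*} [Fintype n] [DecidableEq n] [DecidableEq ι]
    (g : ι → Matrix n n ℂ) (P : Matrix n n ℂ) : Prop where
  conjTranspose : ∀ i, (g i).conjTranspose = g i
  car : ∀ i j, g i * g j + g j * g i = (if i = j then 2 else 0 : ℂ) • (1 : Matrix n n ℂ)
  parity_conjTranspose : P.conjTranspose = P
  parity_mul_self : P * P = 1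
  parity_anticomm : ∀ i, P * g i = -(g i * P)

/-- The Jordan–Wigner sign of the mode `i` in the configuration `u`. -/
def jwSign {L : ℕ} (i : Fin L) (u : Finset (Fin L)) : ℂ :=
  (-1 : ℂ) ^ (u.filter fun k => k < i).card

/-- Adding or removing the mode `i`. -/
def flipMode {L : ℕ} (i : Fin L) (u : Finset (Fin L)) : Finset (Fin L) :=
  if i ∈ u then u.erase i else insert i u

/-- The nonzero coefficients of the Majorana operators. -/
def majoranaCoeff {L : ℕ} : Fin L ⊕ Fin L → Finset (Fin L) → ℂ
  | Sum.inl i, u => jwSign i u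
  | Sum.inr i, u => (if i ∈ u then -Complex.I else Complex.I) * jwSign i u

/-- The mode underlying a Majorana index. -/
def majoranaMode {L : ℕ} : Fin L ⊕ Fin L → Fin L
  | Sum.inl i => i
  | Sum.inr i => i

variable {L : ℕ}

lemma flipMode_flipMode (i : Fin L) (u : Finset (Fin L)) : flipMode i (flipMode i u) = u := by
  unfold flipMode
  by_cases h : i ∈ u <;> simp [h]

lemma flipMode_comm (i j : Fin L) (u : Finset (Fin L)) :
    flipMode i (flipMode j u) = flipMode j (flipMode i u) := by
  rcases eq_or_ne i j with rfl | h
  · rfl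
  ext k
  unfold flipMode
  split_ifs <;> simp_all <;> grind

lemma mem_flipMode_self (i : Fin L) (u : Finset (Fin L)) : i ∈ flipMode i u ↔ i ∉ u := by
  unfold flipMode
  by_cases h : i ∈ u <;> simp [h]

lemma mem_flipMode_of_ne {i j : Fin L} (h : i ≠ j) (u : Finset (Fin L)) :
    i ∈ flipMode j u ↔ i ∈ u := by
  unfold flipMode
  by_cases h' : j ∈ u <;> simp [h', h]

lemma jwSign_mul_self (i : Fin L) (u : Finset (Fin L)) : jwSign i u * jwSign i u = 1 := by
  unfold jwSign
  rw [← pow_add, Even.neg_one_pow ⟨_, rfl⟩]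

lemma star_jwSign (i : Fin L) (u : Finset (Fin L)) : star (jwSign i u) = jwSign i u := by
  simp [jwSign]

lemma neg_one_pow_card_flip (i : Fin L) (u : Finset (Fin L)) :
    (-1 : ℂ) ^ (flipMode i u).card = -(-1) ^ u.card := by
  unfold flipMode
  by_cases h : i ∈ u
  · obtain ⟨m, hm⟩ : ∃ m, u.card = m + 1 := ⟨u.card - 1, by
      have := Finset.card_pos.2 ⟨i, h⟩; omega⟩
    simp [h, Finset.card_erase_of_mem, hm, pow_succ]
  · simp [h, pow_succ]

lemma jwSign_flipMode (i j : Fin L) (u : Finset (Fin L)) :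
    jwSign i (flipMode j u) = (if j < i then -1 else 1) * jwSign i u := by
  unfold jwSign
  by_cases hji : j < i
  · have : (flipMode j u).filter (fun k => k < i) = flipMode j (u.filter fun k => k < i) := by
      ext k
      unfold flipMode
      by_cases h : j ∈ u <;> simp [h, hji] <;> grind
    rw [this, neg_one_pow_card_flip]
    simp [hji]
  · have : (flipMode j u).filter (fun k => k < i) = u.filter fun k => k < i := by
      ext k
      unfold flipMode
      by_cases h : j ∈ u <;> simp [h] <;> grind
    rw [this]
    simp [hji]

lemma annihilation_apply (i : Fin L) (s u : Finset (Fin L)) :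
    annihilation i s u = if s = flipMode i u then (if i ∈ u then jwSign i u else 0) else 0 := by
  by_cases h : i ∈ u <;> simp [annihilation, jwSign, flipMode, h]

lemma eq_flipMode_comm {i : Fin L} {s u : Finset (Fin L)} : s = flipMode i u ↔ u = flipMode i s :=
  ⟨fun h => by rw [h, flipMode_flipMode], fun h => by rw [h, flipMode_flipMode]⟩

lemma annihilation_conjTranspose_apply (i : Fin L) (s u : Finset (Fin L)) :
    (annihilation i).conjTranspose s u =
      if s = flipMode i u then (if i ∈ u then 0 else jwSign i u) else 0 := by
  rw [Matrix.conjTranspose_apply, annihilation_apply]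
  by_cases h : s = flipMode i u
  · have h' := eq_flipMode_comm.1 h
    rw [if_pos h, if_pos h', h]
    by_cases hi : i ∈ u <;> simp [mem_flipMode_self, hi, jwSign_flipMode, star_jwSign]
  · have h' := mt eq_flipMode_comm.2 h
    simp [h, h']

/-- In each column only one entry is nonzero, because c_i and c_i^* act on complementary
configurations. Matrix products with a Majorana operator therefore reduce to a single term. -/
lemma majorana_apply (a : Fin L ⊕ Fin L) (s u : Finset (Fin L)) :
    majorana a s u = if s = flipMode (majoranaMode a) u then majoranaCoeff a u else 0 := by
  rcases a with i | i
  · simp only [majorana, majoranaMode, majoranaCoeff, Matrix.add_apply, annihilation_apply,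
      annihilation_conjTranspose_apply]
    by_cases h : s = flipMode i u <;> by_cases hi : i ∈ u <;> simp [h, hi]
  · simp only [majorana, majoranaMode, majoranaCoeff, Matrix.sub_apply, Matrix.smul_apply,
      annihilation_apply, annihilation_conjTranspose_apply]
    by_cases h : s = flipMode i u <;> by_cases hi : i ∈ u <;> simp [h, hi]

lemma majorana_mul_apply (a : Fin L ⊕ Fin L) (X : FockOp L) (s u : Finset (Fin L)) :
    (X * majorana a) s u = X s (flipMode (majoranaMode a) u) * majoranaCoeff a u := by
  simp [Matrix.mul_apply, majorana_apply]

lemma majorana_mul_apply' (a : Fin L ⊕ Fin L) (X : FockOp L) (s u : Finset (Fin L)) :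
    (majorana a * X) s u =
      majoranaCoeff a (flipMode (majoranaMode a) s) * X (flipMode (majoranaMode a) s) u := by
  simp only [Matrix.mul_apply, majorana_apply, eq_flipMode_comm (s := s)]
  simp

lemma majorana_conjTranspose (a : Fin L ⊕ Fin L) :
    (majorana a).conjTranspose = majorana a := by
  rcases a with i | i
  · simp [majorana, add_comm]
  · simp [majorana, sub_eq_add_neg, add_comm]

/-- This is the anticommutation relation entry by entry. For distinct modes, flipping the lower one
changes the Jordan–Wigner sign of the higher one and not conversely; for the two operators of one
mode, the sign comes from the factor ∓i. -/
lemma majoranaCoeff_flip_mul (a b : Fin L ⊕ Fin L) (h : a ≠ b) (u : Finset (Fin L)) :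
    majoranaCoeff a (flipMode (majoranaMode b) u) * majoranaCoeff b u =
      -(majoranaCoeff b (flipMode (majoranaMode a) u) * majoranaCoeff a u) := by
  rcases a with i | i <;> rcases b with j | j <;>
    simp only [majoranaCoeff, majoranaMode, jwSign_flipMode] <;>
    rcases lt_trichotomy i j with hij | hij | hij <;>
    first
    | (subst hij
       by_cases hi : i ∈ u <;> simp_all [mem_flipMode_self] <;> ring)
    | (simp [hij, hij.not_gt, mem_flipMode_of_ne hij.ne, mem_flipMode_of_ne hij.ne']
       first | done | ring1 | (split_ifs <;> ring1))

lemma majoranaCoeff_flip_mul_self (a : Fin L ⊕ Fin L) (u : Finset (Fin L)) :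
    majoranaCoeff a (flipMode (majoranaMode a) u) * majoranaCoeff a u = 1 := by
  rcases a with i | i
  · simp [majoranaCoeff, majoranaMode, jwSign_flipMode, jwSign_mul_self]
  · by_cases hi : i ∈ u <;>
      simp [majoranaCoeff, majoranaMode, jwSign_flipMode, mem_flipMode_self, hi] <;>
      linear_combination (-Complex.I * Complex.I) * jwSign_mul_self i u - Complex.I_mul_I

lemma majorana_car (a b : Fin L ⊕ Fin L) :
    majorana a * majorana b + majorana b * majorana a =
      (if a = b then 2 else 0 : ℂ) • (1 : FockOp L) := by
  ext s u
  rw [Matrix.add_apply, majorana_mul_apply, majorana_mul_apply, majorana_apply, majorana_apply]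
  rcases eq_or_ne a b with rfl | h
  · simp only [flipMode_flipMode, if_true, Matrix.smul_apply, Matrix.one_apply]
    split_ifs
    · rw [majoranaCoeff_flip_mul_self]; norm_num
    · simp
  · rw [flipMode_comm]
    simp only [h, if_false, zero_smul, Matrix.zero_apply]
    split_ifs
    · rw [majoranaCoeff_flip_mul a b h]; ring
    · simp

lemma parityOp_conjTranspose : (parityOp L).conjTranspose = parityOp L := by
  simp [parityOp, Matrix.diagonal_conjTranspose, Pi.star_def]

lemma parityOp_mul_self : parityOp L * parityOp L = 1 := by
  rw [parityOp, Matrix.diagonal_mul_diagonal, ← Matrix.diagonal_one]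
  congr 1
  ext u
  rw [← pow_add, Even.neg_one_pow ⟨_, rfl⟩]

lemma parityOp_anticomm (a : Fin L ⊕ Fin L) :
    parityOp L * majorana a = -(majorana a * parityOp L) := by
  ext s u
  rw [Matrix.neg_apply, parityOp, Matrix.diagonal_mul, Matrix.mul_diagonal, majorana_apply]
  split_ifs with h
  · rw [h, neg_one_pow_card_flip]; ring
  · simp

lemma isMajoranaFamily_majorana : IsMajoranaFamily (majorana (L := L)) (parityOp L) :=
  ⟨majorana_conjTranspose, majorana_car, parityOp_conjTranspose, parityOp_mul_self,
    parityOp_anticomm⟩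

/-- An operator commuting with the even part of the Clifford algebra is diagonal. -/
lemma apply_eq_zero_of_commute_even {Z : FockOp L}
    (hZ : ∀ a b, Z * (majorana a * majorana b) = majorana a * majorana b * Z)
    {s u : Finset (Fin L)} (h : s ≠ u) : Z s u = 0 := by
  obtain ⟨i, hi⟩ : ∃ i, ¬(i ∈ s ↔ i ∈ u) := by
    by_contra! hc
    exact h (Finset.ext hc)
  -- The product γ_i γ_{i+L} is diagonal with entries i(-1)^{u_i}, so it separates s from u.
  have key := congrFun (congrFun (hZ (Sum.inl i) (Sum.inr i)) s) u
  rw [← mul_assoc, mul_assoc (majorana _), majorana_mul_apply, majorana_mul_apply,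
    majorana_mul_apply', majorana_mul_apply'] at key
  simp only [majoranaMode, majoranaCoeff, flipMode_flipMode, jwSign_flipMode, lt_irrefl,
    if_false, one_mul] at key
  have hs := jwSign_mul_self i s
  have hu := jwSign_mul_self i u
  by_cases h1 : i ∈ s <;> by_cases h2 : i ∈ u <;> simp [h1, h2] at hi key
  · have : 2 * Complex.I * Z s u = 0 := by
      linear_combination key - Complex.I * Z s u * hs - Complex.I * Z s u * hu
    simpa using this
  · have : 2 * Complex.I * Z s u = 0 := by
      linear_combination -key - Complex.I * Z s u * hs - Complex.I * Z s u * hu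
    simpa using this

lemma commute_parityOp_of_commute_even {Z : FockOp L}
    (hZ : ∀ a b, Z * (majorana a * majorana b) = majorana a * majorana b * Z) :
    Z * parityOp L = parityOp L * Z := by
  ext s u
  rw [parityOp, Matrix.diagonal_mul, Matrix.mul_diagonal]
  rcases eq_or_ne s u with rfl | h
  · ring
  · simp [apply_eq_zero_of_commute_even hZ h]

/-- Irreducibility of the Fock representation. Even products force Z to be diagonal, and γ_i, which
flips mode i, equates the diagonal entries at u and at its flip; flips connect every configuration
to the vacuum. -/
lemma eq_smul_one_of_commute_majorana {Z : FockOp L}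
    (hZ : ∀ a, Z * majorana a = majorana a * Z) : ∃ c : ℂ, Z = c • (1 : FockOp L) := by
  have hd : ∀ s u, s ≠ u → Z s u = 0 := fun s u h =>
    apply_eq_zero_of_commute_even (fun a b => by
      rw [← mul_assoc, hZ, mul_assoc, hZ, mul_assoc]) h
  have hflip : ∀ (i : Fin L) (u : Finset (Fin L)), Z (flipMode i u) (flipMode i u) = Z u u := by
    intro i u
    have key := congrFun (congrFun (hZ (Sum.inl i)) (flipMode i u)) u
    rw [majorana_mul_apply, majorana_mul_apply'] at key
    simp only [majoranaMode, majoranaCoeff, flipMode_flipMode] at key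
    linear_combination (jwSign i u) * key -
      (Z (flipMode i u) (flipMode i u) - Z u u) * jwSign_mul_self i u
  have hconst : ∀ u, Z u u = Z ∅ ∅ := by
    intro u
    induction u using Finset.induction_on with
    | empty => rfl
    | insert i u hi ih =>
      have := hflip i u
      simp only [flipMode, hi, if_false] at this
      rw [this, ih]
  refine ⟨Z ∅ ∅, ?_⟩
  ext s u
  rcases eq_or_ne s u with rfl | h
  · simp [hconst]
  · simp [hd s u h, h]

end FockAlgebra

/-! ### Exponentials of operators: product limits, expansions and decay. -/

section OperatorExponential

open Filter NormedSpace Asymptotics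

/-- The exponential of an intertwined operator is intertwined. -/
theorem map_exp_apply_of_intertwine {V U : Type*} [NormedAddCommGroup V] [NormedSpace ℂ V]
    [CompleteSpace V] [NormedAddCommGroup U] [NormedSpace ℂ U] [CompleteSpace U]
    (f : V →L[ℂ] V) (g : U →L[ℂ] U) (φ : V →L[ℂ] U) (h : ∀ v, φ (f v) = g (φ v)) (v : V) :
    φ (exp f v) = exp g (φ v) := by
  have hpow : ∀ (n : ℕ) (w : V), φ ((f ^ n) w) = (g ^ n) (φ w) := by
    intro n
    induction n with
    | zero => intro w; rfl
    | succ n ih =>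
      intro w
      rw [pow_succ, pow_succ, mul_apply_eq_comp, mul_apply_eq_comp, ih, h]
  have h1 := ((exp_series_hasSum_exp' (𝕂 := ℂ) f).mapL (ContinuousLinearMap.apply ℂ V v)).mapL φ
  have h2 := (exp_series_hasSum_exp' (𝕂 := ℂ) g).mapL (ContinuousLinearMap.apply ℂ U (φ v))
  simp only [ContinuousLinearMap.apply_apply, map_smul, hpow] at h1 h2
  exact h1.unique h2

/-- Telescoping, one factor at a time. Taking r ≥ 1 allows the uniform power r ^ n instead of r ^ (n
- 1). -/
theorem norm_pow_sub_pow_le {A : Type*} [NormedRing A] [NormOneClass A] {a b : A} {r : ℝ}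
    (ha : ‖a‖ ≤ r) (hb : ‖b‖ ≤ r) (hr : 1 ≤ r) (n : ℕ) :
    ‖a ^ n - b ^ n‖ ≤ n * r ^ n * ‖a - b‖ := by
  have h0 : 0 ≤ r := zero_le_one.trans hr
  induction n with
  | zero => simp
  | succ n ih =>
    have hsplit : a ^ (n + 1) - b ^ (n + 1) = (a ^ n - b ^ n) * a + b ^ n * (a - b) := by
      rw [pow_succ, pow_succ]; noncomm_ring
    calc ‖a ^ (n + 1) - b ^ (n + 1)‖
        ≤ ‖a ^ n - b ^ n‖ * ‖a‖ + ‖b ^ n‖ * ‖a - b‖ := by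
          rw [hsplit]
          exact (norm_add_le _ _).trans (add_le_add (norm_mul_le _ _) (norm_mul_le _ _))
      _ ≤ n * r ^ n * ‖a - b‖ * r + r ^ n * r * ‖a - b‖ := by
          have hbn : ‖b ^ n‖ ≤ r ^ n * r :=
            ((norm_pow_le b n).trans (pow_le_pow_left₀ (norm_nonneg _) hb n)).trans
              (le_mul_of_one_le_right (by positivity) hr)
          gcongr
      _ = (n + 1 : ℕ) * r ^ (n + 1) * ‖a - b‖ := by push_cast; ring

/-- Iterates of a family tangent to the identity converge to a semigroup. -/
theorem tendsto_pow_floor_exp {A : Type*} [NormedRing A] [NormOneClass A] [NormedAlgebra ℂ A]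
    [CompleteSpace A] {f : ℝ → A} {G : A}
    (hf : Tendsto (fun τ : ℝ => (τ : ℂ)⁻¹ • (f τ - 1)) (𝓝[>] 0) (𝓝 G)) {t : ℝ} (ht : 0 ≤ t) :
    Tendsto (fun τ : ℝ => f τ ^ ⌊t / τ⌋₊) (𝓝[>] 0) (𝓝 (exp ((t : ℂ) • G))) := by
  let _ : NormedAlgebra ℚ A := NormedAlgebra.restrictScalars ℚ ℂ A
  have hpos : ∀ᶠ τ : ℝ in 𝓝[>] 0, 0 < τ := self_mem_nhdsWithin
  have hexp : Tendsto (fun τ : ℝ => (τ : ℂ)⁻¹ • (exp ((τ : ℂ) • G) - 1)) (𝓝[>] 0) (𝓝 G) := by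
    have h := (hasDerivAt_exp_smul_const (𝕂 := ℝ) (𝔸 := A) G 0)
    have h' := h.hasDerivWithinAt (s := Set.Ioi 0)
    rw [hasDerivWithinAt_iff_tendsto_slope' (by simp)] at h'
    simp only [zero_smul, exp_zero, one_mul] at h'
    refine h'.congr fun τ => ?_
    rw [slope_def_module]
    simp only [zero_smul, exp_zero, sub_zero]
    rw [← Complex.ofReal_inv, Complex.coe_smul, Complex.coe_smul]
  -- The slack of 1 over ‖G‖ makes the difference quotients eventually smaller than c.
  set c : ℝ := ‖G‖ + 1 with hc
  have hc0 : 0 < c := by positivity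
  have bound : ∀ {h : ℝ → A}, Tendsto (fun τ : ℝ => (τ : ℂ)⁻¹ • (h τ - 1)) (𝓝[>] 0) (𝓝 G) →
      ∀ᶠ τ : ℝ in 𝓝[>] 0, ‖h τ‖ ≤ Real.exp (c * τ) := by
    intro h hh
    filter_upwards [hh.norm.eventually_lt_const (show ‖G‖ < c by linarith), hpos] with τ h1 h2
    have h3 : ‖h τ - 1‖ ≤ c * τ := by
      rw [norm_smul, norm_inv, Complex.norm_real, Real.norm_of_nonneg h2.le] at h1
      rw [inv_mul_lt_iff₀ h2] at h1
      linarith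
    calc ‖h τ‖ = ‖(h τ - 1) + 1‖ := by rw [sub_add_cancel]
      _ ≤ ‖h τ - 1‖ + ‖(1 : A)‖ := norm_add_le _ _
      _ ≤ c * τ + 1 := by rw [norm_one]; linarith
      _ ≤ Real.exp (c * τ) := Real.add_one_le_exp _
  -- With n = ⌊t/τ⌋, telescoping bounds the difference by nτ ≤ t times the difference of the two
  -- quotients by τ, up to exp(ct). Both quotients tend to G.
  have hdiff : Tendsto (fun τ : ℝ => f τ ^ ⌊t / τ⌋₊ - exp ((τ : ℂ) • G) ^ ⌊t / τ⌋₊)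
      (𝓝[>] 0) (𝓝 0) := by
    have hlim : Tendsto (fun τ : ℝ => t * Real.exp (c * t) *
        ‖(τ : ℂ)⁻¹ • (f τ - 1) - (τ : ℂ)⁻¹ • (exp ((τ : ℂ) • G) - 1)‖) (𝓝[>] 0) (𝓝 0) := by
      have := (hf.sub hexp).norm.const_mul (t * Real.exp (c * t))
      simpa using this
    refine squeeze_zero_norm' ?_ hlim
    filter_upwards [bound hf, bound hexp, hpos] with τ h1 h2 h3
    have hn : (⌊t / τ⌋₊ : ℝ) * τ ≤ t := by
      have := Nat.floor_le (div_nonneg ht h3.le)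
      rwa [le_div_iff₀ h3] at this
    have hr : Real.exp (c * τ) ^ ⌊t / τ⌋₊ ≤ Real.exp (c * t) := by
      rw [← Real.exp_nat_mul]
      apply Real.exp_le_exp.2
      nlinarith
    have key := norm_pow_sub_pow_le h1 h2 (Real.one_le_exp (by positivity)) ⌊t / τ⌋₊
    rw [← smul_sub, norm_smul, norm_inv, Complex.norm_real, Real.norm_of_nonneg h3.le,
      sub_sub_sub_cancel_right]
    calc _ ≤ _ := key
      _ ≤ (⌊t / τ⌋₊ : ℝ) * Real.exp (c * t) * ‖f τ - exp ((τ : ℂ) • G)‖ := by gcongr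
      _ = ((⌊t / τ⌋₊ : ℝ) * τ) * Real.exp (c * t) * (τ⁻¹ * ‖f τ - exp ((τ : ℂ) • G)‖) := by
          field_simp
      _ ≤ _ := by gcongr
  have hmain : Tendsto (fun τ : ℝ => exp ((τ : ℂ) • G) ^ ⌊t / τ⌋₊) (𝓝[>] 0)
      (𝓝 (exp ((t : ℂ) • G))) := by
    have h1 : Tendsto (fun τ : ℝ => ((⌊t / τ⌋₊ : ℝ) * τ)) (𝓝[>] 0) (𝓝 t) := by
      have hlow : Tendsto (fun τ : ℝ => t - τ) (𝓝[>] 0) (𝓝 t) := by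
        have : Tendsto (fun τ : ℝ => t - τ) (𝓝 0) (𝓝 (t - 0)) :=
          (continuous_const.sub continuous_id).tendsto 0
        rw [sub_zero] at this
        exact this.mono_left nhdsWithin_le_nhds
      refine tendsto_of_tendsto_of_tendsto_of_le_of_le' hlow tendsto_const_nhds ?_ ?_
      · filter_upwards [hpos] with τ h3
        have := (Nat.lt_floor_add_one (t / τ)).le
        rw [div_le_iff₀ h3] at this
        linarith
      · filter_upwards [hpos] with τ h3
        have := Nat.floor_le (div_nonneg ht h3.le)
        rwa [le_div_iff₀ h3] at this
    have h2 : Continuous fun r : ℝ => exp ((r : ℂ) • G) := by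
      refine exp_continuous.comp ?_
      exact (Complex.continuous_ofReal.smul continuous_const)
    refine ((h2.tendsto t).comp h1).congr fun τ => ?_
    simp only [Function.comp]
    rw [← exp_nsmul, ← Nat.cast_smul_eq_nsmul ℂ, smul_smul]
    push_cast
    rfl
  simpa using hdiff.add hmain

/-- Second-order expansion of `exp (s a + s² c)` at `s = 0`. -/
theorem tendsto_exp_second_order {A : Type*} [NormedRing A] [NormedAlgebra ℂ A] [CompleteSpace A]
    (a c : A) :
    Tendsto (fun s : ℝ => ((s : ℂ) ^ 2)⁻¹ • (exp ((s : ℂ) • a + (s : ℂ) ^ 2 • c) - 1 - (s : ℂ) • a))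
      (𝓝[>] 0) (𝓝 (c + (2⁻¹ : ℂ) • (a * a))) := by
  have hz : Tendsto (fun s : ℝ => (s : ℂ) • a + (s : ℂ) ^ 2 • c) (𝓝[>] 0) (𝓝 0) := by
    have hcont : Continuous fun s : ℝ => (s : ℂ) • a + (s : ℂ) ^ 2 • c :=
      (Complex.continuous_ofReal.smul continuous_const).add
        ((Complex.continuous_ofReal.pow 2).smul continuous_const)
    have := hcont.tendsto 0
    simp only [Complex.ofReal_zero, zero_smul, ne_eq, OfNat.ofNat_ne_zero, not_false_eq_true,
      zero_pow, add_zero] at this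
    exact this.mono_left nhdsWithin_le_nhds
  -- The Taylor remainder of exp after the quadratic term is cubic in its argument, which is itself
  -- O(s), so it survives division by s² as O(s).
  have hO := ((exp_hasFPowerSeriesAt_zero (𝕂 := ℂ) (𝔸 := A)).isBigO_sub_partialSum_pow 3).comp_tendsto
    hz
  have hzO : (fun s : ℝ => (s : ℂ) • a + (s : ℂ) ^ 2 • c) =O[𝓝[>] 0] fun s : ℝ => s := by
    refine IsBigO.of_bound (‖a‖ + ‖c‖) ?_
    have h1 : ∀ᶠ s : ℝ in 𝓝[>] 0, s < 1 := nhdsWithin_le_nhds (eventually_lt_nhds zero_lt_one)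
    filter_upwards [h1, self_mem_nhdsWithin] with s h1 h2
    have h2' : (0 : ℝ) < s := h2
    calc ‖(s : ℂ) • a + (s : ℂ) ^ 2 • c‖ ≤ s * ‖a‖ + s ^ 2 * ‖c‖ := by
          refine (norm_add_le _ _).trans ?_
          rw [norm_smul, norm_smul, norm_pow, Complex.norm_real, Real.norm_of_nonneg h2'.le]
      _ ≤ (‖a‖ + ‖c‖) * ‖s‖ := by
          rw [Real.norm_of_nonneg h2'.le]
          nlinarith [norm_nonneg a, norm_nonneg c, mul_nonneg h2'.le (norm_nonneg c)]
  have hO2 : (fun s : ℝ => exp ((s : ℂ) • a + (s : ℂ) ^ 2 • c) - 1 -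
      ((s : ℂ) • a + (s : ℂ) ^ 2 • c) - (2⁻¹ : ℂ) • ((s : ℂ) • a + (s : ℂ) ^ 2 • c) ^ 2)
      =O[𝓝[>] 0] fun s : ℝ => s ^ 3 := by
    refine IsBigO.trans ?_ (hzO.norm_left.pow 3)
    refine hO.congr_left fun s => ?_
    simp only [Function.comp, zero_add, FormalMultilinearSeries.partialSum, Finset.sum_range_succ,
      Finset.sum_range_zero, expSeries_apply_eq]
    simp [sub_sub]
  have hlim : Tendsto (fun s : ℝ => ((s : ℂ) ^ 2)⁻¹ • (exp ((s : ℂ) • a + (s : ℂ) ^ 2 • c) - 1 -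
      ((s : ℂ) • a + (s : ℂ) ^ 2 • c) - (2⁻¹ : ℂ) • ((s : ℂ) • a + (s : ℂ) ^ 2 • c) ^ 2))
      (𝓝[>] 0) (𝓝 0) := by
    have h1 : (fun s : ℝ => ((s : ℂ) ^ 2)⁻¹ • (exp ((s : ℂ) • a + (s : ℂ) ^ 2 • c) - 1 -
      ((s : ℂ) • a + (s : ℂ) ^ 2 • c) - (2⁻¹ : ℂ) • ((s : ℂ) • a + (s : ℂ) ^ 2 • c) ^ 2))
      =O[𝓝[>] 0] fun s : ℝ => s := by
      have hO3 := hO2.trans (IsBigO.of_bound (g := fun s : ℝ => (s : ℂ) ^ 3) 1 (by simp))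
      refine ((isBigO_refl (fun s : ℝ => ((s : ℂ) ^ 2)⁻¹) _).smul hO3).trans ?_
      refine IsBigO.of_bound 1 ?_
      filter_upwards [self_mem_nhdsWithin] with s h2
      have h2' : (0 : ℝ) < s := h2
      rw [norm_smul, norm_inv, norm_pow, norm_pow, Complex.norm_real]
      apply le_of_eq
      have : ‖s‖ ≠ 0 := by simpa using h2'.ne'
      field_simp
    refine h1.trans_tendsto ?_
    exact tendsto_id.mono_left nhdsWithin_le_nhds
  have hrest : Tendsto (fun s : ℝ => c + (2⁻¹ : ℂ) • (a * a) + (2⁻¹ : ℂ) • ((s : ℂ) • (a * c + c * a)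
      + (s : ℂ) ^ 2 • (c * c))) (𝓝[>] 0) (𝓝 (c + (2⁻¹ : ℂ) • (a * a))) := by
    have hcont : Continuous fun s : ℝ => c + (2⁻¹ : ℂ) • (a * a) + (2⁻¹ : ℂ) •
        ((s : ℂ) • (a * c + c * a) + (s : ℂ) ^ 2 • (c * c)) := by fun_prop
    have := hcont.tendsto 0
    simp only [Complex.ofReal_zero, zero_smul, ne_eq, OfNat.ofNat_ne_zero, not_false_eq_true,
      zero_pow, add_zero, smul_zero] at this
    exact this.mono_left nhdsWithin_le_nhds
  have := hlim.add hrest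
  rw [zero_add] at this
  refine this.congr' ?_
  filter_upwards [self_mem_nhdsWithin] with s h2
  have h2' : (s : ℂ) ≠ 0 := Complex.ofReal_ne_zero.2 (ne_of_gt h2)
  have hsq : ((s : ℂ) • a + (s : ℂ) ^ 2 • c) ^ 2 = (s : ℂ) ^ 2 • (a * a + (s : ℂ) • (a * c + c * a)
      + (s : ℂ) ^ 2 • (c * c)) := by
    rw [sq]
    simp only [add_mul, mul_add, smul_mul_assoc, mul_smul_comm, smul_add, smul_smul]
    module
  rw [hsq]
  generalize exp ((s : ℂ) • a + (s : ℂ) ^ 2 • c) = e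
  have hsplit : e - 1 - (s : ℂ) • a = (e - 1 - ((s : ℂ) • a + (s : ℂ) ^ 2 • c) - (2⁻¹ : ℂ) •
      (s : ℂ) ^ 2 • (a * a + (s : ℂ) • (a * c + c * a) + (s : ℂ) ^ 2 • (c * c))) +
      (s : ℂ) ^ 2 • (c + (2⁻¹ : ℂ) • (a * a) + (2⁻¹ : ℂ) •
        ((s : ℂ) • (a * c + c * a) + (s : ℂ) ^ 2 • (c * c))) := by
    module
  conv_rhs => rw [hsplit, smul_add, inv_smul_smul₀ (pow_ne_zero 2 h2')]

/-- If all eigenvalues of `f` have negative real part, its semigroup decays. -/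
theorem tendsto_exp_apply_zero {V : Type*} [NormedAddCommGroup V] [NormedSpace ℂ V]
    [FiniteDimensional ℂ V] (f : V →L[ℂ] V)
    (hf : ∀ μ : ℂ, Module.End.HasEigenvalue (f : V →ₗ[ℂ] V) μ → μ.re < 0) (v : V) :
    Tendsto (fun t : ℝ => exp ((t : ℂ) • f) v) atTop (𝓝 0) := by
  have : CompleteSpace V := FiniteDimensional.complete ℂ V
  let _ : NormedAlgebra ℚ (V →L[ℂ] V) := NormedAlgebra.restrictScalars ℚ ℂ _
  -- The space is the span of the generalised eigenspaces, so decay need only be checked on each of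
  -- them.
  have hv : v ∈ ⨆ μ : ℂ, Module.End.maxGenEigenspace (f : V →ₗ[ℂ] V) μ := by
    rw [Module.End.iSup_maxGenEigenspace_eq_top]; trivial
  induction hv using Submodule.iSup_induction' with
  | zero => simp
  | add x y _ _ hx hy => simpa using hx.add hy
  | mem μ x hx =>
    rcases eq_or_ne x 0 with rfl | hx0
    · simp
    have hμ : μ.re < 0 := by
      apply hf
      rw [Module.End.maxGenEigenspace_eq] at hx
      refine Module.End.hasEigenvalue_of_hasGenEigenvalue (k := Module.End.maxGenEigenspaceIndex
        (f : V →ₗ[ℂ] V) μ) ?_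
      intro hbot
      exact hx0 (by simpa [hbot] using hx)
    obtain ⟨k, hk⟩ := Module.End.mem_maxGenEigenspace _ _ _ |>.1 hx
    set N : V →L[ℂ] V := f - μ • 1 with hN
    have hNk : ∀ j, k ≤ j → (N ^ j) x = 0 := by
      intro j hj
      have h1 : (N ^ k) x = 0 := by
        rw [← hk]
        have : ∀ (j : ℕ) (y : V), (N ^ j) y = (((f : V →ₗ[ℂ] V) - μ • 1) ^ j) y := by
          intro j
          induction j with
          | zero => intro y; rfl
          | succ j ih =>
            intro y
            rw [pow_succ, pow_succ, mul_apply_eq_comp, Module.End.mul_apply, ih]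
            rfl
        exact this k x
      obtain ⟨m, rfl⟩ := Nat.exists_eq_add_of_le hj
      rw [add_comm, pow_add, mul_apply_eq_comp, h1, map_zero]
    -- On a generalised eigenvector f = μ + N with N nilpotent, so the exponential is e^{tμ} times a
    -- polynomial in t.
    have hsum : ∀ t : ℝ, exp ((t : ℂ) • f) x = ∑ j ∈ Finset.range k,
        (Complex.exp (t * μ) * (t : ℂ) ^ j) • (((j.factorial : ℂ)⁻¹) • (N ^ j) x) := by
      intro t
      have hsplit : (t : ℂ) • f = ((t : ℂ) * μ) • (1 : V →L[ℂ] V) + (t : ℂ) • N := by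
        rw [hN, smul_sub, smul_smul]; abel
      have hcomm : Commute (((t : ℂ) * μ) • (1 : V →L[ℂ] V)) ((t : ℂ) • N) :=
        (Commute.one_left _).smul_left _
      have hscal : exp (((t : ℂ) * μ) • (1 : V →L[ℂ] V)) = Complex.exp (t * μ) • 1 := by
        rw [← Algebra.algebraMap_eq_smul_one, ← algebraMap_exp_comm, Complex.exp_eq_exp_ℂ,
          Algebra.algebraMap_eq_smul_one]
      rw [hsplit, exp_add_of_commute hcomm, hscal, mul_apply_eq_comp]
      have h1 := (exp_series_hasSum_exp' (𝕂 := ℂ) ((t : ℂ) • N)).mapL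
        (ContinuousLinearMap.apply ℂ V x)
      have h2 := h1.unique (hasSum_sum_of_ne_finset_zero (s := Finset.range k) ?_)
      · simp only [ContinuousLinearMap.apply_apply] at h2
        rw [h2]
        simp only [smul_apply, smul_pow, one_apply_eq_self,
          Finset.smul_sum, smul_smul]
        refine Finset.sum_congr rfl fun j _ => ?_
        congr 1
        ring
      · intro j hj
        simp [smul_pow, hNk j (by simpa using hj)]
    simp only [hsum]
    rw [show (0 : V) = ∑ j ∈ Finset.range k, (0 : ℂ) • (((j.factorial : ℂ)⁻¹) • (N ^ j) x) by simp]
    refine tendsto_finsetSum _ fun j _ => Tendsto.smul_const ?_ _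
    rw [tendsto_zero_iff_norm_tendsto_zero]
    refine (tendsto_rpow_mul_exp_neg_mul_atTop_nhds_zero j (-μ.re) (by linarith)).congr' ?_
    filter_upwards [eventually_ge_atTop 0] with t ht
    rw [norm_mul, Complex.norm_exp, norm_pow, Complex.norm_real, Real.norm_of_nonneg ht,
      Real.rpow_natCast, mul_comm]
    simp [mul_comm]

end OperatorExponential

/-! ### The quasi-free Lindblad generator and its commutation relations. -/

noncomputable section QuadraticGenerator

set_option linter.unusedSectionVars false

variable {n ι : Type*} [Fintype n] [DecidableEq n] [Fintype ι] [DecidableEq ι]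

/-- The field operator `∑ v_i g_i`. -/
def fieldOp (g : ι → Matrix n n ℂ) (v : ι → ℂ) : Matrix n n ℂ := ∑ i, v i • g i

/-- The quadratic operator `∑ X_ij g_i g_j`. -/
def quadOp (g : ι → Matrix n n ℂ) (X : Matrix ι ι ℂ) : Matrix n n ℂ :=
  ∑ i, ∑ j, X i j • (g i * g j)

/-- The quasi-free Lindblad generator with Hamiltonian `1/2 ∑ T_ij g_i g_j` and rates `M`. -/
def lindbladian (g : ι → Matrix n n ℂ) (T M : Matrix ι ι ℂ) :
    Matrix n n ℂ →ₗ[ℂ] Matrix n n ℂ where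
  toFun ρ := (-Complex.I / 2) • (quadOp g T * ρ - ρ * quadOp g T) +
    ∑ i, ∑ k, M i k • (g i * ρ * g k - (2⁻¹ : ℂ) • (g k * g i * ρ + ρ * (g k * g i)))
  map_add' x y := by
    have h : ∀ i k, M i k • (g i * (x + y) * g k -
        (2⁻¹ : ℂ) • (g k * g i * (x + y) + (x + y) * (g k * g i))) =
        M i k • (g i * x * g k - (2⁻¹ : ℂ) • (g k * g i * x + x * (g k * g i))) +
        M i k • (g i * y * g k - (2⁻¹ : ℂ) • (g k * g i * y + y * (g k * g i))) := by
      intro i k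
      simp only [mul_add, add_mul]
      module
    rw [Finset.sum_congr rfl fun i _ => Finset.sum_congr rfl fun k _ => h i k]
    simp only [Finset.sum_add_distrib, mul_add, add_mul]
    module
  map_smul' c x := by
    have h : ∀ i k, M i k • (g i * (c • x) * g k -
        (2⁻¹ : ℂ) • (g k * g i * (c • x) + (c • x) * (g k * g i))) =
        c • (M i k • (g i * x * g k - (2⁻¹ : ℂ) • (g k * g i * x + x * (g k * g i)))) := by
      intro i k
      simp only [smul_mul_assoc, mul_smul_comm]
      module
    rw [Finset.sum_congr rfl fun i _ => Finset.sum_congr rfl fun k _ => h i k]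
    simp only [← Finset.smul_sum, smul_mul_assoc, mul_smul_comm, RingHom.id_apply]
    module

lemma lindbladian_apply (g : ι → Matrix n n ℂ) (T M : Matrix ι ι ℂ) (ρ : Matrix n n ℂ) :
    lindbladian g T M ρ = (-Complex.I / 2) • (quadOp g T * ρ - ρ * quadOp g T) +
    ∑ i, ∑ k, M i k • (g i * ρ * g k - (2⁻¹ : ℂ) • (g k * g i * ρ + ρ * (g k * g i))) := rfl

lemma trace_lindbladian (g : ι → Matrix n n ℂ) (T M : Matrix ι ι ℂ) (ρ : Matrix n n ℂ) :
    (lindbladian g T M ρ).trace = 0 := by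
  have h : ∀ i k, (g i * ρ * g k - (2⁻¹ : ℂ) • (g k * g i * ρ + ρ * (g k * g i))).trace = 0 := by
    intro i k
    rw [Matrix.trace_sub, Matrix.trace_smul, Matrix.trace_add, Matrix.trace_mul_comm ρ,
      Matrix.trace_mul_comm (g i * ρ), mul_assoc (g k), smul_eq_mul]
    ring
  simp only [lindbladian_apply, Matrix.trace_add, Matrix.trace_sum, Matrix.trace_smul, h,
    Matrix.trace_sub, Matrix.trace_mul_comm ρ]
  simp

/-- The generator is affine in the rates; the Hamiltonian part must be counted once, hence the zero
in the second summand. -/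
lemma lindbladian_add_rates (g : ι → Matrix n n ℂ) (T M M' : Matrix ι ι ℂ) (ρ : Matrix n n ℂ) :
    lindbladian g T (M + M') ρ = lindbladian g T M ρ + lindbladian g 0 M' ρ := by
  simp only [lindbladian_apply, Matrix.add_apply, add_smul, Finset.sum_add_distrib]
  simp [quadOp, add_assoc]

/-- The matrix driving the one-point functions of the twisted dynamics. -/
def drift (T M : Matrix ι ι ℂ) : Matrix ι ι ℂ :=
  -(Complex.I • (T.transpose - T)) - (M + M.transpose)

namespace IsMajoranaFamily

variable {g : ι → Matrix n n ℂ} {P : Matrix n n ℂ}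

lemma mul_swap (hg : IsMajoranaFamily g P) (i j : ι) :
    g i * g j = (if i = j then 2 else 0 : ℂ) • (1 : Matrix n n ℂ) - g j * g i := by
  rw [← hg.car i j]; abel

lemma commutator_mul (hg : IsMajoranaFamily g P) (i j p : ι) :
    g i * g j * g p - g p * (g i * g j) =
      (if j = p then 2 else 0 : ℂ) • g i - (if i = p then 2 else 0 : ℂ) • g j := by
  rw [mul_assoc, hg.mul_swap j p, mul_sub, ← mul_assoc (g i) (g p), hg.mul_swap i p]
  simp only [sub_mul, smul_mul_assoc, mul_smul_comm, one_mul, mul_one, mul_assoc]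
  abel

/-- Commutation with a quadratic operator preserves the span of the fields, which reduces the
dynamics to one-particle matrices. Only the antisymmetric part of X acts. -/
lemma commutator_quadOp (hg : IsMajoranaFamily g P) (X : Matrix ι ι ℂ) (p : ι) :
    quadOp g X * g p - g p * quadOp g X = ∑ k, (2 * (X k p - X p k)) • g k := by
  have h1 : quadOp g X * g p - g p * quadOp g X =
      ∑ i, ∑ j, X i j • (g i * g j * g p - g p * (g i * g j)) := by
    simp only [quadOp, Finset.sum_mul, Finset.mul_sum, smul_sub, Finset.sum_sub_distrib,
      smul_mul_assoc, mul_smul_comm]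
  rw [h1]
  simp only [hg.commutator_mul, smul_sub, Finset.sum_sub_distrib, smul_smul, mul_sub, sub_smul]
  congr 1
  · refine Finset.sum_congr rfl fun i _ => ?_
    rw [← Finset.sum_smul]
    simp [mul_comm]
  · rw [Finset.sum_comm]
    refine Finset.sum_congr rfl fun i _ => ?_
    rw [← Finset.sum_smul]
    simp [mul_comm]

lemma parity_conj (hg : IsMajoranaFamily g P) (i : ι) : P * g i * P = -g i := by
  rw [hg.parity_anticomm, neg_mul, mul_assoc, hg.parity_mul_self, mul_one]

lemma parity_mul_comm (hg : IsMajoranaFamily g P) (i j : ι) :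
    P * (g i * g j) = g i * g j * P := by
  rw [← mul_assoc, hg.parity_anticomm, neg_mul, mul_assoc, hg.parity_anticomm]
  simp [mul_assoc]

lemma parity_quadOp (hg : IsMajoranaFamily g P) (X : Matrix ι ι ℂ) :
    P * quadOp g X = quadOp g X * P := by
  simp only [quadOp, Finset.mul_sum, Finset.sum_mul, mul_smul_comm, smul_mul_assoc,
    hg.parity_mul_comm]

/-- The generator in the twisted representation obtained by multiplying with the parity. -/
lemma parity_lindbladian (hg : IsMajoranaFamily g P) (T M : Matrix ι ι ℂ) (Y : Matrix n n ℂ) :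
    P * lindbladian g T M (P * Y) = (-Complex.I / 2) • (quadOp g T * Y - Y * quadOp g T) +
      ∑ i, ∑ k, M i k • (-(g i * Y * g k) - (2⁻¹ : ℂ) • (g k * g i * Y + Y * (g k * g i))) := by
  have hPP : ∀ Z : Matrix n n ℂ, P * (P * Z) = Z := fun Z => by
    rw [← mul_assoc, hg.parity_mul_self, one_mul]
  rw [lindbladian_apply]
  simp only [mul_add, Finset.mul_sum, mul_smul_comm, mul_sub]
  congr 2
  · congr 1
    · rw [← mul_assoc, hg.parity_quadOp, mul_assoc, hPP]
    · rw [mul_assoc, hPP]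
  · refine funext fun i => Finset.sum_congr rfl fun k _ => ?_
    congr 2
    · rw [← mul_assoc, ← mul_assoc, ← mul_assoc, hg.parity_conj]
      simp [mul_assoc]
    · congr 2
      · rw [← mul_assoc, hg.parity_mul_comm, mul_assoc, hPP]
      · rw [mul_assoc, hPP]

/-- Carrying g_p out of the jump term crosses one field and reverses the sign, which is the sign of
the jump term in `parity_lindbladian`. The contractions left over, half of them cancelled by the
anticommutator part, are again commutators of Y with fields; they produce the damping. -/
lemma dissipator_commutator (hg : IsMajoranaFamily g P) (i k p : ι) (Y : Matrix n n ℂ) :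
    g i * (Y * g p - g p * Y) * g k - (2⁻¹ : ℂ) • (g k * g i * (Y * g p - g p * Y) +
        (Y * g p - g p * Y) * (g k * g i)) =
      ((-(g i * Y * g k) - (2⁻¹ : ℂ) • (g k * g i * Y + Y * (g k * g i))) * g p -
        g p * (-(g i * Y * g k) - (2⁻¹ : ℂ) • (g k * g i * Y + Y * (g k * g i)))) -
      ((if k = p then 1 else 0 : ℂ) • (Y * g i - g i * Y) +
        (if i = p then 1 else 0 : ℂ) • (Y * g k - g k * Y)) := by
  have h1 : g k * g i * g p = g p * (g k * g i) + ((if i = p then 2 else 0 : ℂ) • g k -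
      (if k = p then 2 else 0 : ℂ) • g i) := by rw [← hg.commutator_mul]; abel
  have h2 : g k * g p = (if k = p then 2 else 0 : ℂ) • (1 : Matrix n n ℂ) - g p * g k :=
    hg.mul_swap k p
  have h3 : g i * g p = (if i = p then 2 else 0 : ℂ) • (1 : Matrix n n ℂ) - g p * g i :=
    hg.mul_swap i p
  have e1 : g k * g i * (g p * Y) = g p * (g k * g i) * Y + ((if i = p then 2 else 0 : ℂ) •
      (g k * Y) - (if k = p then 2 else 0 : ℂ) • (g i * Y)) := by
    rw [← mul_assoc, h1, add_mul, sub_mul, smul_mul_assoc, smul_mul_assoc]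
  have e2 : Y * (g k * g i) * g p = Y * g p * (g k * g i) + ((if i = p then 2 else 0 : ℂ) •
      (Y * g k) - (if k = p then 2 else 0 : ℂ) • (Y * g i)) := by
    rw [mul_assoc, h1, mul_add, mul_sub, mul_smul_comm, mul_smul_comm, mul_assoc]
  have e3 : g i * Y * g k * g p = (if k = p then 2 else 0 : ℂ) • (g i * Y) -
      g i * (Y * g p) * g k := by
    rw [mul_assoc, h2, mul_sub, mul_smul_comm, mul_one]
    simp only [mul_assoc]
  have e4 : g i * (g p * Y) * g k = (if i = p then 2 else 0 : ℂ) • (Y * g k) -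
      g p * (g i * Y * g k) := by
    rw [← mul_assoc, h3, sub_mul, sub_mul, smul_mul_assoc, one_mul, smul_mul_assoc]
    simp only [mul_assoc]
  simp only [mul_sub, sub_mul, mul_add, add_mul, mul_neg, neg_mul, smul_mul_assoc, mul_smul_comm,
    e1, e2, e3, e4]
  simp only [mul_assoc]
  split_ifs <;> module

/-- Commutation of the generator with inner derivations by field operators. -/
lemma lindbladian_commutator (hg : IsMajoranaFamily g P) (T M : Matrix ι ι ℂ) (p : ι)
    (Y : Matrix n n ℂ) :
    lindbladian g T M (Y * g p - g p * Y) =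
      (P * lindbladian g T M (P * Y) * g p - g p * (P * lindbladian g T M (P * Y))) +
      ∑ k, drift T M p k • (Y * g k - g k * Y) := by
  rw [hg.parity_lindbladian, lindbladian_apply]
  simp only [hg.dissipator_commutator]
  have hq : quadOp g T * g p = g p * quadOp g T + ∑ k, (2 * (T k p - T p k)) • g k := by
    rw [← hg.commutator_quadOp]; abel
  have hham : quadOp g T * (Y * g p - g p * Y) - (Y * g p - g p * Y) * quadOp g T =
      ((quadOp g T * Y - Y * quadOp g T) * g p - g p * (quadOp g T * Y - Y * quadOp g T)) +
        ∑ k, (2 * (T k p - T p k)) • (Y * g k - g k * Y) := by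
    have e1 : quadOp g T * (g p * Y) = g p * quadOp g T * Y +
        ∑ k, (2 * (T k p - T p k)) • (g k * Y) := by
      rw [← mul_assoc, hq, add_mul, Finset.sum_mul]
      simp only [smul_mul_assoc]
    have e2 : Y * quadOp g T * g p = Y * g p * quadOp g T +
        ∑ k, (2 * (T k p - T p k)) • (Y * g k) := by
      rw [mul_assoc, hq, mul_add, Finset.mul_sum, mul_assoc]
      simp only [mul_smul_comm]
    simp only [smul_sub, Finset.sum_sub_distrib, mul_sub, sub_mul, e1, e2]
    simp only [mul_assoc]
    abel
  have hdiss : ∑ i, ∑ k, M i k • ((if k = p then 1 else 0 : ℂ) • (Y * g i - g i * Y) +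
        (if i = p then 1 else 0 : ℂ) • (Y * g k - g k * Y)) =
      ∑ k, (M k p + M p k) • (Y * g k - g k * Y) := by
    simp only [smul_add, Finset.sum_add_distrib, smul_smul, add_smul]
    congr 1
    · refine Finset.sum_congr rfl fun i _ => ?_
      rw [← Finset.sum_smul]
      simp
    · rw [Finset.sum_comm]
      refine Finset.sum_congr rfl fun i _ => ?_
      rw [← Finset.sum_smul]
      simp
  have hdrift : ∑ k, drift T M p k • (Y * g k - g k * Y) =
      (-Complex.I / 2) • ∑ k, (2 * (T k p - T p k)) • (Y * g k - g k * Y) -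
        ∑ k, (M k p + M p k) • (Y * g k - g k * Y) := by
    rw [Finset.smul_sum, ← Finset.sum_sub_distrib]
    refine Finset.sum_congr rfl fun k _ => ?_
    rw [smul_smul, ← sub_smul]
    congr 1
    simp [drift]
    ring
  rw [hham, hdrift, ← hdiss]
  generalize ∑ k, (2 * (T k p - T p k)) • (Y * g k - g k * Y) = Q
  have hsub : ∀ A B : ι → ι → Matrix n n ℂ, ∑ i, ∑ k, M i k • (A i k - B i k) =
      ∑ i, ∑ k, M i k • A i k - ∑ i, ∑ k, M i k • B i k := fun A B => by
    simp only [smul_sub, Finset.sum_sub_distrib]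
  have := hsub (fun i k => (-(g i * Y * g k) - (2⁻¹ : ℂ) • (g k * g i * Y + Y * (g k * g i))) * g p -
        g p * (-(g i * Y * g k) - (2⁻¹ : ℂ) • (g k * g i * Y + Y * (g k * g i))))
    (fun i k => (if k = p then 1 else 0 : ℂ) • (Y * g i - g i * Y) +
        (if i = p then 1 else 0 : ℂ) • (Y * g k - g k * Y))
  beta_reduce at this
  rw [this]
  generalize ∑ i, ∑ k, M i k • ((if k = p then 1 else 0 : ℂ) • (Y * g i - g i * Y) +
        (if i = p then 1 else 0 : ℂ) • (Y * g k - g k * Y)) = R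
  simp only [add_mul, mul_add, Finset.sum_mul, Finset.mul_sum, smul_mul_assoc, mul_smul_comm,
    smul_sub, sub_mul, mul_sub, Finset.sum_sub_distrib]
  module

/-- The evolution of the odd linear functionals `ρ ↦ Tr (g_p P ρ)`. -/
lemma trace_field_parity_lindbladian (hg : IsMajoranaFamily g P) (T M : Matrix ι ι ℂ) (p : ι)
    (ρ : Matrix n n ℂ) :
    (g p * P * lindbladian g T M ρ).trace =
      ∑ k, (Complex.I * (T k p - T p k) - (M k p + M p k)) * (g k * P * ρ).trace := by
  -- The parity reverses the sign of the jump term, so the cubic products g_k g_p g_i cancel and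
  -- only contractions with p survive.
  have hdiss : ∀ i k, (g p * P * (g i * ρ * g k - (2⁻¹ : ℂ) •
      (g k * g i * ρ + ρ * (g k * g i)))).trace =
      -((if k = p then 1 else 0) * (g i * P * ρ).trace +
        (if i = p then 1 else 0) * (g k * P * ρ).trace) := by
    intro i k
    have t1 : (g p * P * (g i * ρ * g k)).trace = -(g k * g p * g i * P * ρ).trace := by
      rw [← mul_assoc, Matrix.trace_mul_comm, ← Matrix.trace_neg]
      congr 1
      rw [mul_assoc (g p), ← mul_assoc P, hg.parity_anticomm]
      simp only [mul_assoc, mul_neg, neg_mul]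
    have t2 : (g p * P * (g k * g i * ρ)).trace = (g p * (g k * g i) * P * ρ).trace := by
      rw [← mul_assoc, mul_assoc (g p) P, hg.parity_mul_comm, ← mul_assoc]
    have t3 : (g p * P * (ρ * (g k * g i))).trace = (g k * g i * g p * P * ρ).trace := by
      rw [← mul_assoc, Matrix.trace_mul_comm]
      simp only [mul_assoc]
    rw [mul_sub, mul_smul_comm, mul_add, Matrix.trace_sub, Matrix.trace_smul, Matrix.trace_add,
      t1, t2, t3]
    have e1 : g k * g i * g p = (if i = p then 2 else 0 : ℂ) • g k - g k * g p * g i := by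
      rw [mul_assoc, hg.mul_swap i p, mul_sub, mul_smul_comm, mul_one, mul_assoc]
    have e2 : g p * (g k * g i) = (if k = p then 2 else 0 : ℂ) • g i - g k * g p * g i := by
      rw [← mul_assoc, eq_sub_iff_add_eq, ← add_mul, add_comm, hg.car, smul_mul_assoc, one_mul]
    rw [e1, e2]
    simp only [sub_mul, Matrix.trace_sub, smul_mul_assoc, Matrix.trace_smul, smul_eq_mul]
    split_ifs <;> ring
  have hham : (g p * P * (quadOp g T * ρ - ρ * quadOp g T)).trace =
      -∑ k, (2 * (T k p - T p k)) * (g k * P * ρ).trace := by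
    have : (g p * P * (quadOp g T * ρ - ρ * quadOp g T)).trace =
        -((quadOp g T * g p - g p * quadOp g T) * P * ρ).trace := by
      rw [mul_sub, Matrix.trace_sub, ← mul_assoc (g p * P) ρ, Matrix.trace_mul_comm (g p * P * ρ),
        ← mul_assoc, mul_assoc (g p), hg.parity_quadOp, sub_mul, sub_mul, Matrix.trace_sub]
      simp only [mul_assoc]
      ring
    rw [this, hg.commutator_quadOp]
    simp [Finset.sum_mul, Matrix.trace_sum]
  rw [lindbladian_apply, mul_add, Matrix.trace_add, mul_smul_comm, Matrix.trace_smul, hham]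
  simp only [Finset.mul_sum, mul_smul_comm, Matrix.trace_sum, Matrix.trace_smul, hdiss, smul_eq_mul,
    mul_neg, mul_add, Finset.sum_neg_distrib, Finset.sum_add_distrib]
  have h1 : ∑ i, ∑ k, M i k * ((if k = p then 1 else 0) * (g i * P * ρ).trace) =
      ∑ i, M i p * (g i * P * ρ).trace := by simp
  have h2 : ∑ i, ∑ k, M i k * ((if i = p then 1 else 0) * (g k * P * ρ).trace) =
      ∑ k, M p k * (g k * P * ρ).trace := by
    rw [Finset.sum_comm]; simp
  rw [h1, h2, ← Finset.sum_add_distrib, ← Finset.sum_neg_distrib, ← Finset.sum_neg_distrib,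
    ← Finset.sum_add_distrib]
  refine Finset.sum_congr rfl fun k _ => ?_
  ring

lemma fieldOp_car (hg : IsMajoranaFamily g P) (v w : ι → ℂ) :
    fieldOp g v * fieldOp g w + fieldOp g w * fieldOp g v =
      (2 * ∑ i, v i * w i) • (1 : Matrix n n ℂ) := by
  have h : fieldOp g v * fieldOp g w + fieldOp g w * fieldOp g v =
      ∑ i, ∑ j, (v i * w j) • (g i * g j + g j * g i) := by
    have h1 : ∀ v w : ι → ℂ, fieldOp g v * fieldOp g w = ∑ i, ∑ j, (v i * w j) • (g i * g j) := by
      intro v w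
      simp only [fieldOp, Finset.sum_mul]
      refine Finset.sum_congr rfl fun i _ => ?_
      rw [Finset.mul_sum]
      simp only [smul_mul_assoc, mul_smul_comm, smul_smul]
      refine Finset.sum_congr rfl fun j _ => ?_
      rw [mul_comm]
    rw [h1, h1, Finset.sum_comm (f := fun i j => (w i * v j) • (g i * g j))]
    simp only [smul_add, Finset.sum_add_distrib, mul_comm]
  rw [h]
  simp only [hg.car, smul_smul, ← Finset.sum_smul, Finset.mul_sum]
  congr 1
  refine Finset.sum_congr rfl fun i _ => ?_
  simp [mul_comm]

/-- The CAR are bilinear in the coefficients, so v is paired with its complex conjugate: the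
anticommutator is 2‖v‖² times the identity. -/
lemma fieldOp_ne_zero [Nonempty n] (hg : IsMajoranaFamily g P) {v : ι → ℂ} (hv : v ≠ 0) :
    fieldOp g v ≠ 0 := by
  intro h0
  have h := hg.fieldOp_car v (star v)
  rw [h0, zero_mul, mul_zero, add_zero] at h
  have h1 : (2 * ∑ i, v i * star v i : ℂ) ≠ 0 := by
    have : (v ⬝ᵥ star v) ≠ 0 := fun h => hv (dotProduct_self_star_eq_zero.1 h)
    simpa [dotProduct] using this
  exact h1 (by simpa using h.symm)

end IsMajoranaFamily

end QuadraticGenerator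

/-! ### Positive matrices, compactness of the set of states, and even states. -/

section States

open Filter Matrix

variable {n : Type*} [Fintype n]

lemma isClosed_posSemidef : IsClosed {X : Matrix n n ℂ | X.PosSemidef} := by
  have h : {X : Matrix n n ℂ | X.PosSemidef} =
      {X | X.conjTranspose = X} ∩ ⋂ x : n → ℂ, {X | 0 ≤ star x ⬝ᵥ (X *ᵥ x)} := by
    ext X
    simp [posSemidef_iff_dotProduct_mulVec, IsHermitian]
  rw [h]
  refine (isClosed_eq continuous_id.matrix_conjTranspose continuous_id).inter
    (isClosed_iInter fun x => isClosed_le continuous_const ?_)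
  exact continuous_const.dotProduct (continuous_id.matrix_mulVec continuous_const)

lemma isClosed_isState : IsClosed {X : Matrix n n ℂ | IsState X} :=
  isClosed_posSemidef.inter (isClosed_eq continuous_id.matrix_trace continuous_const)

lemma Matrix.PosSemidef.norm_apply_le_trace [DecidableEq n] {A : Matrix n n ℂ}
    (hA : A.PosSemidef) (i j : n) : ‖A i j‖ ≤ A.trace.re := by
  have hdiag : ∀ k, 0 ≤ (A k k).re := fun k => (Complex.le_def.1 hA.diag_nonneg).1
  have hle : ∀ k, (A k k).re ≤ A.trace.re := by
    intro k
    rw [Matrix.trace, Complex.re_sum]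
    exact Finset.single_le_sum (f := fun k => (A k k).re) (fun k _ => hdiag k) (Finset.mem_univ k)
  rcases eq_or_ne (A i j) 0 with h0 | h0
  · rw [h0, norm_zero]
    exact (hdiag i).trans (hle i)
  -- This phase makes both cross terms equal to -|A_ij| in the quadratic form at e_i + c e_j, whence
  -- 2|A_ij| ≤ A_ii + A_jj.
  set c : ℂ := -(star (A i j)) / ‖A i j‖ with hc
  have hn : (‖A i j‖ : ℂ) ≠ 0 := by simpa using h0
  have hsq : A i j * star (A i j) = (‖A i j‖ : ℂ) ^ 2 := Complex.mul_conj' _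
  have hji : A j i = star (A i j) := by rw [← hA.1.apply]
  have h := (Complex.le_def.1 (hA.dotProduct_mulVec_nonneg (Pi.single i 1 + Pi.single j c))).1
  have hval : star (Pi.single i 1 + Pi.single j c) ⬝ᵥ (A *ᵥ (Pi.single i 1 + Pi.single j c)) =
      A i i + c * A i j + star c * A j i + star c * c * A j j := by
    simp only [star_add, Pi.star_single, star_one, add_dotProduct, mulVec_add, dotProduct_add,
      single_dotProduct, mulVec_single, one_mul]
    simp
    ring
  have h1 : c * A i j = -(‖A i j‖ : ℂ) := by
    rw [hc]
    field_simp
    linear_combination -hsq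
  have h2 : star c * A j i = -(‖A i j‖ : ℂ) := by
    rw [hc, hji]
    simp only [star_div₀, star_neg, star_star]
    rw [show star (‖A i j‖ : ℂ) = (‖A i j‖ : ℂ) from Complex.conj_ofReal _]
    field_simp
    linear_combination -hsq
  have h3 : star c * c = 1 := by
    rw [hc]
    simp only [star_div₀, star_neg, star_star]
    rw [show star (‖A i j‖ : ℂ) = (‖A i j‖ : ℂ) from Complex.conj_ofReal _]
    field_simp
    linear_combination hsq
  rw [hval, h1, h2, h3] at h
  simp at h
  have := hle i
  have := hle j
  linarith

lemma exists_norm_apply_le_of_isState [DecidableEq n] {A : Matrix n n ℂ} (hA : IsState A)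
    (i j : n) : ‖A i j‖ ≤ 1 := by
  have := hA.1.norm_apply_le_trace i j
  rwa [hA.2, Complex.one_re] at this

lemma isCompact_isState [DecidableEq n] : IsCompact {X : Matrix n n ℂ | IsState X} := by
  have hK : IsCompact (Set.univ.pi fun _ : n => Set.univ.pi fun _ : n =>
      Metric.closedBall (0 : ℂ) 1) :=
    isCompact_univ_pi fun _ => isCompact_univ_pi fun _ => isCompact_closedBall 0 1
  refine IsCompact.of_isClosed_subset hK isClosed_isState ?_
  intro X hX i _ j _
  simpa using exists_norm_apply_le_of_isState hX i j

/-- Every matrix is a linear combination of four positive semidefinite ones. -/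
lemma four_smul_eq_sum_posSemidef [DecidableEq n] (X : Matrix n n ℂ) :
    (4 : ℂ) • X = ∑ k : Fin 4, Complex.I ^ (k : ℕ) •
      ((X + Complex.I ^ (k : ℕ) • 1).conjTranspose * (X + Complex.I ^ (k : ℕ) • 1)) := by
  simp only [Fin.sum_univ_four, Fin.val_zero, Fin.val_one, Fin.val_two, pow_zero, pow_one,
    Complex.I_sq, show ((3 : Fin 4) : ℕ) = 3 from rfl, Complex.I_pow_three,
    conjTranspose_add, conjTranspose_smul, conjTranspose_one, add_mul, mul_add, smul_mul_assoc,
    mul_smul_comm, one_mul, mul_one, smul_add, smul_smul]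
  simp
  match_scalars <;> linear_combination 0 * Complex.I_mul_I

/-- By polarization, properties stable under linear combinations pass from positive matrices, where
trace bounds are available, to all matrices. -/
lemma posSemidef_induction [DecidableEq n] {p : Matrix n n ℂ → Prop}
    (hpos : ∀ X, X.PosSemidef → p X) (hadd : ∀ X Y, p X → p Y → p (X + Y))
    (hsmul : ∀ (c : ℂ) X, p X → p (c • X)) (X : Matrix n n ℂ) : p X := by
  have h : X = (4 : ℂ)⁻¹ • ∑ k : Fin 4, Complex.I ^ (k : ℕ) •
      ((X + Complex.I ^ (k : ℕ) • 1).conjTranspose * (X + Complex.I ^ (k : ℕ) • 1)) := by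
    rw [← four_smul_eq_sum_posSemidef, smul_smul]; norm_num
  rw [h]
  refine hsmul _ _ (Finset.sum_induction _ p hadd ?_ fun k _ =>
    hsmul _ _ (hpos _ (posSemidef_conjTranspose_mul_self _)))
  exact hpos 0 PosSemidef.zero

variable {L : ℕ}

/-- The exponential is the square of the Hermitian matrix exp(X/2), and it is invertible. -/
lemma posDef_exp [DecidableEq n] {X : Matrix n n ℂ} (hX : X.IsHermitian) :
    (NormedSpace.exp X).PosDef := by
  have hhalf : ((2⁻¹ : ℂ) • X).IsHermitian := by
    rw [IsHermitian, conjTranspose_smul, hX.eq]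
    simp
  have hsplit : NormedSpace.exp X = (NormedSpace.exp ((2⁻¹ : ℂ) • X)).conjTranspose *
      NormedSpace.exp ((2⁻¹ : ℂ) • X) := by
    rw [hhalf.exp.eq, ← Matrix.exp_add_of_commute _ _ (Commute.refl _), ← add_smul]
    norm_num
  have hpsd : (NormedSpace.exp X).PosSemidef := by
    rw [hsplit]; exact posSemidef_conjTranspose_mul_self _
  exact hpsd.posDef_iff_isUnit.2 (Matrix.isUnit_exp X)

lemma isState_normalize [Nonempty n] {X : Matrix n n ℂ} (hX : X.PosDef) :
    IsState (X.trace⁻¹ • X) := by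
  have hpos : 0 < X.trace := hX.trace_pos
  refine ⟨hX.posSemidef.smul (inv_nonneg.2 hpos.le), ?_⟩
  rw [trace_smul, smul_eq_mul, inv_mul_cancel₀ hpos.ne']

lemma IsGaussian.isState {ρ : FockOp L} (h : IsGaussian ρ) : IsState ρ := by
  obtain ⟨β, H, hH, rfl⟩ := h
  apply isState_normalize
  apply posDef_exp
  rw [IsHermitian, conjTranspose_smul, hH.1.eq]
  simp

/-- A quadratic Hamiltonian is even, hence so is its exponential. Evenness is a closed condition and
passes to quasi-free states. -/
lemma IsGaussian.parity_comm {ρ : FockOp L} (h : IsGaussian ρ) :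
    parityOp L * ρ = ρ * parityOp L := by
  obtain ⟨β, H, ⟨-, T, rfl⟩, rfl⟩ := h
  have h1 : Commute (parityOp L) (-(β : ℂ) • quadOp majorana T) :=
    Commute.smul_right (isMajoranaFamily_majorana.parity_quadOp T) _
  exact (h1.exp_right.smul_right _).eq

lemma IsQuasiFree.isState {ρ : FockOp L} (h : IsQuasiFree ρ) : IsState ρ :=
  closure_minimal (fun _ hσ => IsGaussian.isState hσ) isClosed_isState h

lemma IsQuasiFree.parity_comm {ρ : FockOp L} (h : IsQuasiFree ρ) :
    parityOp L * ρ = ρ * parityOp L :=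
  closure_minimal (t := {σ : FockOp L | parityOp L * σ = σ * parityOp L})
    (fun _ hσ => IsGaussian.parity_comm hσ)
    (isClosed_eq (continuous_const.matrix_mul continuous_id)
      (continuous_id.matrix_mul continuous_const)) h

/-- Conjugation by the parity fixes ω and reverses the field, so the one-point function equals its
own negative. -/
lemma IsMajoranaFamily.trace_mul_eq_zero [DecidableEq n] {ι : Type*} [Fintype ι] [DecidableEq ι]
    {g : ι → Matrix n n ℂ} {P ω : Matrix n n ℂ}
    (hg : IsMajoranaFamily g P) (hω : P * ω = ω * P) (i : ι) : (g i * ω).trace = 0 := by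
  have h : (g i * ω).trace = -(g i * ω).trace := by
    calc (g i * ω).trace = (P * (P * (g i * ω))).trace := by
          rw [← mul_assoc, hg.parity_mul_self, one_mul]
      _ = (P * (g i * ω) * P).trace := Matrix.trace_mul_comm _ _
      _ = (-(g i * (ω * (P * P)))).trace := by
          congr 1
          rw [← mul_assoc, hg.parity_anticomm, neg_mul, neg_mul, mul_assoc (g i), hω]
          simp only [mul_assoc]
      _ = -(g i * ω).trace := by rw [hg.parity_mul_self, mul_one, Matrix.trace_neg]
  linear_combination h / 2

end States

/-! ### The partial trace over the bath. -/

section PartialTrace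

open Matrix

variable {L K : ℕ}

lemma traceBath_kronecker (A : FockOp L) (B : FockOp K) :
    traceBath (A ⊗ₖ B) = B.trace • A := by
  ext s u
  simp [traceBath, Matrix.trace, mul_comm, Finset.mul_sum]

/-- The partial trace as a linear map. -/
def traceBathLin : JointOp L K →ₗ[ℂ] FockOp L where
  toFun := traceBath
  map_add' X Y := by
    ext s u
    simp [traceBath, Finset.sum_add_distrib]
  map_smul' c X := by
    ext s u
    simp [traceBath, Finset.mul_sum]

lemma traceBathLin_apply (X : JointOp L K) : traceBathLin X = traceBath X := rfl

lemma posSemidef_traceBath {X : JointOp L K} (hX : X.PosSemidef) : (traceBath X).PosSemidef := by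
  have h : traceBath X = ∑ b, X.submatrix (fun s => (s, b)) (fun s => (s, b)) := by
    ext s u
    simp [traceBath, Matrix.sum_apply]
  rw [h]
  exact posSemidef_sum _ fun b _ => hX.submatrix _

end PartialTrace

/-! ### A common form for the two identifications. -/

noncomputable section Identifications

open Matrix

variable {L K : ℕ}

/-- The fields by which the bath acts on the system. -/
def sysField (E : Identification) (i : Fin L ⊕ Fin L) : FockOp L :=
  match E with
  | Identification.SB => Complex.I • (majorana i * parityOp L)
  | Identification.BS => majorana i

/-- The fields by which the system acts on the bath. -/
def auxField (E : Identification) (j : Fin K ⊕ Fin K) : FockOp K :=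
  match E with
  | Identification.SB => majorana j
  | Identification.BS => Complex.I • (parityOp K * majorana j)

lemma majorana_parity_mul (i j : Fin L ⊕ Fin L) :
    majorana i * parityOp L * (majorana j * parityOp L) = -(majorana i * majorana j) := by
  rw [mul_assoc, ← mul_assoc (parityOp L), parityOp_anticomm, neg_mul, mul_assoc,
    parityOp_mul_self, mul_one, mul_neg]

lemma parity_majorana_mul (i j : Fin L ⊕ Fin L) :
    parityOp L * majorana i * (parityOp L * majorana j) = -(majorana i * majorana j) := by
  rw [parityOp_anticomm, neg_mul, mul_assoc, ← mul_assoc (parityOp L), parityOp_mul_self, one_mul]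

/-- The two parities cancel with a sign that i² compensates. Even operators, in particular quadratic
Hamiltonians, are thus the same for both identifications. -/
lemma sysField_mul (E : Identification) (i j : Fin L ⊕ Fin L) :
    sysField E i * sysField E j = majorana i * majorana j := by
  cases E
  · simp [sysField, majorana_parity_mul, smul_smul]
  · rfl

lemma auxField_mul (E : Identification) (i j : Fin K ⊕ Fin K) :
    auxField E i * auxField E j = majorana i * majorana j := by
  cases E
  · rfl
  · simp [auxField, parity_majorana_mul, smul_smul]

/-- The factor i restores self-adjointness, since γ_i and the parity anticommute. From here on both
identifications are handled at once. -/
lemma isMajoranaFamily_sysField (E : Identification) :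
    IsMajoranaFamily (sysField (L := L) E) (parityOp L) where
  conjTranspose i := by
    cases E
    · simp [sysField, majorana_conjTranspose, parityOp_conjTranspose, parityOp_anticomm]
    · exact majorana_conjTranspose i
  car i j := by rw [sysField_mul, sysField_mul, majorana_car]
  parity_conjTranspose := parityOp_conjTranspose
  parity_mul_self := parityOp_mul_self
  parity_anticomm i := by
    cases E
    · simp [sysField, ← mul_assoc, parityOp_anticomm]
    · exact parityOp_anticomm i

lemma isMajoranaFamily_auxField (E : Identification) :
    IsMajoranaFamily (auxField (K := K) E) (parityOp K) where
  conjTranspose i := by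
    cases E
    · exact majorana_conjTranspose i
    · simp [auxField, majorana_conjTranspose, parityOp_conjTranspose, parityOp_anticomm]
  car i j := by rw [auxField_mul, auxField_mul, majorana_car]
  parity_conjTranspose := parityOp_conjTranspose
  parity_mul_self := parityOp_mul_self
  parity_anticomm i := by
    cases E
    · exact parityOp_anticomm i
    · have h : majorana i * parityOp K = -(parityOp K * majorana i) := by
        rw [parityOp_anticomm, neg_neg]
      simp [auxField, mul_assoc, h]

/-- Commuting with the products of two fields already forces commutation with the parity, which can
then be removed from the twisted fields. -/
lemma eq_smul_one_of_commute_sysField (E : Identification) {Z : FockOp L}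
    (hZ : ∀ a, Z * sysField E a = sysField E a * Z) : ∃ c : ℂ, Z = c • (1 : FockOp L) := by
  have heven : ∀ a b, Z * (majorana a * majorana b) = majorana a * majorana b * Z := by
    intro a b
    rw [← sysField_mul E, ← mul_assoc, hZ, mul_assoc, hZ, mul_assoc]
  have hP := commute_parityOp_of_commute_even heven
  refine eq_smul_one_of_commute_majorana fun a => ?_
  cases E
  · have h := hZ a
    simp only [sysField, mul_smul_comm, smul_mul_assoc] at h
    have h' := smul_right_injective _ Complex.I_ne_zero h
    calc Z * majorana a = Z * (majorana a * parityOp L) * parityOp L := by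
          rw [mul_assoc, mul_assoc, parityOp_mul_self, mul_one]
      _ = majorana a * Z := by
          rw [h', mul_assoc (majorana a), ← hP, ← mul_assoc, mul_assoc, parityOp_mul_self, mul_one]
  · exact hZ a

/-- The factor i of Θ = iW is absorbed by whichever field carries the parity. The coupling becomes a
real combination of tensor products of self-adjoint operators. -/
lemma totalHamiltonian_eq (E : Identification)
    (TS : Matrix (Fin L ⊕ Fin L) (Fin L ⊕ Fin L) ℂ)
    (TB : Matrix (Fin K ⊕ Fin K) (Fin K ⊕ Fin K) ℂ)
    (W : Matrix (Fin L ⊕ Fin L) (Fin K ⊕ Fin K) ℝ) (lam : ℝ) :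
    totalHamiltonian E TS TB (imagMatrix W) lam =
      (((1 / 2 : ℂ) • quadOp (sysField E) TS) ⊗ₖ (1 : FockOp K) +
        (1 : FockOp L) ⊗ₖ ((1 / 2 : ℂ) • quadOp (auxField E) TB)) +
      (lam : ℂ) • ∑ i, sysField E i ⊗ₖ fieldOp (auxField E) (fun j => (W i j : ℂ)) := by
  have hS : ∀ i j : Fin L ⊕ Fin L, systemField (K := K) E i * systemField E j =
      (sysField E i * sysField E j) ⊗ₖ (1 : FockOp K) := by
    intro i j
    rw [sysField_mul]
    cases E
    · simp [systemField, ← mul_kronecker_mul]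
    · simp [systemField, ← mul_kronecker_mul, parityOp_mul_self]
  have hB : ∀ i j : Fin K ⊕ Fin K, bathField (L := L) E i * bathField E j =
      (1 : FockOp L) ⊗ₖ (auxField E i * auxField E j) := by
    intro i j
    rw [auxField_mul]
    cases E
    · simp [bathField, ← mul_kronecker_mul, parityOp_mul_self]
    · simp [bathField, ← mul_kronecker_mul]
  have hV : ∀ i j, imagMatrix W i j • (systemField E i * bathField E j) =
      (W i j : ℂ) • (sysField E i ⊗ₖ auxField (K := K) E j) := by
    intro i j
    cases E <;> simp [systemField, bathField, sysField, auxField, ← mul_kronecker_mul, imagMatrix,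
      smul_kronecker, kronecker_smul, smul_smul, mul_comm]
  have hsumS : ∑ i, ∑ j, TS i j • ((sysField E i * sysField E j) ⊗ₖ (1 : FockOp K)) =
      quadOp (sysField E) TS ⊗ₖ (1 : FockOp K) := by
    ext ⟨a, b⟩ ⟨c, d⟩
    simp only [quadOp, Matrix.sum_apply, Finset.sum_mul, Matrix.smul_apply, kroneckerMap_apply,
      smul_eq_mul, mul_assoc]
  have hsumB : ∑ i, ∑ j, TB i j • ((1 : FockOp L) ⊗ₖ (auxField E i * auxField E j)) =
      (1 : FockOp L) ⊗ₖ quadOp (auxField E) TB := by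
    ext ⟨a, b⟩ ⟨c, d⟩
    simp only [quadOp, Matrix.sum_apply, Finset.mul_sum, Matrix.smul_apply, kroneckerMap_apply,
      smul_eq_mul, mul_left_comm]
  have hsumV : ∑ i, ∑ j, (W i j : ℂ) • (sysField E i ⊗ₖ auxField (K := K) E j) =
      ∑ i, sysField E i ⊗ₖ fieldOp (auxField E) (fun j => (W i j : ℂ)) := by
    ext ⟨a, b⟩ ⟨c, d⟩
    simp only [fieldOp, Matrix.sum_apply, Finset.mul_sum, Matrix.smul_apply, kroneckerMap_apply,
      smul_eq_mul, mul_left_comm]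
  simp only [totalHamiltonian, hS, hB, hV, hsumS, hsumB, hsumV, smul_kronecker, kronecker_smul]
  abel

end Identifications

/-! ### Conjugation as the exponential of a commutator. -/

noncomputable section Conjugation

open NormedSpace

variable {R : Type*} [NormedRing R] [NormedAlgebra ℂ R]

/-- The commutator with `Z` as a continuous linear map. -/
def commutatorCLM (Z : R) : R →L[ℂ] R :=
  ContinuousLinearMap.mul ℂ R Z - (ContinuousLinearMap.mul ℂ R).flip Z

lemma commutatorCLM_apply (Z X : R) : commutatorCLM Z X = Z * X - X * Z := rfl

lemma commutatorCLM_smul (c : ℂ) (Z : R) : commutatorCLM (c • Z) = c • commutatorCLM Z := by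
  ext X
  simp [commutatorCLM_apply, smul_sub]

lemma commutatorCLM_add (Y Z : R) :
    commutatorCLM (Y + Z) = commutatorCLM Y + commutatorCLM Z := by
  ext X
  simp only [commutatorCLM_apply, add_apply, add_mul, mul_add]
  abel

lemma exp_mul_clm_apply [CompleteSpace R] (Y X : R) :
    exp (ContinuousLinearMap.mul ℂ R Y) X = exp Y * X := by
  have h1 := (exp_series_hasSum_exp' (𝕂 := ℂ) (ContinuousLinearMap.mul ℂ R Y)).mapL
    (ContinuousLinearMap.apply ℂ R X)
  have h2 := (exp_series_hasSum_exp' (𝕂 := ℂ) Y).mapL ((ContinuousLinearMap.mul ℂ R).flip X)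
  have hpow : ∀ n : ℕ, ((ContinuousLinearMap.mul ℂ R Y) ^ n) X = Y ^ n * X := by
    intro n
    induction n with
    | zero => simp
    | succ n ih =>
      rw [pow_succ', pow_succ', mul_apply_eq_comp, ih, ContinuousLinearMap.mul_apply', mul_assoc]
  simp only [ContinuousLinearMap.apply_apply, map_smul, hpow,
    ContinuousLinearMap.flip_apply, ContinuousLinearMap.mul_apply'] at h1 h2
  exact h1.unique h2

/-- Left and right multiplications commute, so the exponential of their difference factorises. -/
theorem exp_commutatorCLM_apply [CompleteSpace R] (Z X : R) :
    exp (commutatorCLM Z) X = exp Z * X * exp (-Z) := by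
  let _ : NormedAlgebra ℚ (R →L[ℂ] R) := NormedAlgebra.restrictScalars ℚ ℂ _
  have hright : ∀ Y X : R, exp ((ContinuousLinearMap.mul ℂ R).flip Y) X = X * exp Y := by
    intro Y X
    have h1 := (exp_series_hasSum_exp' (𝕂 := ℂ) ((ContinuousLinearMap.mul ℂ R).flip Y)).mapL
      (ContinuousLinearMap.apply ℂ R X)
    have h2 := (exp_series_hasSum_exp' (𝕂 := ℂ) Y).mapL (ContinuousLinearMap.mul ℂ R X)
    have hpow : ∀ n : ℕ, (((ContinuousLinearMap.mul ℂ R).flip Y) ^ n) X = X * Y ^ n := by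
      intro n
      induction n with
      | zero => simp
      | succ n ih =>
        rw [pow_succ', pow_succ, mul_apply_eq_comp, ih, ContinuousLinearMap.flip_apply,
          ContinuousLinearMap.mul_apply', mul_assoc]
    simp only [ContinuousLinearMap.apply_apply, map_smul, hpow,
      ContinuousLinearMap.mul_apply'] at h1 h2
    exact h1.unique h2
  have hsplit : commutatorCLM Z = ContinuousLinearMap.mul ℂ R Z +
      (ContinuousLinearMap.mul ℂ R).flip (-Z) := by
    rw [commutatorCLM, map_neg, sub_eq_add_neg]
  have hcomm : Commute (ContinuousLinearMap.mul ℂ R Z)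
      ((ContinuousLinearMap.mul ℂ R).flip (-Z)) := by
    ext X
    simp [mul_apply_eq_comp, mul_assoc]
  rw [hsplit, exp_add_of_commute hcomm, mul_apply_eq_comp, hright, exp_mul_clm_apply, mul_assoc]

/-- A linear map intertwining multiplication by `Y` with the commutator by `Z` intertwines
their exponentials. -/
theorem exp_mul_map_one_of_intertwine {S : Type*} [NormedRing S] [NormedAlgebra ℂ S]
    [FiniteDimensional ℂ S] [FiniteDimensional ℂ R] (φ : S →ₗ[ℂ] R) {Y : S} {Z : R}
    (h : ∀ X, φ (Y * X) = Z * φ X - φ X * Z) : exp Z * φ 1 = φ (exp Y) * exp Z := by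
  have : CompleteSpace S := FiniteDimensional.complete ℂ S
  have : CompleteSpace R := FiniteDimensional.complete ℂ R
  let _ : NormedAlgebra ℚ R := NormedAlgebra.restrictScalars ℚ ℂ R
  have h1 := map_exp_apply_of_intertwine (ContinuousLinearMap.mul ℂ S Y) (commutatorCLM Z)
    (LinearMap.toContinuousLinearMap φ) h 1
  rw [exp_commutatorCLM_apply, exp_mul_clm_apply, mul_one] at h1
  have h2 : φ (exp Y) = exp Z * φ 1 * exp (-Z) := h1
  have h3 : exp (-Z) * exp Z = 1 := by
    rw [← exp_add_of_commute (Commute.neg_left (Commute.refl Z)), neg_add_cancel, exp_zero]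
  rw [h2, mul_assoc, h3, mul_one]

end Conjugation

/-! ### Linear flows, intertwining, and the weak-coupling limit. -/

noncomputable section Flow

open Filter NormedSpace

variable {V U : Type*} [NormedAddCommGroup V] [NormedSpace ℂ V] [FiniteDimensional ℂ V]
  [NormedAddCommGroup U] [NormedSpace ℂ U] [FiniteDimensional ℂ U]

/-- The one-parameter group generated by a linear map on a finite-dimensional space. -/
def linearFlow (G : V →ₗ[ℂ] V) (t : ℝ) : V →ₗ[ℂ] V :=
  (exp ((t : ℂ) • LinearMap.toContinuousLinearMap G) : V →L[ℂ] V)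

lemma linearFlow_apply (G : V →ₗ[ℂ] V) (t : ℝ) (v : V) :
    linearFlow G t v = exp ((t : ℂ) • LinearMap.toContinuousLinearMap G) v := rfl

lemma map_linearFlow (G : V →ₗ[ℂ] V) (F : U →ₗ[ℂ] U) (φ : V →ₗ[ℂ] U)
    (h : ∀ v, φ (G v) = F (φ v)) (t : ℝ) (v : V) :
    φ (linearFlow G t v) = linearFlow F t (φ v) := by
  have : CompleteSpace U := FiniteDimensional.complete ℂ U
  have : CompleteSpace V := FiniteDimensional.complete ℂ V
  refine map_exp_apply_of_intertwine ((t : ℂ) • LinearMap.toContinuousLinearMap G)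
    ((t : ℂ) • LinearMap.toContinuousLinearMap F) (LinearMap.toContinuousLinearMap φ)
    (fun v => ?_) v
  simp [h]

lemma linearFlow_smul_id (κ : ℂ) (t : ℝ) (z : ℂ) :
    linearFlow (κ • LinearMap.id : ℂ →ₗ[ℂ] ℂ) t z = Complex.exp (t * κ) * z := by
  have h : (t : ℂ) • LinearMap.toContinuousLinearMap (κ • LinearMap.id : ℂ →ₗ[ℂ] ℂ) =
      algebraMap ℂ (ℂ →L[ℂ] ℂ) (t * κ) := by
    ext
    simp
  rw [linearFlow_apply, h, ← algebraMap_exp_comm, Complex.exp_eq_exp_ℂ]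
  simp

lemma map_linearFlow_of_eigenfunctional (G : V →ₗ[ℂ] V) (φ : V →ₗ[ℂ] ℂ) (κ : ℂ)
    (h : ∀ v, φ (G v) = κ * φ v) (t : ℝ) (v : V) :
    φ (linearFlow G t v) = Complex.exp (t * κ) * φ v := by
  rw [map_linearFlow G (κ • LinearMap.id) φ (by simpa using h), linearFlow_smul_id]

lemma linearFlow_of_eq_zero (G : V →ₗ[ℂ] V) {v : V} (h : G v = 0) (t : ℝ) :
    linearFlow G t v = v := by
  -- The map z ↦ z v intertwines the zero generator on ℂ with G.
  have h1 := map_linearFlow ((0 : ℂ) • LinearMap.id : ℂ →ₗ[ℂ] ℂ) G (LinearMap.toSpanSingleton ℂ V v)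
    (by simp [h]) t 1
  rw [linearFlow_smul_id] at h1
  simpa using h1.symm

lemma linearFlow_add_of_commute (F G : V →ₗ[ℂ] V) (h : ∀ v, F (G v) = G (F v)) (t : ℝ) (v : V) :
    linearFlow (F + G) t v = linearFlow F t (linearFlow G t v) := by
  have : CompleteSpace V := FiniteDimensional.complete ℂ V
  let _ : NormedAlgebra ℚ (V →L[ℂ] V) := NormedAlgebra.restrictScalars ℚ ℂ _
  have hcomm : Commute ((t : ℂ) • LinearMap.toContinuousLinearMap F)
      ((t : ℂ) • LinearMap.toContinuousLinearMap G) := by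
    refine ((show Commute (LinearMap.toContinuousLinearMap F) (LinearMap.toContinuousLinearMap G)
      from ?_).smul_left _).smul_right _
    ext v
    simp [mul_apply_eq_comp, h]
  rw [linearFlow_apply, map_add, smul_add, exp_add_of_commute hcomm, mul_apply_eq_comp]
  rfl

lemma tendsto_linearFlow_zero (G : V →ₗ[ℂ] V)
    (hG : ∀ μ : ℂ, Module.End.HasEigenvalue G μ → μ.re < 0) (v : V) :
    Tendsto (fun t : ℝ => linearFlow G t v) atTop (𝓝 0) :=
  tendsto_exp_apply_zero (LinearMap.toContinuousLinearMap G) (by simpa using hG) v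

/-- A flow decays on the ranges of maps `D_p` which it intertwines, up to a decaying
matrix flow, with a bounded flow. -/
theorem tendsto_linearFlow_range {ι : Type*} [Fintype ι] [DecidableEq ι] (G G' : V →ₗ[ℂ] V)
    (D : ι → V →ₗ[ℂ] V) (B : Matrix ι ι ℂ)
    (hD : ∀ p Y, G (D p Y) = D p (G' Y) + ∑ k, B p k • D k Y)
    (hbdd : ∀ Y, ∃ C : ℝ, ∀ t : ℝ, 0 ≤ t → ‖linearFlow G' t Y‖ ≤ C)
    (hB : ∀ μ : ℂ, Module.End.HasEigenvalue (Matrix.toLin' B.transpose) μ → μ.re < 0)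
    (p : ι) (Y : V) :
    Tendsto (fun t : ℝ => linearFlow G t (D p Y)) atTop (𝓝 0) := by
  -- The D_k are assembled into one map Ψ on ι → V. It intertwines G with F + M, where F applies G'
  -- to each component and M mixes the components with scalar coefficients, so that F and M commute.
  let Ψ : (ι → V) →ₗ[ℂ] V := ∑ k, (D k).comp (LinearMap.proj k)
  have hΨ : ∀ Z : ι → V, Ψ Z = ∑ k, D k (Z k) := fun Z => by simp [Ψ]
  let F : (ι → V) →ₗ[ℂ] (ι → V) := LinearMap.pi fun k => G'.comp (LinearMap.proj k)
  let M : (ι → V) →ₗ[ℂ] (ι → V) := LinearMap.pi fun k => ∑ q, B q k • LinearMap.proj q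
  have hF : ∀ Z k, F Z k = G' (Z k) := fun Z k => rfl
  have hM : ∀ Z k, M Z k = ∑ q, B q k • Z q := fun Z k => by simp [M]
  have hint : ∀ Z, Ψ ((F + M) Z) = G (Ψ Z) := by
    intro Z
    rw [LinearMap.add_apply, map_add, hΨ, hΨ, hΨ, map_sum]
    simp only [hD, Finset.sum_add_distrib, hF, hM, map_sum, map_smul]
    rw [Finset.sum_comm]
  have hcomm : ∀ Z, F (M Z) = M (F Z) := by
    intro Z
    ext k
    simp [hF, hM]
  let φ : (ι → ℂ) →ₗ[ℂ] (ι → V) := LinearMap.pi fun k => (LinearMap.proj k).smulRight Y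
  have hφ : ∀ w k, φ w k = w k • Y := fun w k => rfl
  have hφM : ∀ w, φ (Matrix.toLin' B.transpose w) = M (φ w) := by
    intro w
    ext k
    rw [hφ, hM, Matrix.toLin'_apply, Matrix.mulVec, dotProduct, Finset.sum_smul]
    refine Finset.sum_congr rfl fun q _ => ?_
    rw [hφ, smul_smul, Matrix.transpose_apply]
  set w : ℝ → ι → ℂ := fun t => linearFlow (Matrix.toLin' B.transpose) t (Pi.single p 1) with hw
  -- Because F and M commute, the flow of F + M factorises into the scalar flow of Bᵀ, started at
  -- e_p, and the flow of G' on Y.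
  have hformula : ∀ t, linearFlow G t (D p Y) = ∑ k, w t k • D k (linearFlow G' t Y) := by
    intro t
    have hstart : D p Y = Ψ (φ (Pi.single p 1)) := by
      rw [hΨ, Finset.sum_eq_single p]
      · simp [hφ]
      · intro k _ hk
        simp [hφ, hk]
      · simp
    rw [hstart, ← map_linearFlow (F + M) G Ψ hint, linearFlow_add_of_commute F M hcomm,
      ← map_linearFlow _ M φ hφM, hΨ]
    refine Finset.sum_congr rfl fun k _ => ?_
    have h1 := map_linearFlow F G' (LinearMap.proj k) (fun Z => rfl) t (φ (w t))
    rw [LinearMap.proj_apply, LinearMap.proj_apply, hφ, map_smul] at h1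
    rw [h1, map_smul]
  have hwlim : ∀ k, Tendsto (fun t => w t k) atTop (𝓝 0) := fun k =>
    (tendsto_pi_nhds.1 (tendsto_linearFlow_zero _ hB (Pi.single p 1))) k
  obtain ⟨C, hC⟩ := hbdd Y
  simp only [hformula]
  rw [show (0 : V) = ∑ k : ι, (0 : V) by simp]
  refine tendsto_finsetSum _ fun k _ => ?_
  have hlim : Tendsto (fun t => ‖w t k‖ * (‖LinearMap.toContinuousLinearMap (D k)‖ * C))
      atTop (𝓝 0) := by
    simpa using (hwlim k).norm.mul_const (‖LinearMap.toContinuousLinearMap (D k)‖ * C)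
  refine squeeze_zero_norm' ?_ hlim
  filter_upwards [eventually_ge_atTop 0] with t ht
  rw [norm_smul]
  gcongr
  calc ‖D k (linearFlow G' t Y)‖
      ≤ ‖LinearMap.toContinuousLinearMap (D k)‖ * ‖linearFlow G' t Y‖ :=
        (LinearMap.toContinuousLinearMap (D k)).le_opNorm _
    _ ≤ _ := by gcongr; exact hC t ht

/-- Weak-coupling limit: iterating a reduced conjugation by `exp (√τ A + τ C)`, whose first-order
term in `√τ` averages to zero, converges to the flow of the averaged second-order term. -/
theorem tendsto_iterate_reduced_conjugation [Nontrivial V] {R : Type*} [NormedRing R]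
    [NormedAlgebra ℂ R] [FiniteDimensional ℂ R] (k : V →ₗ[ℂ] R) (r : R →ₗ[ℂ] V) (A C : R)
    (G : V →ₗ[ℂ] V) (h0 : ∀ v, r (k v) = v) (h1 : ∀ v, r (A * k v - k v * A) = 0)
    (h2 : ∀ v, r (C * k v - k v * C) + (2⁻¹ : ℂ) •
      r (A * (A * k v - k v * A) - (A * k v - k v * A) * A) = G v) {t : ℝ} (ht : 0 ≤ t) (v : V) :
    Tendsto (fun τ : ℝ => (fun w => r (exp (((√τ : ℝ) : ℂ) • A + (τ : ℂ) • C) * k w *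
      exp (-(((√τ : ℝ) : ℂ) • A + (τ : ℂ) • C))))^[⌊t / τ⌋₊] v) (𝓝[>] 0)
      (𝓝 (linearFlow G t v)) := by
  have : CompleteSpace R := FiniteDimensional.complete ℂ R
  have : CompleteSpace V := FiniteDimensional.complete ℂ V
  let ρ : (R →L[ℂ] R) → (V →L[ℂ] V) := fun Q => (LinearMap.toContinuousLinearMap r).comp
    (Q.comp (LinearMap.toContinuousLinearMap k))
  have hρ : ∀ Q v, ρ Q v = r (Q (k v)) := fun Q v => rfl
  have hcont : Continuous ρ := continuous_const.clm_comp (continuous_id.clm_comp continuous_const)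
  have hsqrt : Tendsto (fun τ : ℝ => √τ) (𝓝[>] 0) (𝓝[>] 0) := by
    refine tendsto_nhdsWithin_iff.2 ⟨?_, ?_⟩
    · have := Real.continuous_sqrt.tendsto 0
      rw [Real.sqrt_zero] at this
      exact this.mono_left nhdsWithin_le_nhds
    · filter_upwards [self_mem_nhdsWithin] with τ hτ
      exact Real.sqrt_pos.2 hτ
  have hlim := (hcont.tendsto _).comp
    ((tendsto_exp_second_order (commutatorCLM A) (commutatorCLM C)).comp hsqrt)
  have hG : ρ (commutatorCLM C + (2⁻¹ : ℂ) • (commutatorCLM A * commutatorCLM A)) =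
      LinearMap.toContinuousLinearMap G := by
    ext1 v
    rw [hρ, add_apply, smul_apply, mul_apply_eq_comp, map_add, map_smul, commutatorCLM_apply,
      commutatorCLM_apply, commutatorCLM_apply, h2]
    rfl
  rw [hG] at hlim
  -- The second-order expansion is used at s = √τ. By `h0` and `h1` its terms of order 0 and √τ
  -- reduce to the identity and to zero, leaving a difference quotient in τ.
  have hgen : Tendsto (fun τ : ℝ => (τ : ℂ)⁻¹ • (ρ (exp (commutatorCLM
      (((√τ : ℝ) : ℂ) • A + (τ : ℂ) • C))) - 1)) (𝓝[>] 0)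
      (𝓝 (LinearMap.toContinuousLinearMap G)) := by
    refine hlim.congr' ?_
    filter_upwards [self_mem_nhdsWithin] with τ hτ
    have hsq : ((√τ : ℝ) : ℂ) ^ 2 = τ := by
      rw [← Complex.ofReal_pow, Real.sq_sqrt (le_of_lt hτ)]
    ext1 v
    simp only [Function.comp, hρ, smul_apply, sub_apply, map_smul, map_sub, one_apply_eq_self,
      h0, commutatorCLM_apply A, h1, smul_zero, sub_zero, hsq, commutatorCLM_add,
      commutatorCLM_smul]
  have hpow := tendsto_pow_floor_exp hgen ht
  have hev := ((ContinuousLinearMap.apply ℂ V v).continuous.tendsto _).comp hpow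
  refine hev.congr fun τ => ?_
  have hfun : (fun w => r (exp (((√τ : ℝ) : ℂ) • A + (τ : ℂ) • C) * k w *
      exp (-(((√τ : ℝ) : ℂ) • A + (τ : ℂ) • C)))) = ρ (exp (commutatorCLM
      (((√τ : ℝ) : ℂ) • A + (τ : ℂ) • C))) := by
    ext1 w
    rw [hρ, exp_commutatorCLM_apply]
  rw [hfun]
  simp

end Flow

/-! ### Flows on matrices. -/

noncomputable section MatrixFlow

set_option linter.unusedSectionVars false

open Filter

variable {n : Type*} [Fintype n] [DecidableEq n]

/-- The one-parameter group generated by a linear map on matrices. -/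
def matrixFlow (G : Matrix n n ℂ →ₗ[ℂ] Matrix n n ℂ) (t : ℝ) : Matrix n n ℂ →ₗ[ℂ] Matrix n n ℂ :=
  @linearFlow (Matrix n n ℂ) Matrix.linftyOpNormedAddCommGroup Matrix.linftyOpNormedSpace
    inferInstance G t

lemma map_matrixFlow_of_eigenfunctional (G : Matrix n n ℂ →ₗ[ℂ] Matrix n n ℂ)
    (φ : Matrix n n ℂ →ₗ[ℂ] ℂ) (κ : ℂ) (h : ∀ v, φ (G v) = κ * φ v) (t : ℝ) (v : Matrix n n ℂ) :
    φ (matrixFlow G t v) = Complex.exp (t * κ) * φ v :=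
  @map_linearFlow_of_eigenfunctional (Matrix n n ℂ) Matrix.linftyOpNormedAddCommGroup
    Matrix.linftyOpNormedSpace inferInstance G φ κ h t v

lemma matrixFlow_of_eq_zero (G : Matrix n n ℂ →ₗ[ℂ] Matrix n n ℂ) {v : Matrix n n ℂ}
    (h : G v = 0) (t : ℝ) : matrixFlow G t v = v :=
  @linearFlow_of_eq_zero (Matrix n n ℂ) Matrix.linftyOpNormedAddCommGroup
    Matrix.linftyOpNormedSpace inferInstance G v h t

lemma map_matrixFlow (G F φ : Matrix n n ℂ →ₗ[ℂ] Matrix n n ℂ)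
    (h : ∀ v, φ (G v) = F (φ v)) (t : ℝ) (v : Matrix n n ℂ) :
    φ (matrixFlow G t v) = matrixFlow F t (φ v) :=
  @map_linearFlow (Matrix n n ℂ) (Matrix n n ℂ) Matrix.linftyOpNormedAddCommGroup
    Matrix.linftyOpNormedSpace inferInstance Matrix.linftyOpNormedAddCommGroup
    Matrix.linftyOpNormedSpace inferInstance G F φ h t v

/-- Decay on the span of the ranges of intertwined maps, for a flow with relatively compact
orbits. -/
theorem tendsto_matrixFlow_range {ι : Type*} [Fintype ι] [DecidableEq ι]
    (G G' : Matrix n n ℂ →ₗ[ℂ] Matrix n n ℂ) (D : ι → Matrix n n ℂ →ₗ[ℂ] Matrix n n ℂ)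
    (B : Matrix ι ι ℂ) (hD : ∀ p Y, G (D p Y) = D p (G' Y) + ∑ k, B p k • D k Y)
    (hbdd : ∀ Y, ∃ C : ℝ, ∀ t : ℝ, 0 ≤ t → ∀ i j, ‖matrixFlow G' t Y i j‖ ≤ C)
    (hB : ∀ μ : ℂ, Module.End.HasEigenvalue (Matrix.toLin' B.transpose) μ → μ.re < 0)
    (p : ι) (Y : Matrix n n ℂ) :
    Tendsto (fun t : ℝ => matrixFlow G t (D p Y)) atTop (𝓝 0) := by
  refine @tendsto_linearFlow_range (Matrix n n ℂ) Matrix.linftyOpNormedAddCommGroup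
    Matrix.linftyOpNormedSpace inferInstance ι _ _ G G' D B hD (fun Y => ?_) hB p Y
  obtain ⟨C, hC⟩ := hbdd Y
  -- Entrywise bounds put the orbit in a compact set of the product topology, which is bounded for
  -- the operator norm inducing this topology.
  have hK : IsCompact (Set.univ.pi fun _ : n => Set.univ.pi fun _ : n =>
      Metric.closedBall (0 : ℂ) C) :=
    isCompact_univ_pi fun _ => isCompact_univ_pi fun _ => isCompact_closedBall 0 C
  have hK' : @Bornology.IsBounded (Matrix n n ℂ)
      (@PseudoMetricSpace.toBornology _ (@SeminormedAddGroup.toPseudoMetricSpace _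
        (@SeminormedAddCommGroup.toSeminormedAddGroup _
          (@NormedAddCommGroup.toSeminormedAddCommGroup _ Matrix.linftyOpNormedAddCommGroup))))
      (Set.univ.pi fun _ : n => Set.univ.pi fun _ : n => Metric.closedBall (0 : ℂ) C) :=
    @IsCompact.isBounded (Matrix n n ℂ) (@SeminormedAddGroup.toPseudoMetricSpace _
        (@SeminormedAddCommGroup.toSeminormedAddGroup _
          (@NormedAddCommGroup.toSeminormedAddCommGroup _ Matrix.linftyOpNormedAddCommGroup))) _ hK
  obtain ⟨C', hC'⟩ := (@isBounded_iff_forall_norm_le (Matrix n n ℂ)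
    (@SeminormedAddCommGroup.toSeminormedAddGroup _
      (@NormedAddCommGroup.toSeminormedAddCommGroup _ Matrix.linftyOpNormedAddCommGroup)) _).1 hK'
  refine ⟨C', fun t ht => hC' _ fun i _ j _ => ?_⟩
  exact mem_closedBall_zero_iff.2 (hC t ht i j)

end MatrixFlow

/-! ### The repeated interaction and its Lindblad limit. -/

noncomputable section Interaction

open Filter NormedSpace Matrix

variable {L K : ℕ}

/-- The bath operators coupled to the system fields. -/
def couplingField (E : Identification) (W : Matrix (Fin L ⊕ Fin L) (Fin K ⊕ Fin K) ℝ)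
    (i : Fin L ⊕ Fin L) : FockOp K :=
  fieldOp (auxField E) fun j => (W i j : ℂ)

/-- The rate matrix of the limiting Lindblad generator. -/
def bathRates (E : Identification) (W : Matrix (Fin L ⊕ Fin L) (Fin K ⊕ Fin K) ℝ) (ω : FockOp K) :
    Matrix (Fin L ⊕ Fin L) (Fin L ⊕ Fin L) ℂ :=
  Matrix.of fun i k => (couplingField E W k * couplingField E W i * ω).trace

/-- Embedding of system operators next to the bath state. -/
def kroneckerRight (ω : FockOp K) : FockOp L →ₗ[ℂ] JointOp L K where
  toFun ρ := ρ ⊗ₖ ω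
  map_add' _ _ := add_kronecker _ _ _
  map_smul' _ _ := smul_kronecker _ _ _

lemma kroneckerRight_apply (ω : FockOp K) (ρ : FockOp L) :
    kroneckerRight ω ρ = ρ ⊗ₖ ω := rfl

variable (E : Identification) (TS : Matrix (Fin L ⊕ Fin L) (Fin L ⊕ Fin L) ℂ)
    (TB : Matrix (Fin K ⊕ Fin K) (Fin K ⊕ Fin K) ℂ)
    (W : Matrix (Fin L ⊕ Fin L) (Fin K ⊕ Fin K) ℝ) {ω : FockOp K}

/-- Cyclicity of the trace places the right-hand bath operator first; this is the origin of the
index order in `bathRates`. -/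
lemma traceBath_conj (A C ρ : FockOp L) (B D : FockOp K) :
    traceBath ((A ⊗ₖ B) * (ρ ⊗ₖ ω) * (C ⊗ₖ D)) = (D * B * ω).trace • (A * ρ * C) := by
  rw [← mul_kronecker_mul, ← mul_kronecker_mul, traceBath_kronecker, Matrix.trace_mul_comm,
    ← mul_assoc]

/-- The interaction Hamiltonian. -/
def couplingOp : JointOp L K := ∑ i, sysField E i ⊗ₖ couplingField E W i

/-- The free Hamiltonian. -/
def freeOp : JointOp L K :=
  ((1 / 2 : ℂ) • quadOp (sysField E) TS) ⊗ₖ (1 : FockOp K) +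
    (1 : FockOp L) ⊗ₖ ((1 / 2 : ℂ) • quadOp (auxField E) TB)

lemma trace_couplingField_mul (hω : IsQuasiFree ω) (i : Fin L ⊕ Fin L) :
    (couplingField E W i * ω).trace = 0 := by
  simp only [couplingField, fieldOp, Finset.sum_mul, Matrix.trace_sum, smul_mul_assoc,
    Matrix.trace_smul, (isMajoranaFamily_auxField E).trace_mul_eq_zero hω.parity_comm, smul_zero,
    Finset.sum_const_zero]

/-- The averaged first-order term vanishes because the bath state is even. -/
lemma traceBath_commutator_couplingOp (hω : IsQuasiFree ω) (ρ : FockOp L) :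
    traceBath ((-Complex.I • couplingOp E W) * (ρ ⊗ₖ ω) -
      (ρ ⊗ₖ ω) * (-Complex.I • couplingOp E W)) = 0 := by
  have h1 : ∀ i, (sysField E i ⊗ₖ couplingField E W i) * (ρ ⊗ₖ ω) =
      (sysField E i * ρ) ⊗ₖ (couplingField E W i * ω) := fun i => (mul_kronecker_mul _ _ _ _).symm
  have h2 : ∀ i, (ρ ⊗ₖ ω) * (sysField E i ⊗ₖ couplingField E W i) =
      (ρ * sysField E i) ⊗ₖ (ω * couplingField E W i) := fun i => (mul_kronecker_mul _ _ _ _).symm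
  have h3 : ∀ i, (ω * couplingField E W i).trace = 0 := fun i => by
    rw [Matrix.trace_mul_comm, trace_couplingField_mul E W hω]
  rw [couplingOp, smul_mul_assoc, mul_smul_comm, Finset.sum_mul, Finset.mul_sum,
    ← traceBathLin_apply]
  simp only [map_smul, map_sub, map_sum, h1, h2, traceBathLin_apply, traceBath_kronecker, h3,
    trace_couplingField_mul E W hω, zero_smul, Finset.sum_const_zero, smul_zero, sub_zero]

/-- The averaged second-order term is the Lindblad generator. -/
lemma traceBath_second_order (hω : IsQuasiFree ω) (ρ : FockOp L) :
    traceBath ((-Complex.I • freeOp E TS TB) * (ρ ⊗ₖ ω) - (ρ ⊗ₖ ω) * (-Complex.I • freeOp E TS TB)) +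
      (2⁻¹ : ℂ) • traceBath ((-Complex.I • couplingOp E W) * ((-Complex.I • couplingOp E W) *
          (ρ ⊗ₖ ω) - (ρ ⊗ₖ ω) * (-Complex.I • couplingOp E W)) -
        ((-Complex.I • couplingOp E W) * (ρ ⊗ₖ ω) - (ρ ⊗ₖ ω) * (-Complex.I • couplingOp E W)) *
          (-Complex.I • couplingOp E W)) =
      lindbladian (sysField E) TS (bathRates E W ω) ρ := by
  have htr : ω.trace = 1 := hω.isState.2
  have hfree : traceBath (freeOp E TS TB * (ρ ⊗ₖ ω) - (ρ ⊗ₖ ω) * freeOp E TS TB) =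
      (2⁻¹ : ℂ) • (quadOp (sysField E) TS * ρ - ρ * quadOp (sysField E) TS) := by
    rw [freeOp, add_mul, mul_add, ← mul_kronecker_mul, ← mul_kronecker_mul, ← mul_kronecker_mul,
      ← mul_kronecker_mul, ← traceBathLin_apply]
    simp only [map_sub, map_add, traceBathLin_apply, traceBath_kronecker, one_mul, mul_one,
      smul_mul_assoc, mul_smul_comm, Matrix.trace_smul, htr, Matrix.trace_mul_comm ω]
    module
  have hVRV : traceBath (couplingOp E W * (ρ ⊗ₖ ω) * couplingOp E W) =
      ∑ i, ∑ k, bathRates E W ω i k • (sysField E i * ρ * sysField E k) := by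
    simp only [couplingOp, Finset.sum_mul, ← traceBathLin_apply, map_sum]
    refine Finset.sum_congr rfl fun i _ => ?_
    simp only [Finset.mul_sum, map_sum]
    refine Finset.sum_congr rfl fun k _ => ?_
    rw [traceBathLin_apply, traceBath_conj]
    rfl
  have hVVR : traceBath (couplingOp E W * couplingOp E W * (ρ ⊗ₖ ω)) =
      ∑ i, ∑ k, bathRates E W ω i k • (sysField E k * sysField E i * ρ) := by
    rw [Finset.sum_comm]
    simp only [couplingOp, Finset.sum_mul, ← traceBathLin_apply, map_sum]
    refine Finset.sum_congr rfl fun i _ => ?_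
    simp only [Finset.mul_sum, Finset.sum_mul, map_sum]
    refine Finset.sum_congr rfl fun k _ => ?_
    rw [← mul_kronecker_mul, ← mul_kronecker_mul, traceBathLin_apply, traceBath_kronecker]
    rfl
  have hRVV : traceBath ((ρ ⊗ₖ ω) * (couplingOp E W * couplingOp E W)) =
      ∑ i, ∑ k, bathRates E W ω i k • (ρ * (sysField E k * sysField E i)) := by
    rw [Finset.sum_comm]
    simp only [couplingOp, Finset.sum_mul, Finset.mul_sum, ← traceBathLin_apply, map_sum]
    rw [Finset.sum_comm]
    refine Finset.sum_congr rfl fun i _ => Finset.sum_congr rfl fun k _ => ?_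
    rw [← mul_kronecker_mul, ← mul_kronecker_mul, traceBathLin_apply, traceBath_kronecker,
      Matrix.trace_mul_comm]
    rfl
  have hfree' : (-Complex.I • freeOp E TS TB) * (ρ ⊗ₖ ω) - (ρ ⊗ₖ ω) * (-Complex.I • freeOp E TS TB) =
      -Complex.I • (freeOp E TS TB * (ρ ⊗ₖ ω) - (ρ ⊗ₖ ω) * freeOp E TS TB) := by
    simp only [smul_mul_assoc, mul_smul_comm, smul_sub]
  -- The factor (-i)² turns the double commutator into the Lindblad form: twice the jump term minus
  -- the anticommutator.
  have hdouble : ∀ V R : JointOp L K, (-Complex.I • V) * ((-Complex.I • V) * R -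
      R * (-Complex.I • V)) - ((-Complex.I • V) * R - R * (-Complex.I • V)) * (-Complex.I • V) =
      (2 : ℂ) • (V * R * V) - (V * V * R + R * (V * V)) := by
    intro V R
    simp only [smul_mul_assoc, mul_smul_comm, mul_sub, sub_mul, smul_sub, smul_smul, neg_mul_neg,
      Complex.I_mul_I, mul_assoc]
    module
  rw [hfree', hdouble, ← traceBathLin_apply, ← traceBathLin_apply, map_smul,
    map_sub (traceBathLin (L := L) (K := K)) ((2 : ℂ) • _), map_smul, map_add]
  simp only [traceBathLin_apply, hfree, hVRV, hVVR, hRVV, lindbladian_apply]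
  have hsum : ∑ i, ∑ k, bathRates E W ω i k • (sysField E i * ρ * sysField E k -
      (2⁻¹ : ℂ) • (sysField E k * sysField E i * ρ + ρ * (sysField E k * sysField E i))) =
      ∑ i, ∑ k, bathRates E W ω i k • (sysField E i * ρ * sysField E k) - (2⁻¹ : ℂ) •
      (∑ i, ∑ k, bathRates E W ω i k • (sysField E k * sysField E i * ρ) +
        ∑ i, ∑ k, bathRates E W ω i k • (ρ * (sysField E k * sysField E i))) := by
    simp only [← Finset.sum_add_distrib, Finset.smul_sum, ← Finset.sum_sub_distrib]
    refine Finset.sum_congr rfl fun i _ => Finset.sum_congr rfl fun k _ => ?_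
    module
  rw [hsum]
  module

/-- The continuous-time limit of the repeated interaction process. -/
theorem tendsto_repeatedInteraction (hω : IsQuasiFree ω) {t : ℝ} (ht : 0 ≤ t) (ρ : FockOp L) :
    Tendsto (fun τ : ℝ => repeatedInteraction E TS TB (imagMatrix W) ω τ t ρ) (𝓝[>] 0)
      (𝓝 (matrixFlow (lindbladian (sysField E) TS (bathRates E W ω)) t ρ)) := by
  have h := @tendsto_iterate_reduced_conjugation (FockOp L) Matrix.linftyOpNormedAddCommGroup
    Matrix.linftyOpNormedSpace inferInstance inferInstance (JointOp L K)
    Matrix.linftyOpNormedRing Matrix.linftyOpNormedAlgebra inferInstance (kroneckerRight ω)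
    traceBathLin (-Complex.I • couplingOp E W) (-Complex.I • freeOp E TS TB)
    (lindbladian (sysField E) TS (bathRates E W ω))
    (fun ρ => by
      rw [traceBathLin_apply, kroneckerRight_apply, traceBath_kronecker, hω.isState.2, one_smul])
    (traceBath_commutator_couplingOp E W hω) (traceBath_second_order E TS TB W hω) t ht ρ
  refine h.congr' ?_
  filter_upwards [self_mem_nhdsWithin] with τ hτ
  have hτ' : (0 : ℝ) < τ := hτ
  have hsq : ((√τ : ℝ) : ℂ) ^ 2 = τ := by
    rw [← Complex.ofReal_pow, Real.sq_sqrt hτ'.le]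
  have hs0 : ((√τ : ℝ) : ℂ) ≠ 0 := Complex.ofReal_ne_zero.2 (Real.sqrt_pos.2 hτ').ne'
  -- Multiplying τ by the coupling strength 1/√τ leaves √τ in front of the interaction.
  have hH : -(Complex.I * (τ : ℂ)) • totalHamiltonian E TS TB (imagMatrix W) (1 / √τ) =
      ((√τ : ℝ) : ℂ) • (-Complex.I • couplingOp E W) +
        (τ : ℂ) • (-Complex.I • freeOp E TS TB) := by
    rw [totalHamiltonian_eq]
    change _ • (freeOp E TS TB + _ • couplingOp E W) = _
    rw [smul_add, smul_smul, smul_smul, smul_smul, add_comm]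
    congr 2
    · push_cast
      field_simp
      rw [hsq]
    · ring
  rw [repeatedInteraction]
  congr 1
  have hfun : interactionMap E TS TB (imagMatrix W) ω τ = fun w => traceBathLin
      (NormedSpace.exp (((√τ : ℝ) : ℂ) • (-Complex.I • couplingOp E W) +
        (τ : ℂ) • (-Complex.I • freeOp E TS TB)) * kroneckerRight ω w *
      NormedSpace.exp (-(((√τ : ℝ) : ℂ) • (-Complex.I • couplingOp E W) +
        (τ : ℂ) • (-Complex.I • freeOp E TS TB)))) := by
    ext1 w
    rw [← hH, interactionMap, neg_smul, neg_neg]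
    rfl
  rw [hfun]
  rfl

end Interaction

/-! ### The Hautus test. -/

section Observability

open Matrix

variable {m n : Type*} [Fintype m] [Fintype n] [DecidableEq m] [DecidableEq n]

/-- The powers of a matrix beyond the dimension add nothing to the reachable space. -/
lemma range_pow_mul_le_iSup (T : Matrix m m ℂ) (Θ : Matrix m n ℂ) {N : ℕ} (hN : Fintype.card m ≤ N)
    (k : ℕ) : LinearMap.range (toLin' (T ^ k * Θ)) ≤
      ⨆ k ∈ Finset.range (N + 1), LinearMap.range (toLin' (T ^ k * Θ)) := by
  rintro _ ⟨x, rfl⟩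
  -- By Cayley–Hamilton, T ^ k is a polynomial in T given by the remainder modulo the characteristic
  -- polynomial. The bound card m on its degree is enough, as exponents up to N are allowed.
  rw [Matrix.pow_eq_aeval_mod_charpoly T k, Polynomial.aeval_eq_sum_range, Matrix.sum_mul,
    toLin'_apply, Matrix.sum_mulVec]
  refine Submodule.sum_mem _ fun j hj => ?_
  rw [Matrix.smul_mul, smul_mulVec]
  refine Submodule.smul_mem _ _ ?_
  rcases Nat.lt_or_ge N j with hj' | hj'
  · exfalso
    have h1 : j ≤ (Polynomial.X ^ k %ₘ T.charpoly).natDegree := by simpa [Nat.lt_succ_iff] using hj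
    have h2 := Polynomial.natDegree_modByMonic_le (Polynomial.X ^ k) T.charpoly_monic
    rw [Matrix.charpoly_natDegree_eq_dim] at h2
    omega
  · exact Submodule.mem_iSup_of_mem j (Submodule.mem_iSup_of_mem
      (by simpa [Nat.lt_succ_iff] using hj') ⟨x, toLin'_apply _ _⟩)

/-- The Hautus criterion for a self-adjoint matrix. -/
theorem iSup_range_eq_top_iff (T : Matrix m m ℂ) (hT : T.IsHermitian) (Θ : Matrix m n ℂ) {N : ℕ}
    (hN : Fintype.card m ≤ N) :
    (⨆ k ∈ Finset.range (N + 1), LinearMap.range (toLin' (T ^ k * Θ))) = ⊤ ↔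
      ∀ (μ : ℂ) (v : m → ℂ), Module.End.HasEigenvector (toLin' T) μ v →
        v ∉ LinearMap.ker (toLin' Θ.conjTranspose) := by
  constructor
  · intro htop μ v hv hker
    have hTv : T *ᵥ v = μ • v := by
      have := hv.apply_eq_smul
      rwa [toLin'_apply] at this
    have hΘv : Θ.conjTranspose *ᵥ v = 0 := by
      rwa [LinearMap.mem_ker, toLin'_apply] at hker
    have hpow : ∀ k, (T ^ k) *ᵥ v = μ ^ k • v := by
      intro k
      induction k with
      | zero => simp
      | succ k ih => rw [pow_succ, ← mulVec_mulVec, hTv, mulVec_smul, ih, smul_smul, pow_succ']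
    -- The functional ⟨v, ·⟩ annihilates every T ^ k Θ x, because T ^ k v = μ ^ k v and Θ* v = 0; it
    -- does not annihilate v.
    let f : (m → ℂ) →ₗ[ℂ] ℂ := dotProductBilin ℂ ℂ (star v)
    have hf : ∀ x, f x = star v ⬝ᵥ x := fun x => rfl
    have hle : (⨆ k ∈ Finset.range (N + 1), LinearMap.range (toLin' (T ^ k * Θ))) ≤
        LinearMap.ker f := by
      refine iSup₂_le fun k _ => ?_
      rintro _ ⟨x, rfl⟩
      rw [LinearMap.mem_ker, hf, toLin'_apply, dotProduct_mulVec]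
      have : star v ᵥ* (T ^ k * Θ) = star ((T ^ k * Θ).conjTranspose *ᵥ v) := by
        rw [star_mulVec, conjTranspose_conjTranspose]
      rw [this, conjTranspose_mul, (hT.pow k).eq, ← mulVec_mulVec, hpow, mulVec_smul, hΘv]
      simp
    have h0 : f v = 0 := by
      have : v ∈ LinearMap.ker f := hle (htop ▸ Submodule.mem_top)
      exact this
    rw [hf] at h0
    exact hv.2 (dotProduct_star_self_eq_zero.1 h0)
  · intro H
    by_contra hne
    obtain ⟨f, hf0, hf⟩ := Submodule.exists_le_ker_of_lt_top _ (lt_top_iff_ne_top.2 hne)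
    let w : m → ℂ := fun i => star (f (Pi.single i 1))
    have hfw : ∀ x, f x = star w ⬝ᵥ x := by
      intro x
      conv_lhs => rw [pi_eq_sum_univ' x]
      simp [dotProduct, w, mul_comm]
    have hw0 : w ≠ 0 := by
      intro h
      apply hf0
      refine LinearMap.ext fun x => ?_
      rw [hfw, h]
      simp
    -- S is the orthogonal complement of the reachable space. It is T-invariant and contains w, so T
    -- has an eigenvector in it; the case k = 0 places this vector in ker Θ*.
    let S : Submodule ℂ (m → ℂ) := ⨅ k : ℕ, LinearMap.ker (toLin' (Θ.conjTranspose * T ^ k))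
    have hS : ∀ x, x ∈ S ↔ ∀ k : ℕ, (Θ.conjTranspose * T ^ k) *ᵥ x = 0 := by
      intro x
      simp only [S, Submodule.mem_iInf, LinearMap.mem_ker, toLin'_apply]
    have hwS : w ∈ S := by
      rw [hS]
      intro k
      have h1 : ∀ x, star ((Θ.conjTranspose * T ^ k) *ᵥ w) ⬝ᵥ x = 0 := by
        intro x
        rw [star_mulVec, conjTranspose_mul, conjTranspose_conjTranspose, (hT.pow k).eq,
          ← dotProduct_mulVec, ← hfw]
        exact hf (range_pow_mul_le_iSup T Θ hN k ⟨x, toLin'_apply _ _⟩)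
      exact dotProduct_star_self_eq_zero.1 (h1 _)
    have hinv : ∀ x ∈ S, toLin' T x ∈ S := by
      intro x hx
      rw [hS] at hx ⊢
      intro k
      rw [toLin'_apply, mulVec_mulVec, Matrix.mul_assoc, ← pow_succ]
      exact hx (k + 1)
    have : Nontrivial S := ⟨⟨⟨w, hwS⟩, 0, fun h => hw0 (congrArg Subtype.val h)⟩⟩
    obtain ⟨μ, hμ⟩ := Module.End.exists_eigenvalue ((toLin' T).restrict hinv)
    obtain ⟨⟨v, hvS⟩, hv⟩ := hμ.exists_hasEigenvector
    refine H μ v ⟨?_, fun h => hv.2 (Subtype.ext h)⟩ ?_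
    · rw [Module.End.mem_eigenspace_iff]
      exact congrArg Subtype.val hv.apply_eq_smul
    · rw [LinearMap.mem_ker, toLin'_apply]
      simpa using (hS v).1 hvS 0

end Observability

/-! ### Positivity and boundedness of the semigroup. -/

section Positivity

open Matrix Filter

variable {L K : ℕ}

lemma quadOp_conjTranspose {n ι : Type*} [Fintype n] [DecidableEq n] [Fintype ι] [DecidableEq ι]
    {g : ι → Matrix n n ℂ} {P : Matrix n n ℂ} (hg : IsMajoranaFamily g P) (X : Matrix ι ι ℂ) :
    (quadOp g X).conjTranspose = quadOp g X.conjTranspose := by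
  simp only [quadOp, conjTranspose_sum, conjTranspose_smul, conjTranspose_mul, hg.conjTranspose,
    conjTranspose_apply]
  rw [Finset.sum_comm]

lemma imagMatrix_isHermitian {ι : Type*} {R : Matrix ι ι ℝ} (hR : R.transpose = -R) :
    (imagMatrix R).IsHermitian := by
  ext i j
  have := congrFun (congrFun hR i) j
  simp only [transpose_apply] at this
  simp [imagMatrix, this]

lemma imagMatrix_transpose {ι : Type*} {R : Matrix ι ι ℝ} (hR : R.transpose = -R) :
    (imagMatrix R).transpose = -imagMatrix R := by
  ext i j
  have := congrFun (congrFun hR i) j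
  simp only [transpose_apply] at this
  simp [imagMatrix, this]

lemma fieldOp_real_conjTranspose {n ι : Type*} [Fintype n] [DecidableEq n] [Fintype ι]
    [DecidableEq ι] {g : ι → Matrix n n ℂ} {P : Matrix n n ℂ} (hg : IsMajoranaFamily g P)
    (v : ι → ℝ) : (fieldOp g fun i => (v i : ℂ)).conjTranspose = fieldOp g fun i => (v i : ℂ) := by
  simp only [fieldOp, conjTranspose_sum, conjTranspose_smul, hg.conjTranspose]
  simp

lemma couplingField_conjTranspose (E : Identification)
    (W : Matrix (Fin L ⊕ Fin L) (Fin K ⊕ Fin K) ℝ) (i : Fin L ⊕ Fin L) :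
    (couplingField E W i).conjTranspose = couplingField E W i :=
  fieldOp_real_conjTranspose (isMajoranaFamily_auxField E) _

lemma totalHamiltonian_isHermitian (E : Identification)
    {RS : Matrix (Fin L ⊕ Fin L) (Fin L ⊕ Fin L) ℝ} (hRS : RS.transpose = -RS)
    {RB : Matrix (Fin K ⊕ Fin K) (Fin K ⊕ Fin K) ℝ} (hRB : RB.transpose = -RB)
    (W : Matrix (Fin L ⊕ Fin L) (Fin K ⊕ Fin K) ℝ) (lam : ℝ) :
    (totalHamiltonian E (imagMatrix RS) (imagMatrix RB) (imagMatrix W) lam).IsHermitian := by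
  rw [totalHamiltonian_eq, IsHermitian]
  have hhalf : star (1 / 2 : ℂ) = 1 / 2 := by simp
  have hV : ∀ i, (fieldOp (auxField (K := K) E) fun j => (W i j : ℂ)).conjTranspose =
    fieldOp (auxField (K := K) E) fun j => (W i j : ℂ) := couplingField_conjTranspose E W
  simp only [conjTranspose_add, conjTranspose_smul, conjTranspose_sum, conjTranspose_kronecker,
    conjTranspose_one, quadOp_conjTranspose (isMajoranaFamily_sysField E),
    quadOp_conjTranspose (isMajoranaFamily_auxField E), (imagMatrix_isHermitian hRS).eq,
    (imagMatrix_isHermitian hRB).eq, (isMajoranaFamily_sysField E).conjTranspose, hV, hhalf]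
  simp

variable (E : Identification) {RS : Matrix (Fin L ⊕ Fin L) (Fin L ⊕ Fin L) ℝ}
  (hRS : RS.transpose = -RS) {RB : Matrix (Fin K ⊕ Fin K) (Fin K ⊕ Fin K) ℝ}
  (hRB : RB.transpose = -RB) (W : Matrix (Fin L ⊕ Fin L) (Fin K ⊕ Fin K) ℝ)
  {ω : FockOp K} (hω : IsQuasiFree ω)

include hRS hRB hω in
lemma posSemidef_interactionMap (τ : ℝ) {ρ : FockOp L} (hρ : ρ.PosSemidef) :
    (interactionMap E (imagMatrix RS) (imagMatrix RB) (imagMatrix W) ω τ ρ).PosSemidef := by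
  refine posSemidef_traceBath ?_
  have hH := totalHamiltonian_isHermitian E hRS hRB W (1 / √τ)
  set H := totalHamiltonian E (imagMatrix RS) (imagMatrix RB) (imagMatrix W) (1 / √τ)
  have hconj : NormedSpace.exp ((Complex.I * (τ : ℂ)) • H) =
      (NormedSpace.exp (-(Complex.I * (τ : ℂ)) • H)).conjTranspose := by
    rw [← Matrix.exp_conjTranspose, conjTranspose_smul, hH.eq]
    simp
  rw [hconj]
  exact (hρ.kronecker hω.isState.1).mul_mul_conjTranspose_same _

include hRS hRB hω in
/-- The limiting semigroup is positive. -/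
lemma posSemidef_matrixFlow {t : ℝ} (ht : 0 ≤ t) {ρ : FockOp L} (hρ : ρ.PosSemidef) :
    (matrixFlow (lindbladian (sysField E) (imagMatrix RS) (bathRates E W ω)) t ρ).PosSemidef := by
  -- Positivity is inherited from the discrete process: each interaction map is a unitary
  -- conjugation of ρ ⊗ ω followed by a partial trace.
  refine isClosed_posSemidef.mem_of_tendsto
    (tendsto_repeatedInteraction E (imagMatrix RS) (imagMatrix RB) W hω ht ρ)
    (Eventually.of_forall fun τ => ?_)
  rw [Set.mem_ofPred_eq, repeatedInteraction]
  induction ⌊t / τ⌋₊ with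
  | zero => exact hρ
  | succ k ih =>
    rw [Function.iterate_succ_apply']
    exact posSemidef_interactionMap E hRS hRB W hω τ ih

lemma trace_matrixFlow {n ι : Type*} [Fintype n] [DecidableEq n] [Fintype ι]
    [DecidableEq ι] (g : ι → Matrix n n ℂ) (T M : Matrix ι ι ℂ) (t : ℝ) (X : Matrix n n ℂ) :
    (matrixFlow (lindbladian g T M) t X).trace = X.trace := by
  have h := map_matrixFlow_of_eigenfunctional (lindbladian g T M) (Matrix.traceLinearMap n ℂ ℂ) 0
    (fun v => by simp [trace_lindbladian]) t X
  simpa using h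

include hRS hRB hω in
/-- The limiting semigroup is bounded. -/
lemma bounded_matrixFlow (X : FockOp L) : ∃ C : ℝ, ∀ t : ℝ, 0 ≤ t → ∀ i j,
    ‖matrixFlow (lindbladian (sysField E) (imagMatrix RS) (bathRates E W ω)) t X i j‖ ≤ C := by
  -- On a positive X the orbit stays positive with constant trace, and the trace bounds every entry.
  induction X using posSemidef_induction with
  | hpos X hX =>
    refine ⟨X.trace.re, fun t ht i j => ?_⟩
    have := (posSemidef_matrixFlow E hRS hRB W hω ht hX).norm_apply_le_trace i j
    rwa [trace_matrixFlow] at this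
  | hadd X Y hX hY =>
    obtain ⟨C, hC⟩ := hX
    obtain ⟨C', hC'⟩ := hY
    refine ⟨C + C', fun t ht i j => ?_⟩
    rw [map_add, Matrix.add_apply]
    exact (norm_add_le _ _).trans (add_le_add (hC t ht i j) (hC' t ht i j))
  | hsmul c X hX =>
    obtain ⟨C, hC⟩ := hX
    refine ⟨‖c‖ * C, fun t ht i j => ?_⟩
    rw [map_smul, Matrix.smul_apply, norm_smul]
    gcongr
    exact hC t ht i j

end Positivity

/-! ### Decay on traceless operators, and the obstruction to relaxation. -/

noncomputable section Relaxation

open Matrix Filter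

variable {L K : ℕ}

/-- The CAR turn the symmetrised two-point function of the bath into a scalar, so only the
normalisation of ω enters. The damping is the same for every bath state. -/
lemma bathRates_add_transpose (E : Identification)
    (W : Matrix (Fin L ⊕ Fin L) (Fin K ⊕ Fin K) ℝ) {ω : FockOp K} (hω : ω.trace = 1) :
    bathRates E W ω + (bathRates E W ω).transpose =
      (2 : ℂ) • (imagMatrix W * (imagMatrix W).conjTranspose) := by
  ext i k
  rw [Matrix.add_apply, transpose_apply, bathRates, of_apply, of_apply, ← trace_add, ← add_mul,
    couplingField, couplingField, (isMajoranaFamily_auxField E).fieldOp_car, smul_mul_assoc, one_mul,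
    trace_smul, hω, Matrix.smul_apply, mul_apply]
  simp only [smul_eq_mul, mul_one, conjTranspose_apply, imagMatrix, Matrix.smul_apply, map_apply]
  congr 1
  refine Finset.sum_congr rfl fun j _ => ?_
  simp only [star_mul', Complex.star_def, Complex.conj_I, Complex.conj_ofReal]
  linear_combination ((W i j : ℂ) * W k j) * Complex.I_mul_I

variable {m n : Type*} [Fintype m] [Fintype n] [DecidableEq m]

lemma drift_transpose {m : Type*} {T M : Matrix m m ℂ} (hT : T.transpose = -T) {A : Matrix m m ℂ}
    (hM : M + M.transpose = (2 : ℂ) • A) :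
    (drift T M).transpose = -((2 * Complex.I) • T) - (2 : ℂ) • A := by
  have h : (drift T M).transpose = -(Complex.I • (T - T.transpose)) - (M + M.transpose) := by
    simp [drift, add_comm]
  rw [h, hT, hM]
  module

/-- The drift of the one-point functions is stable under the Hautus condition. -/
lemma re_neg_of_hasEigenvalue_drift {T M : Matrix m m ℂ} (hTh : T.IsHermitian)
    (hT : T.transpose = -T) {Θ : Matrix m n ℂ}
    (hM : M + M.transpose = (2 : ℂ) • (Θ * Θ.conjTranspose))
    (H : ∀ (μ : ℂ) (v : m → ℂ), Module.End.HasEigenvector (toLin' T) μ v →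
      v ∉ LinearMap.ker (toLin' Θ.conjTranspose)) (μ : ℂ)
    (hμ : Module.End.HasEigenvalue (toLin' (drift T M).transpose) μ) : μ.re < 0 := by
  obtain ⟨v, hv⟩ := hμ.exists_hasEigenvector
  have h1 : -((2 * Complex.I) • (T *ᵥ v)) - (2 : ℂ) • (Θ *ᵥ (Θ.conjTranspose *ᵥ v)) = μ • v := by
    have := hv.apply_eq_smul
    rw [toLin'_apply, drift_transpose hT hM, sub_mulVec, neg_mulVec, smul_mulVec, smul_mulVec,
      ← mulVec_mulVec] at this
    exact this
  have hreal : (star v ⬝ᵥ (T *ᵥ v)).im = 0 := hTh.im_star_dotProduct_mulVec_self v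
  have hΘ : star v ⬝ᵥ (Θ *ᵥ (Θ.conjTranspose *ᵥ v)) =
      star (Θ.conjTranspose *ᵥ v) ⬝ᵥ (Θ.conjTranspose *ᵥ v) := by
    rw [star_mulVec, conjTranspose_conjTranspose, ← dotProduct_mulVec]
  -- Pairing the eigenvalue equation with v gives Re μ ‖v‖² = -2‖Θ* v‖², the Hamiltonian part being
  -- purely imaginary.
  have h2 := congrArg (fun x => (star v ⬝ᵥ x).re) h1
  simp only [dotProduct_sub, dotProduct_neg, dotProduct_smul, hΘ, smul_eq_mul] at h2
  have hvpos : 0 < star v ⬝ᵥ v := dotProduct_star_self_pos_iff.2 hv.2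
  have hnn : 0 ≤ star (Θ.conjTranspose *ᵥ v) ⬝ᵥ (Θ.conjTranspose *ᵥ v) :=
    dotProduct_star_self_nonneg _
  rw [Complex.lt_def] at hvpos
  obtain ⟨hnn1, hnn2⟩ := Complex.le_def.1 hnn
  simp [hreal, ← hvpos.2] at h2
  simp only [Complex.zero_re] at hvpos hnn1
  by_contra! hre
  have hz : (star (Θ.conjTranspose *ᵥ v) ⬝ᵥ (Θ.conjTranspose *ᵥ v)).re = 0 := by
    have := mul_nonneg hre hvpos.1.le
    linarith
  have hΘv : Θ.conjTranspose *ᵥ v = 0 :=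
    dotProduct_star_self_eq_zero.1 (Complex.ext hz hnn2.symm)
  -- Once Θ* v = 0, the equation reads -2i T v = μ v, so the eigenvalue of T is iμ/2.
  refine H (Complex.I * μ / 2) v ⟨?_, hv.2⟩ (by rwa [LinearMap.mem_ker, toLin'_apply])
  rw [Module.End.mem_eigenspace_iff, toLin'_apply]
  rw [hΘv, mulVec_zero, smul_zero, sub_zero] at h1
  have h3 : (Complex.I * μ / 2) • v = (Complex.I / 2) • (μ • v) := by
    rw [smul_smul]; ring_nf
  rw [h3, ← h1, smul_neg, smul_smul, ← neg_smul]
  have : -(Complex.I / 2 * (2 * Complex.I)) = 1 := by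
    linear_combination -Complex.I_mul_I
  rw [this, one_smul]

/-- The commutator with a matrix as a linear map. -/
def commutatorLin {d : Type*} [Fintype d] (A : Matrix d d ℂ) : Matrix d d ℂ →ₗ[ℂ] Matrix d d ℂ :=
  LinearMap.mulRight ℂ A - LinearMap.mulLeft ℂ A

lemma commutatorLin_apply {d : Type*} [Fintype d] (A Y : Matrix d d ℂ) :
    commutatorLin A Y = Y * A - A * Y := rfl

/-- Every linear functional on matrices is a trace. -/
lemma exists_trace_representation {d : Type*} [Fintype d] [DecidableEq d]
    (f : Matrix d d ℂ →ₗ[ℂ] ℂ) : ∃ Z : Matrix d d ℂ, ∀ Y, f Y = (Z * Y).trace := by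
  refine ⟨Matrix.of fun i j => f (Matrix.single j i 1), fun Y => ?_⟩
  conv_lhs => rw [matrix_eq_sum_single Y]
  simp only [map_sum, Matrix.trace, diag_apply, mul_apply, of_apply]
  rw [Finset.sum_comm]
  refine Finset.sum_congr rfl fun i _ => Finset.sum_congr rfl fun j _ => ?_
  have : Matrix.single j i (Y j i) = Y j i • Matrix.single j i (1 : ℂ) := by
    rw [smul_single, smul_eq_mul, mul_one]
  rw [this, map_smul, smul_eq_mul, mul_comm]

/-- Traceless matrices are sums of commutators with the members of an irreducible family. -/
lemma mem_iSup_range_commutatorLin {d ι : Type*} [Fintype d] [DecidableEq d]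
    (g : ι → Matrix d d ℂ)
    (hirr : ∀ Z : Matrix d d ℂ, (∀ a, Z * g a = g a * Z) → ∃ c : ℂ, Z = c • (1 : Matrix d d ℂ))
    {X : Matrix d d ℂ} (hX : X.trace = 0) :
    X ∈ ⨆ p, LinearMap.range (commutatorLin (g p)) := by
  by_contra hmem
  -- Duality: a functional Tr(Z ·) that vanishes on all these commutators has Z commuting with the
  -- family. Then Z is scalar and the functional is a multiple of the trace.
  obtain ⟨f, hfX, hf⟩ := Submodule.exists_le_ker_of_notMem hmem
  obtain ⟨Z, hZ⟩ := exists_trace_representation f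
  obtain ⟨c, rfl⟩ := hirr Z fun a => by
    rw [Matrix.ext_iff_trace_mul_right]
    intro Y
    have h1 : f (commutatorLin (g a) Y) = 0 :=
      hf (Submodule.mem_iSup_of_mem a ⟨Y, rfl⟩)
    rw [hZ, commutatorLin_apply, mul_sub, trace_sub, ← mul_assoc, trace_mul_comm (Z * Y),
      ← mul_assoc, ← mul_assoc] at h1
    exact (sub_eq_zero.1 h1).symm
  apply hfX
  rw [hZ, smul_mul_assoc, one_mul, trace_smul, hX, smul_zero]

/-- The parity is diagonal with entries ±1, so boundedness of the semigroup passes to the twisted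
one. -/
lemma norm_parityOp_mul_apply (Z : FockOp L) (i j : Finset (Fin L)) :
    ‖(parityOp L * Z) i j‖ = ‖Z i j‖ := by
  rw [parityOp, diagonal_mul, norm_mul]
  simp

variable (E : Identification) {RS : Matrix (Fin L ⊕ Fin L) (Fin L ⊕ Fin L) ℝ}
  (hRS : RS.transpose = -RS) {RB : Matrix (Fin K ⊕ Fin K) (Fin K ⊕ Fin K) ℝ}
  (hRB : RB.transpose = -RB) (W : Matrix (Fin L ⊕ Fin L) (Fin K ⊕ Fin K) ℝ)
  {ω : FockOp K} (hω : IsQuasiFree ω)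

include hRS hRB hω in
/-- Under the Hautus condition the semigroup vanishes asymptotically on traceless operators. -/
theorem tendsto_matrixFlow_of_trace_eq_zero
    (H : ∀ (μ : ℂ) (v : Fin L ⊕ Fin L → ℂ),
      Module.End.HasEigenvector (Matrix.toLin' (imagMatrix RS)) μ v →
        v ∉ LinearMap.ker (Matrix.toLin' (imagMatrix W).conjTranspose))
    {X : FockOp L} (hX : X.trace = 0) :
    Tendsto (fun t : ℝ => matrixFlow (lindbladian (sysField E) (imagMatrix RS)
      (bathRates E W ω)) t X) atTop (𝓝 0) := by
  have hmem := mem_iSup_range_commutatorLin (sysField (L := L) E)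
    (fun Z => eq_smul_one_of_commute_sysField E) hX
  set G := lindbladian (sysField E) (imagMatrix RS) (bathRates E W ω) with hG
  clear hX
  induction hmem using Submodule.iSup_induction' with
  | zero => simp
  | add x y _ _ hx hy => simpa using hx.add hy
  | mem p x hx =>
    obtain ⟨Y, rfl⟩ := hx
    let Q : FockOp L →ₗ[ℂ] FockOp L := LinearMap.mulLeft ℂ (parityOp L)
    have hQ : ∀ Z, Q Z = parityOp L * Z := fun Z => rfl
    have hQQ : ∀ Z, Q (Q Z) = Z := fun Z => by
      rw [hQ, hQ, ← mul_assoc, parityOp_mul_self, one_mul]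
    refine tendsto_matrixFlow_range G (Q ∘ₗ G ∘ₗ Q) (fun p => commutatorLin (sysField E p))
      (drift (imagMatrix RS) (bathRates E W ω))
      (fun p Y => (isMajoranaFamily_sysField E).lindbladian_commutator _ _ p Y) (fun Y => ?_)
      (re_neg_of_hasEigenvalue_drift (imagMatrix_isHermitian hRS) (imagMatrix_transpose hRS)
        (bathRates_add_transpose E W hω.isState.2) H) p Y
    obtain ⟨C, hC⟩ := bounded_matrixFlow E hRS hRB W hω (Q Y)
    refine ⟨C, fun t ht i j => ?_⟩
    -- Q is an involution, so the flow of Q G Q is the flow of G conjugated by Q.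
    have h1 : matrixFlow (Q ∘ₗ G ∘ₗ Q) t Y = Q (matrixFlow G t (Q Y)) := by
      rw [← map_matrixFlow (Q ∘ₗ G ∘ₗ Q) G Q (fun v => by simp [hQQ]) t Y, hQQ]
    rw [h1, hQ, norm_parityOp_mul_apply]
    exact hC t ht i j

/-- The odd functional `ρ ↦ Tr (g(v) P ρ)`. -/
def oddFunctional {d ι : Type*} [Fintype d] [DecidableEq d] [Fintype ι] (g : ι → Matrix d d ℂ)
    (P : Matrix d d ℂ) (v : ι → ℂ) : Matrix d d ℂ →ₗ[ℂ] ℂ :=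
  (Matrix.traceLinearMap d ℂ ℂ).comp (LinearMap.mulLeft ℂ (fieldOp g v * P))

lemma oddFunctional_apply {d ι : Type*} [Fintype d] [DecidableEq d] [Fintype ι]
    (g : ι → Matrix d d ℂ) (P : Matrix d d ℂ) (v : ι → ℂ) (ρ : Matrix d d ℂ) :
    oddFunctional g P v ρ = ∑ p, v p * (g p * P * ρ).trace := by
  have : oddFunctional g P v ρ = (fieldOp g v * P * ρ).trace := rfl
  rw [this]
  simp only [fieldOp, Finset.sum_mul, trace_sum, smul_mul_assoc, trace_smul, smul_eq_mul]

/-- The condition on M removes the damping, and antisymmetry of T turns i(T - Tᵀ) into 2iT, which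
acts on v as a scalar. -/
lemma oddFunctional_lindbladian {d ι : Type*} [Fintype d] [DecidableEq d] [Fintype ι]
    [DecidableEq ι] {g : ι → Matrix d d ℂ} {P : Matrix d d ℂ} (hg : IsMajoranaFamily g P)
    {T M : Matrix ι ι ℂ} (hT : T.transpose = -T) {v : ι → ℂ} {μ : ℂ} (hv : T *ᵥ v = μ • v)
    (hM : (M + M.transpose) *ᵥ v = 0) (ρ : Matrix d d ℂ) :
    oddFunctional g P v (lindbladian g T M ρ) = (2 * Complex.I * μ) * oddFunctional g P v ρ := by
  have h1 : ∀ k, ∑ p, T k p * v p = μ * v k := fun k => congrFun hv k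
  have h2 : ∀ k, ∑ p, (M k p + M p k) * v p = 0 := fun k => congrFun hM k
  have h3 : ∀ k p, T p k = -T k p := fun k p => congrFun (congrFun hT k) p
  rw [oddFunctional_apply, oddFunctional_apply]
  simp only [hg.trace_field_parity_lindbladian, Finset.mul_sum]
  rw [Finset.sum_comm]
  refine Finset.sum_congr rfl fun k _ => ?_
  have h4 : ∑ p, v p * ((Complex.I * (T k p - T p k) - (M k p + M p k)) * (g k * P * ρ).trace) =
      (2 * Complex.I * ∑ p, T k p * v p - ∑ p, (M k p + M p k) * v p) * (g k * P * ρ).trace := by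
    rw [Finset.mul_sum, ← Finset.sum_sub_distrib, Finset.sum_mul]
    refine Finset.sum_congr rfl fun p _ => ?_
    rw [h3 k p]
    ring
  rw [h4, h1, h2]
  ring

/-- An eigenvector of the one-particle Hamiltonian in the kernel of the coupling obstructs relaxation. -/
theorem not_relaxing_of_eigenvector {d ι : Type*} [Fintype d] [DecidableEq d] [Nonempty d]
    [Fintype ι] [DecidableEq ι] {g : ι → Matrix d d ℂ} {P : Matrix d d ℂ}
    (hg : IsMajoranaFamily g P) {T M : Matrix ι ι ℂ} (hTh : T.IsHermitian)
    (hT : T.transpose = -T) {v : ι → ℂ} (hv0 : v ≠ 0) {μ : ℂ} (hv : T *ᵥ v = μ • v)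
    (hM : (M + M.transpose) *ᵥ v = 0) (ρ₀ : Matrix d d ℂ)
    (hlim : ∀ ρ : Matrix d d ℂ, IsState ρ →
      Tendsto (fun t : ℝ => matrixFlow (lindbladian g T M) t ρ) atTop (𝓝 ρ₀)) : False := by
  have hμ : μ.im = 0 := by
    have h1 : (star v ⬝ᵥ (T *ᵥ v)).im = 0 := hTh.im_star_dotProduct_mulVec_self v
    have hvpos : 0 < star v ⬝ᵥ v := dotProduct_star_self_pos_iff.2 hv0
    rw [Complex.lt_def] at hvpos
    rw [hv, dotProduct_smul, smul_eq_mul, Complex.mul_im, ← hvpos.2] at h1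
    simp only [Complex.zero_re] at hvpos
    simpa [hvpos.1.ne'] using h1
  set φ := oddFunctional g P v with hφ
  have hφc : Continuous φ := φ.continuous_of_finiteDimensional
  have hnorm : ∀ (t : ℝ) ρ, ‖φ (matrixFlow (lindbladian g T M) t ρ)‖ = ‖φ ρ‖ := by
    intro t ρ
    rw [map_matrixFlow_of_eigenfunctional _ φ _ (oddFunctional_lindbladian hg hT hv hM) t ρ,
      norm_mul, Complex.norm_exp]
    simp [hμ]
  -- The eigenvalue 2iμ is imaginary, so |φ| is constant along each orbit and must equal its value
  -- at the common limit.
  have hconst : ∀ ρ, IsState ρ → ‖φ ρ‖ = ‖φ ρ₀‖ := by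
    intro ρ hρ
    have h1 := ((hφc.tendsto _).comp (hlim ρ hρ)).norm
    simp only [Function.comp_apply, hnorm] at h1
    exact tendsto_nhds_unique tendsto_const_nhds h1
  have hone : φ 1 = 0 := by
    rw [hφ, oddFunctional_apply]
    simp [hg.trace_mul_eq_zero rfl]
  have hzero : ∀ ρ, IsState ρ → φ ρ = 0 := by
    intro ρ hρ
    -- The maximally mixed state is even, so φ vanishes there, and hence on every state.
    have h1 := hconst _ (isState_normalize (PosDef.one (n := d) (R := ℂ)))
    rw [map_smul, hone, smul_zero, norm_zero] at h1
    rw [← norm_eq_zero, hconst ρ hρ, ← h1]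
  have hall : ∀ X, φ X = 0 := by
    intro X
    induction X using posSemidef_induction with
    | hpos X hX =>
      by_cases htr : X.trace = 0
      · rw [hX.trace_eq_zero_iff.1 htr, map_zero]
      · have h1 := hzero (X.trace⁻¹ • X) ⟨hX.smul (inv_nonneg.2 hX.trace_nonneg), by
          rw [trace_smul, smul_eq_mul, inv_mul_cancel₀ htr]⟩
        rw [map_smul, smul_eq_mul] at h1
        exact (mul_eq_zero.1 h1).resolve_left (inv_ne_zero htr)
    | hadd X Y hX hY => rw [map_add, hX, hY, add_zero]
    | hsmul c X hX => rw [map_smul, hX, smul_zero]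
  have hfP : fieldOp g v * P = 0 := by
    rw [Matrix.ext_iff_trace_mul_right]
    intro Y
    rw [zero_mul, trace_zero]
    exact hall Y
  apply hg.fieldOp_ne_zero hv0
  calc fieldOp g v = fieldOp g v * P * P := by rw [mul_assoc, hg.parity_mul_self, mul_one]
    _ = 0 := by rw [hfP, zero_mul]

end Relaxation

/-! ### Lyapunov equations and the stationary covariance. -/

noncomputable section Lyapunov

open Matrix

variable {m : Type*} [Fintype m] [DecidableEq m]

lemma star_dotProduct_lyapunov {m : Type*} [Fintype m] (X B : Matrix m m ℂ) {v : m → ℂ} {c : ℝ}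
    (hX : X.IsHermitian) (hv : X *ᵥ v = (c : ℂ) • v) :
    star v ⬝ᵥ ((X * B + B.conjTranspose * X) *ᵥ v) =
      c * (star v ⬝ᵥ ((B + B.conjTranspose) *ᵥ v)) := by
  have h1 : star v ᵥ* X = (c : ℂ) • star v := by
    rw [← hX.eq, ← star_mulVec, hv, star_smul]
    simp
  rw [add_mulVec, add_mulVec, dotProduct_add, dotProduct_add, ← mulVec_mulVec, ← mulVec_mulVec, hv,
    dotProduct_mulVec _ X, h1, smul_dotProduct, mulVec_smul, dotProduct_smul, smul_eq_mul,
    smul_eq_mul, mul_add]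

/-- Testing on an eigenvector of X gives its eigenvalue times a positive number, and this product is
positive by hypothesis. -/
lemma posDef_of_lyapunov {X B : Matrix m m ℂ} (hB : (B + B.conjTranspose).PosDef)
    (hX : X.IsHermitian) (hQ : (X * B + B.conjTranspose * X).PosDef) : X.PosDef := by
  rw [hX.posDef_iff_eigenvalues_pos]
  intro i
  have hv := hX.mulVec_eigenvectorBasis i
  have hne : (hX.eigenvectorBasis i : m → ℂ) ≠ 0 := by
    intro h
    exact hX.eigenvectorBasis.orthonormal.ne_zero i (by ext j; exact congrFun h j)
  have h := star_dotProduct_lyapunov X B (c := hX.eigenvalues i) hX (by simpa using hv)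
  have h1 := hQ.dotProduct_mulVec_pos hne
  have h2 := hB.dotProduct_mulVec_pos hne
  rw [h] at h1
  have h3 := Complex.pos_iff.1 h1
  have h4 := Complex.pos_iff.1 h2
  rw [Complex.re_ofReal_mul] at h3
  exact pos_of_mul_pos_left h3.1 h4.1.le

lemma eq_zero_of_lyapunov_of_isHermitian {X B : Matrix m m ℂ} (hB : (B + B.conjTranspose).PosDef)
    (hX : X.IsHermitian) (hQ : X * B + B.conjTranspose * X = 0) : X = 0 := by
  rw [← hX.eigenvalues_eq_zero_iff]
  funext i
  have hv := hX.mulVec_eigenvectorBasis i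
  have hne : (hX.eigenvectorBasis i : m → ℂ) ≠ 0 := by
    intro h
    exact hX.eigenvectorBasis.orthonormal.ne_zero i (by ext j; exact congrFun h j)
  have h := star_dotProduct_lyapunov X B (c := hX.eigenvalues i) hX (by simpa using hv)
  have h2 := hB.dotProduct_mulVec_pos hne
  rw [hQ, zero_mulVec, dotProduct_zero] at h
  simpa using (mul_eq_zero.1 h.symm).resolve_right h2.ne'

/-- The Lyapunov operator `X ↦ X B + B^* X`. -/
def lyapunov (B : Matrix m m ℂ) : Matrix m m ℂ →ₗ[ℂ] Matrix m m ℂ :=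
  LinearMap.mulRight ℂ B + LinearMap.mulLeft ℂ B.conjTranspose

lemma lyapunov_apply (B X : Matrix m m ℂ) : lyapunov B X = X * B + B.conjTranspose * X := rfl

lemma lyapunov_conjTranspose (B X : Matrix m m ℂ) :
    lyapunov B X.conjTranspose = (lyapunov B X).conjTranspose := by
  simp [lyapunov_apply, add_comm]

/-- The kernel is stable under the adjoint, so it suffices to treat the Hermitian matrices X + X*
and i(X - X*). -/
lemma lyapunov_injective {B : Matrix m m ℂ} (hB : (B + B.conjTranspose).PosDef) :
    Function.Injective (lyapunov B) := by
  rw [injective_iff_map_eq_zero]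
  intro X hX
  have hX' : lyapunov B X.conjTranspose = 0 := by
    rw [lyapunov_conjTranspose, hX, conjTranspose_zero]
  have h1 : X + X.conjTranspose = 0 :=
    eq_zero_of_lyapunov_of_isHermitian hB (isHermitian_add_transpose_self X)
      (by rw [← lyapunov_apply, map_add, hX, hX', add_zero])
  have h2 : Complex.I • (X - X.conjTranspose) = 0 := by
    refine eq_zero_of_lyapunov_of_isHermitian hB ?_ ?_
    · rw [IsHermitian, conjTranspose_smul, conjTranspose_sub, conjTranspose_conjTranspose,
        Complex.star_def, Complex.conj_I]
      module
    · rw [← lyapunov_apply, map_smul, map_sub, hX, hX', sub_zero, smul_zero]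
  have h3 := (smul_eq_zero.1 h2).resolve_left Complex.I_ne_zero
  rw [← sub_eq_zero.1 h3, ← two_smul ℂ] at h1
  exact (smul_eq_zero.1 h1).resolve_left two_ne_zero

/-- The covariance matrix solving the stationarity equation. -/
theorem exists_stationary_covariance {T M : Matrix m m ℂ} (hTh : T.IsHermitian)
    (hT : T.transpose = -T) (hM : M.PosDef) :
    ∃ C : Matrix m m ℂ, C.IsHermitian ∧ C.transpose = -C ∧ (1 - C).PosDef ∧ (1 + C).PosDef ∧
      C * ((2⁻¹ : ℂ) • (M + M.transpose) - Complex.I • T) +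
        ((2⁻¹ : ℂ) • (M + M.transpose) + Complex.I • T) * C = M.transpose - M := by
  set B : Matrix m m ℂ := (2⁻¹ : ℂ) • (M + M.transpose) - Complex.I • T with hBdef
  have hMt : M.transpose.PosDef := hM.transpose
  have hBc : B.conjTranspose = (2⁻¹ : ℂ) • (M + M.transpose) + Complex.I • T := by
    rw [hBdef, conjTranspose_sub, conjTranspose_smul, conjTranspose_smul, conjTranspose_add,
      hM.1.eq, hMt.1.eq, hTh.eq]
    simp
  have hBt : B.transpose = B.conjTranspose := by
    rw [hBc, hBdef, transpose_sub, transpose_smul, transpose_smul, transpose_add,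
      transpose_transpose, hT, add_comm M.transpose]
    module
  have hBct : B.conjTranspose.transpose = B := by rw [← hBt, transpose_transpose]
  have hsum : B + B.conjTranspose = M + M.transpose := by
    rw [hBc, hBdef]
    module
  have hB : (B + B.conjTranspose).PosDef := by
    rw [hsum]
    exact hM.add hMt
  have hinj := lyapunov_injective hB
  -- Injectivity gives existence by finite dimension. The symmetries of C then follow from
  -- uniqueness, since the right-hand side is Hermitian and antisymmetric.
  obtain ⟨C, hC⟩ := (LinearMap.injective_iff_surjective.1 hinj) (M.transpose - M)
  have hCh : C.IsHermitian := by
    apply hinj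
    rw [lyapunov_conjTranspose, hC, conjTranspose_sub, hM.1.eq, hMt.1.eq]
  have hCt : C.transpose = -C := by
    apply hinj
    rw [map_neg, hC, lyapunov_apply]
    have := congrArg transpose hC
    rw [lyapunov_apply, transpose_add, transpose_mul, transpose_mul, hBt, hBct, transpose_sub,
      transpose_transpose] at this
    rw [add_comm, this]
    abel
  have hone : lyapunov B 1 = M + M.transpose := by
    rw [lyapunov_apply, one_mul, mul_one, hsum]
  -- The Lyapunov operator sends 1 - C to 2M and 1 + C to 2Mᵀ, both positive definite.
  refine ⟨C, hCh, hCt, posDef_of_lyapunov hB (isHermitian_one.sub hCh) ?_,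
    posDef_of_lyapunov hB (isHermitian_one.add hCh) ?_, ?_⟩
  · rw [← lyapunov_apply, map_sub, hone, hC]
    convert hM.add hM using 1
    abel
  · rw [← lyapunov_apply, map_add, hone, hC]
    convert hMt.add hMt using 1
    abel
  · rw [← hBc, ← lyapunov_apply, hC]

lemma Matrix.IsHermitian.exp_cfc {A : Matrix m m ℂ} (hA : A.IsHermitian) (f : ℝ → ℝ) :
    NormedSpace.exp (cfc f A) = cfc (fun x => Real.exp (f x)) A := by
  have hU : IsUnit (hA.eigenvectorUnitary : Matrix m m ℂ) :=
    (Unitary.toUnits hA.eigenvectorUnitary).isUnit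
  have hinv : (hA.eigenvectorUnitary : Matrix m m ℂ)⁻¹ =
      star (hA.eigenvectorUnitary : Matrix m m ℂ) :=
    Matrix.inv_eq_right_inv (Unitary.mul_star_self_of_mem hA.eigenvectorUnitary.2)
  rw [hA.cfc_eq, hA.cfc_eq, IsHermitian.cfc, IsHermitian.cfc, Unitary.conjStarAlgAut_apply,
    Unitary.conjStarAlgAut_apply, ← hinv, Matrix.exp_conj _ _ hU, exp_diagonal]
  congr 3
  funext i
  rw [Pi.coe_exp]
  simp [← Complex.exp_eq_exp_ℂ]

/-- Entrywise complex conjugation. -/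
def conjStarAlgHom : Matrix m m ℂ →⋆ₐ[ℝ] Matrix m m ℂ :=
  { (Complex.conjAe : ℂ →ₐ[ℝ] ℂ).mapMatrix with
    map_star' := fun A => by
      ext i j
      simp [star_apply] }

lemma conjStarAlgHom_apply (A : Matrix m m ℂ) : conjStarAlgHom A = A.conjTranspose.transpose := by
  ext i j
  simp [conjStarAlgHom]

/-- The Cayley transform of a covariance matrix is the exponential of an odd Hermitian matrix. -/
theorem exists_exp_two_smul_eq_cayley {C : Matrix m m ℂ} (hC : C.IsHermitian)
    (hCt : C.transpose = -C) (h1 : (1 - C).PosDef) (h2 : (1 + C).PosDef) :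
    ∃ X : Matrix m m ℂ, X.IsHermitian ∧ X.transpose = -X ∧
      NormedSpace.exp ((2 : ℂ) • X) * (1 + C) = 1 - C ∧
      (1 + C) * NormedSpace.exp ((2 : ℂ) • X) = 1 - C := by
  -- The spectrum is finite, so every real function is continuous on it, including the logarithm
  -- used below.
  have hcont : ∀ (f : ℝ → ℝ) (s : Set ℝ), s.Finite → ContinuousOn f s := fun f s hs => by
    rw [continuousOn_iff_continuous_domRestrict]
    have := hs.to_subtype
    exact continuous_of_discreteTopology
  have hfin := C.finite_real_spectrum
  have hspec : ∀ x ∈ spectrum ℝ C, -1 < x ∧ x < 1 := by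
    intro x hx
    rw [hC.spectrum_real_eq_range_eigenvalues] at hx
    obtain ⟨i, rfl⟩ := hx
    have hv : C *ᵥ hC.eigenvectorBasis i = (hC.eigenvalues i : ℂ) • hC.eigenvectorBasis i := by
      simpa using hC.mulVec_eigenvectorBasis i
    have hne : (hC.eigenvectorBasis i : m → ℂ) ≠ 0 := by
      intro h
      exact hC.eigenvectorBasis.orthonormal.ne_zero i (by ext j; exact congrFun h j)
    have hpos := dotProduct_star_self_pos_iff.2 hne
    have e1 := h1.dotProduct_mulVec_pos hne
    have e2 := h2.dotProduct_mulVec_pos hne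
    rw [sub_mulVec, one_mulVec, dotProduct_sub, hv, dotProduct_smul, smul_eq_mul] at e1
    rw [add_mulVec, one_mulVec, dotProduct_add, hv, dotProduct_smul, smul_eq_mul] at e2
    have f0 := (Complex.pos_iff.1 hpos).1
    have f1 := (Complex.pos_iff.1 e1).1
    have f2 := (Complex.pos_iff.1 e2).1
    rw [Complex.sub_re, Complex.re_ofReal_mul] at f1
    rw [Complex.add_re, Complex.re_ofReal_mul] at f2
    constructor <;> nlinarith
  -- Half the logarithm of the Cayley transform, so that exp(2 f(C)) = (1 - C)(1 + C)⁻¹. Its oddness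
  -- will give antisymmetry.
  set f : ℝ → ℝ := fun x => 2⁻¹ * Real.log ((1 - x) / (1 + x)) with hf
  have hodd : ∀ x, f (-x) = -f x := by
    intro x
    simp only [hf]
    rw [sub_neg_eq_add, ← sub_eq_add_neg, ← inv_div, Real.log_inv]
    ring
  have hCs : IsSelfAdjoint C := hC
  have htwo : (2 : ℂ) • cfc f C = cfc (fun x => f x + f x) C := by
    rw [two_smul, cfc_add (a := C) f f (hcont _ _ hfin) (hcont _ _ hfin)]
  have hE : NormedSpace.exp ((2 : ℂ) • cfc f C) = cfc (fun x : ℝ => (1 - x) / (1 + x)) C := by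
    rw [htwo, hC.exp_cfc]
    refine cfc_congr fun x hx => ?_
    have := hspec x hx
    have hp : 0 < (1 - x) / (1 + x) := div_pos (by linarith) (by linarith)
    simp only [hf]
    rw [← two_mul, ← mul_assoc, mul_inv_cancel₀ two_ne_zero, one_mul, Real.exp_log hp]
  have hadd : 1 + C = cfc (fun x : ℝ => 1 + x) C := by
    rw [cfc_const_add (1 : ℝ) (fun x => x) C, cfc_id' ℝ C, map_one]
  have hsub : 1 - C = cfc (fun x : ℝ => 1 - x) C := by
    rw [cfc_sub (a := C) (fun _ => (1 : ℝ)) (fun x => x), cfc_id' ℝ C, cfc_const_one ℝ C]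
  have hmul : cfc (fun x : ℝ => (1 - x) / (1 + x)) C * (1 + C) = 1 - C := by
    rw [hadd, hsub, ← cfc_mul (a := C) _ _ (hcont _ _ hfin) (hcont _ _ hfin)]
    refine cfc_congr fun x hx => ?_
    have := hspec x hx
    exact div_mul_cancel₀ _ (by linarith)
  refine ⟨cfc f C, cfc_predicate f C, ?_, by rw [hE, hmul], ?_⟩
  · have hX : (cfc f C).conjTranspose = cfc f C := cfc_predicate (R := ℝ) f C
    have hconj : conjStarAlgHom C = -C := by rw [conjStarAlgHom_apply, hC.eq, hCt]
    have hφ : Continuous (conjStarAlgHom : Matrix m m ℂ → Matrix m m ℂ) := by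
      have : (conjStarAlgHom : Matrix m m ℂ → Matrix m m ℂ) = fun A => A.conjTranspose.transpose :=
        funext conjStarAlgHom_apply
      rw [this]
      fun_prop
    -- Entrywise conjugation sends C to -C, hence f(C) to f(-C) = -f(C). As f(C) is Hermitian, its
    -- conjugate is its transpose.
    have h3 := StarAlgHomClass.map_cfc (S := ℝ) (conjStarAlgHom (m := m)) f C (hcont _ _ hfin) hφ hCs
      (by rw [hconj]; exact hCs.neg)
    rw [conjStarAlgHom_apply, hX, hconj, ← cfc_comp_neg (hf := hcont _ _ (hfin.image _))] at h3
    rw [h3]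
    simp only [hodd]
    exact cfc_neg f C
  · rw [hE, ← hmul]
    rw [hadd]
    exact cfc_commute_cfc _ _ _

end Lyapunov

/-! ### Gaussian and quasi-free stationary states. -/

noncomputable section GaussianStationary

set_option linter.unusedSectionVars false

open Matrix Filter

variable {n ι : Type*} [Fintype n] [DecidableEq n] [Fintype ι] [DecidableEq ι]

lemma quadOp_add (g : ι → Matrix n n ℂ) (X Y : Matrix ι ι ℂ) :
    quadOp g (X + Y) = quadOp g X + quadOp g Y := by
  simp [quadOp, add_smul, Finset.sum_add_distrib]

lemma quadOp_smul (g : ι → Matrix n n ℂ) (c : ℂ) (X : Matrix ι ι ℂ) :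
    quadOp g (c • X) = c • quadOp g X := by
  simp [quadOp, mul_smul, Finset.smul_sum]

lemma quadOp_sub (g : ι → Matrix n n ℂ) (X Y : Matrix ι ι ℂ) :
    quadOp g (X - Y) = quadOp g X - quadOp g Y := by
  simp [quadOp, sub_smul, Finset.sum_sub_distrib]

lemma mul_quadOp_of_intertwine {g : ι → Matrix n n ℂ} {ρ : Matrix n n ℂ} {F : Matrix ι ι ℂ}
    (h : ∀ p, ρ * g p = (∑ k, F k p • g k) * ρ) (Z : Matrix ι ι ℂ) :
    ρ * quadOp g Z = quadOp g (F * Z * F.transpose) * ρ := by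
  have h1 : ∀ i j, ρ * (g i * g j) = ∑ k, ∑ l, (F k i * F l j) • (g k * g l * ρ) := by
    intro i j
    rw [← mul_assoc, h, mul_assoc, h, Finset.sum_mul]
    refine Finset.sum_congr rfl fun k _ => ?_
    rw [Finset.sum_mul, Finset.mul_sum]
    refine Finset.sum_congr rfl fun l _ => ?_
    rw [smul_mul_assoc, smul_mul_assoc, mul_smul_comm, smul_smul, mul_assoc]
  have h2 : ∀ k l, (F * Z * F.transpose) k l = ∑ i, ∑ j, Z i j * (F k i * F l j) := by
    intro k l
    simp only [mul_apply, transpose_apply, Finset.sum_mul]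
    rw [Finset.sum_comm]
    refine Finset.sum_congr rfl fun i _ => Finset.sum_congr rfl fun j _ => ?_
    ring
  calc ρ * quadOp g Z = ∑ i, ∑ j, ∑ k, ∑ l, (Z i j * (F k i * F l j)) • (g k * g l * ρ) := by
        simp only [quadOp, Finset.mul_sum, mul_smul_comm, h1, Finset.smul_sum, smul_smul]
    _ = ∑ k, ∑ l, ∑ i, ∑ j, (Z i j * (F k i * F l j)) • (g k * g l * ρ) := by
        rw [Finset.sum_congr rfl fun i _ => Finset.sum_comm, Finset.sum_comm]
        refine Finset.sum_congr rfl fun k _ => ?_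
        rw [Finset.sum_congr rfl fun i _ => Finset.sum_comm, Finset.sum_comm]
    _ = quadOp g (F * Z * F.transpose) * ρ := by
        simp only [quadOp, Finset.sum_mul, smul_mul_assoc, h2, Finset.sum_smul]

/-- The generator acts on an operator implementing a Bogoliubov map as a quadratic operator. -/
lemma lindbladian_of_intertwine {g : ι → Matrix n n ℂ} {ρ : Matrix n n ℂ} {F : Matrix ι ι ℂ}
    (h : ∀ p, ρ * g p = (∑ k, F k p • g k) * ρ) (T M : Matrix ι ι ℂ) :
    lindbladian g T M ρ = quadOp g ((-Complex.I / 2) • (T - F * T * F.transpose) +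
      (M * F.transpose - (2⁻¹ : ℂ) • (M.transpose + F * M.transpose * F.transpose))) * ρ := by
  have h1 : ∑ i, ∑ k, M i k • (g i * ρ * g k) = quadOp g (M * F.transpose) * ρ := by
    simp only [quadOp, Finset.sum_mul, smul_mul_assoc, mul_apply, transpose_apply, Finset.sum_smul]
    refine Finset.sum_congr rfl fun i _ => ?_
    rw [Finset.sum_comm]
    refine Finset.sum_congr rfl fun k _ => ?_
    rw [mul_assoc, h, Finset.sum_mul, Finset.mul_sum, Finset.smul_sum]
    refine Finset.sum_congr rfl fun l _ => ?_
    rw [smul_mul_assoc, mul_smul_comm, smul_smul, mul_assoc]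
  have h2 : ∑ i, ∑ k, M i k • (g k * g i) = quadOp g M.transpose := by
    rw [Finset.sum_comm]
    rfl
  have h3 : ∑ i, ∑ k, M i k • (g i * ρ * g k -
      (2⁻¹ : ℂ) • (g k * g i * ρ + ρ * (g k * g i))) = ∑ i, ∑ k, M i k • (g i * ρ * g k) -
      (2⁻¹ : ℂ) • (quadOp g M.transpose * ρ + ρ * quadOp g M.transpose) := by
    rw [← h2]
    simp only [Finset.sum_mul, Finset.mul_sum, smul_mul_assoc, mul_smul_comm,
      ← Finset.sum_add_distrib, Finset.smul_sum, ← Finset.sum_sub_distrib]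
    refine Finset.sum_congr rfl fun i _ => Finset.sum_congr rfl fun k _ => ?_
    module
  rw [lindbladian_apply, h3, h1, mul_quadOp_of_intertwine h, mul_quadOp_of_intertwine h]
  simp only [quadOp_add, quadOp_sub, quadOp_smul, add_mul, sub_mul, smul_mul_assoc]

/-- Averaging over the exchange of the two indices replaces each product by half an anticommutator.
-/
lemma IsMajoranaFamily.quadOp_of_isSymm {g : ι → Matrix n n ℂ} {P : Matrix n n ℂ}
    (hg : IsMajoranaFamily g P) {Q : Matrix ι ι ℂ} (hQ : Q.transpose = Q) :
    quadOp g Q = Q.trace • (1 : Matrix n n ℂ) := by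
  have h1 : quadOp g Q = ∑ i, ∑ j, Q i j • (g j * g i) := by
    conv_lhs => rw [← hQ]
    rw [Finset.sum_comm]
    rfl
  have h2 : (2 : ℂ) • quadOp g Q = (2 : ℂ) • (Q.trace • (1 : Matrix n n ℂ)) := by
    rw [two_smul]
    nth_rewrite 2 [h1]
    rw [quadOp]
    simp only [← Finset.sum_add_distrib, ← smul_add, hg.car, smul_smul, ← Finset.sum_smul]
    congr 1
    simp [Matrix.trace, Finset.mul_sum, mul_comm]
  exact (smul_right_injective _ (two_ne_zero (α := ℂ))) h2

/-- The Gaussian operator `exp (1/2 ∑ X_ij g_i g_j)` implements the map `exp (2 X)`. -/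
lemma IsMajoranaFamily.exp_quadOp_mul {g : ι → Matrix n n ℂ} {P : Matrix n n ℂ}
    (hg : IsMajoranaFamily g P) {X : Matrix ι ι ℂ} (hX : X.transpose = -X) (p : ι) :
    NormedSpace.exp ((2⁻¹ : ℂ) • quadOp g X) * g p =
      (∑ k, NormedSpace.exp ((2 : ℂ) • X) k p • g k) *
        NormedSpace.exp ((2⁻¹ : ℂ) • quadOp g X) := by
  -- φ reads column p of Z as a field. It intertwines left multiplication by 2X with the commutator
  -- by the exponent, and it sends 1 to g_p.
  let φ : Matrix ι ι ℂ →ₗ[ℂ] Matrix n n ℂ :=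
    { toFun := fun Z => ∑ k, Z k p • g k
      map_add' := fun Y Z => by simp [add_smul, Finset.sum_add_distrib]
      map_smul' := fun c Z => by simp [mul_smul, Finset.smul_sum] }
  have hφ : ∀ Z, φ Z = ∑ k, Z k p • g k := fun Z => rfl
  have hXt : ∀ k l, X l k = -X k l := fun k l => congrFun (congrFun hX k) l
  have hcomm : ∀ Z, φ (((2 : ℂ) • X) * Z) =
      ((2⁻¹ : ℂ) • quadOp g X) * φ Z - φ Z * ((2⁻¹ : ℂ) • quadOp g X) := by
    intro Z
    have h1 : ((2⁻¹ : ℂ) • quadOp g X) * φ Z - φ Z * ((2⁻¹ : ℂ) • quadOp g X) =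
        ∑ l, (2⁻¹ * Z l p) • (quadOp g X * g l - g l * quadOp g X) := by
      simp only [hφ, Finset.mul_sum, Finset.sum_mul, smul_mul_assoc, mul_smul_comm, smul_sub,
        Finset.sum_sub_distrib, smul_smul]
      simp only [Finset.smul_sum, smul_smul, mul_comm]
    rw [h1]
    simp only [hg.commutator_quadOp, Finset.smul_sum, smul_smul]
    rw [hφ, Finset.sum_comm]
    refine Finset.sum_congr rfl fun k _ => ?_
    rw [← Finset.sum_smul, mul_apply]
    congr 1
    refine Finset.sum_congr rfl fun l _ => ?_
    rw [hXt k l, Matrix.smul_apply, smul_eq_mul]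
    ring
  have h := @exp_mul_map_one_of_intertwine (Matrix n n ℂ) Matrix.linftyOpNormedRing
    Matrix.linftyOpNormedAlgebra (Matrix ι ι ℂ) Matrix.linftyOpNormedRing
    Matrix.linftyOpNormedAlgebra inferInstance inferInstance φ _ _ hcomm
  have hone : φ 1 = g p := by
    rw [hφ]
    simp [one_apply, ite_smul]
  rw [hone] at h
  exact h

/-- The stationarity equation in terms of the Cayley transform. -/
lemma isSymm_of_cayley {C F T M : Matrix ι ι ℂ} (hCp : IsUnit (1 + C))
    (h1 : F * (1 + C) = 1 - C) (h2 : (1 + C) * F = 1 - C) (hF : F.transpose * F = 1)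
    (hT : T.transpose = -T)
    (hC : C * ((2⁻¹ : ℂ) • (M + M.transpose) - Complex.I • T) +
        ((2⁻¹ : ℂ) • (M + M.transpose) + Complex.I • T) * C = M.transpose - M) :
    ((-Complex.I / 2) • (T - F * T * F.transpose) +
      (M * F.transpose - (2⁻¹ : ℂ) • (M.transpose + F * M.transpose * F.transpose))).transpose =
    (-Complex.I / 2) • (T - F * T * F.transpose) +
      (M * F.transpose - (2⁻¹ : ℂ) • (M.transpose + F * M.transpose * F.transpose)) := by
  have hFu : IsUnit F := IsUnit.of_mul_eq_one_right _ hF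
  symm
  rw [← sub_eq_zero]
  set D := (-Complex.I / 2) • (T - F * T * F.transpose) +
      (M * F.transpose - (2⁻¹ : ℂ) • (M.transpose + F * M.transpose * F.transpose)) with hD
  -- Multiplication by F on the right removes every Fᵀ, as Fᵀ F = 1.
  have hDF : (D - D.transpose) * F = -Complex.I • (T * F - F * T) + M - F * M.transpose * F -
      (2⁻¹ : ℂ) • ((M.transpose - M) * F + F * (M.transpose - M)) := by
    have hZ : ∀ Z : Matrix ι ι ℂ, Z * F.transpose * F = Z := fun Z => by
      rw [mul_assoc, hF, mul_one]
    have hDt : D.transpose = (-Complex.I / 2) • (-T + F * T * F.transpose) +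
      (F * M.transpose - (2⁻¹ : ℂ) • (M + F * M * F.transpose)) := by
      rw [hD]
      simp only [transpose_add, transpose_sub, transpose_smul, transpose_mul, transpose_transpose,
        hT, mul_neg, neg_mul, mul_assoc, sub_neg_eq_add]
    rw [hDt, hD]
    simp only [sub_mul, add_mul, smul_mul_assoc, hZ, mul_sub, neg_mul]
    module
  -- Multiplying by 1 + C on both sides replaces each F by 1 - C, which leaves twice the
  -- stationarity equation for C. The factors 1 + C and F are invertible and can be cancelled.
  have hzero : (1 + C) * ((D - D.transpose) * F) * (1 + C) = 0 := by
    have e1 : ∀ Z, (1 + C) * (Z * F) * (1 + C) = (1 + C) * Z * (1 - C) := fun Z => by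
      rw [mul_assoc, mul_assoc Z, h1, ← mul_assoc]
    have e2 : ∀ Z, (1 + C) * (F * Z) * (1 + C) = (1 - C) * Z * (1 + C) := fun Z => by
      rw [← mul_assoc, h2]
    have e3 : ∀ Z, (1 + C) * (F * Z * F) * (1 + C) = (1 - C) * Z * (1 - C) := fun Z => by
      rw [e1, ← mul_assoc, h2]
    rw [hDF]
    have hsplit : (1 + C) * (-Complex.I • (T * F - F * T) + M - F * M.transpose * F -
        (2⁻¹ : ℂ) • ((M.transpose - M) * F + F * (M.transpose - M))) * (1 + C) =
        -Complex.I • ((1 + C) * (T * F) * (1 + C) - (1 + C) * (F * T) * (1 + C)) +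
          (1 + C) * M * (1 + C) - (1 + C) * (F * M.transpose * F) * (1 + C) -
          (2⁻¹ : ℂ) • ((1 + C) * ((M.transpose - M) * F) * (1 + C) +
            (1 + C) * (F * (M.transpose - M)) * (1 + C)) := by
      generalize 1 + C = Y
      simp only [mul_add, add_mul, mul_sub, sub_mul, mul_smul_comm, smul_mul_assoc]
    rw [hsplit, e3, e1, e1, e2, e2]
    have hC' := congrArg (fun Z => (2 : ℂ) • (Z - (M.transpose - M))) hC
    simp only [sub_self, smul_zero] at hC'
    rw [← hC']
    simp only [mul_add, add_mul, mul_sub, sub_mul, mul_smul_comm, smul_mul_assoc, one_mul, mul_one]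
    module
  have h3 := (hCp.mul_left_eq_zero).1 hzero
  have h4 := (hCp.mul_right_eq_zero).1 h3
  exact (hFu.mul_left_eq_zero).1 h4

/-- For faithful rates the Gaussian operator built from the Cayley transform is stationary. -/
theorem exists_lindbladian_exp_quadOp_eq_zero [Nonempty n] {g : ι → Matrix n n ℂ} {P : Matrix n n ℂ}
    (hg : IsMajoranaFamily g P) {T M : Matrix ι ι ℂ} (hTh : T.IsHermitian)
    (hT : T.transpose = -T) (hM : M.PosDef) :
    ∃ X : Matrix ι ι ℂ, X.IsHermitian ∧
      lindbladian g T M (NormedSpace.exp ((2⁻¹ : ℂ) • quadOp g X)) = 0 := by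
  obtain ⟨C, hCh, hCt, hCm, hCp, hC⟩ := exists_stationary_covariance hTh hT hM
  obtain ⟨X, hXh, hXt, h1, h2⟩ := exists_exp_two_smul_eq_cayley hCh hCt hCm hCp
  refine ⟨X, hXh, ?_⟩
  have hF : (NormedSpace.exp ((2 : ℂ) • X)).transpose * NormedSpace.exp ((2 : ℂ) • X) = 1 := by
    rw [← exp_transpose, transpose_smul, hXt, smul_neg, exp_neg]
    exact nonsing_inv_mul _ ((isUnit_iff_isUnit_det _).1 (isUnit_exp _))
  have hQ := isSymm_of_cayley hCp.isUnit h1 h2 hF hT hC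
  have h := lindbladian_of_intertwine (hg.exp_quadOp_mul hXt) T M
  rw [hg.quadOp_of_isSymm hQ, smul_mul_assoc, one_mul] at h
  have hpos : (NormedSpace.exp ((2⁻¹ : ℂ) • quadOp g X)).PosDef := by
    apply posDef_exp
    rw [IsHermitian, conjTranspose_smul, quadOp_conjTranspose hg, hXh.eq]
    simp
  -- At this point Gρ is a scalar multiple of ρ; since Gρ is traceless and ρ has positive trace, the
  -- scalar is zero.
  have htr := congrArg trace h
  rw [trace_lindbladian, trace_smul, smul_eq_mul] at htr
  rw [h, (mul_eq_zero.1 htr.symm).resolve_right hpos.trace_pos.ne', zero_smul]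

variable {L K : ℕ}

lemma exists_isGaussian_lindbladian_eq_zero (E : Identification)
    {T M : Matrix (Fin L ⊕ Fin L) (Fin L ⊕ Fin L) ℂ} (hTh : T.IsHermitian)
    (hT : T.transpose = -T) (hM : M.PosDef) :
    ∃ ρ : FockOp L, IsGaussian ρ ∧ lindbladian (sysField E) T M ρ = 0 := by
  obtain ⟨X, hX, h⟩ :=
    exists_lindbladian_exp_quadOp_eq_zero (isMajoranaFamily_sysField E) hTh hT hM
  -- The exponent carries a plus sign, so the inverse temperature is taken to be -1.
  have hH : -((-1 : ℝ) : ℂ) • (2⁻¹ : ℂ) • quadOp (sysField (L := L) E) X =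
      (2⁻¹ : ℂ) • quadOp (sysField E) X := by
    simp
  refine ⟨_, ⟨-1, (2⁻¹ : ℂ) • quadOp (sysField E) X, ⟨?_, (2⁻¹ : ℂ) • X, ?_⟩, rfl⟩, ?_⟩
  · rw [IsHermitian, conjTranspose_smul, quadOp_conjTranspose (isMajoranaFamily_sysField E), hX.eq]
    simp
  · rw [← quadOp_smul]
    simp only [quadOp, sysField_mul]
  · rw [map_smul, hH, h, smul_zero]

/-- The generator with positive semidefinite rates has a quasi-free stationary state. -/
theorem exists_isQuasiFree_lindbladian_eq_zero (E : Identification)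
    {T M : Matrix (Fin L ⊕ Fin L) (Fin L ⊕ Fin L) ℂ} (hTh : T.IsHermitian)
    (hT : T.transpose = -T) (hM : M.PosSemidef) :
    ∃ ρ : FockOp L, IsQuasiFree ρ ∧ lindbladian (sysField E) T M ρ = 0 := by
  -- The rates may be degenerate, so 1/(k + 1) times the identity is added to make them positive
  -- definite.
  have hex : ∀ k : ℕ, ∃ ρ : FockOp L, IsGaussian ρ ∧
      lindbladian (sysField E) T (M + ((1 / ((k : ℝ) + 1) : ℝ) : ℂ) • 1) ρ = 0 := fun k => by
    refine exists_isGaussian_lindbladian_eq_zero E hTh hT (PosDef.posSemidef_add hM ?_)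
    refine PosDef.one.smul ?_
    exact_mod_cast Nat.one_div_pos_of_nat (α := ℝ)
  choose ρ hρ hρ0 using hex
  have : FirstCountableTopology (FockOp L) :=
    inferInstanceAs (FirstCountableTopology (Finset (Fin L) → Finset (Fin L) → ℂ))
  obtain ⟨σ, hσ, φ, hφ, hlim⟩ :=
    (isCompact_isState (n := Finset (Fin L))).tendsto_subseq fun k => (hρ k).isState
  refine ⟨σ, mem_closure_of_tendsto hlim (Eventually.of_forall fun k => hρ (φ k)), ?_⟩
  have hcont : ∀ M : Matrix (Fin L ⊕ Fin L) (Fin L ⊕ Fin L) ℂ, ∀ T,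
      Continuous (lindbladian (sysField (L := L) E) T M) := fun M T =>
    LinearMap.continuous_of_finiteDimensional _
  -- Stationarity for the perturbed rates leaves an error proportional to 1/(k + 1), which vanishes
  -- along the convergent subsequence.
  have h1 : ∀ k, lindbladian (sysField E) T M (ρ k) =
      -((1 / ((k : ℝ) + 1) : ℝ) : ℂ) • lindbladian (sysField E) 0 1 (ρ k) := by
    intro k
    have h2 := hρ0 k
    rw [lindbladian_add_rates] at h2
    rw [eq_neg_of_add_eq_zero_left h2, neg_smul]
    congr 1
    simp only [lindbladian_apply, Matrix.smul_apply, smul_assoc, ← Finset.smul_sum]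
    simp [quadOp]
  have h3 : Tendsto (fun k => lindbladian (sysField E) T M (ρ (φ k))) atTop (𝓝 0) := by
    have hε : Tendsto (fun k : ℕ => -((1 / ((φ k : ℝ) + 1) : ℝ) : ℂ)) atTop (𝓝 0) := by
      have := (tendsto_one_div_add_atTop_nhds_zero_nat (𝕜 := ℝ)).comp hφ.tendsto_atTop
      simpa using ((Complex.continuous_ofReal.tendsto 0).comp this).neg
    have := hε.smul (((hcont 1 0).tendsto σ).comp hlim)
    rw [zero_smul] at this
    refine this.congr fun k => ?_
    rw [h1]
    rfl
  exact tendsto_nhds_unique (((hcont M T).tendsto σ).comp hlim) h3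

/-- The quadratic form at x is Tr(b(x)* ω b(x)) with b(x) = Σ x_k b_k. -/
lemma posSemidef_bathRates (E : Identification) (W : Matrix (Fin L ⊕ Fin L) (Fin K ⊕ Fin K) ℝ)
    {ω : FockOp K} (hω : ω.PosSemidef) : (bathRates E W ω).PosSemidef := by
  rw [posSemidef_iff_dotProduct_mulVec]
  constructor
  · ext i k
    rw [conjTranspose_apply, bathRates, of_apply, of_apply, ← trace_conjTranspose,
      conjTranspose_mul, conjTranspose_mul, couplingField_conjTranspose, couplingField_conjTranspose,
      hω.1.eq, trace_mul_comm]
  · intro x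
    have h : star x ⬝ᵥ (bathRates E W ω *ᵥ x) =
        ((∑ k, x k • couplingField E W k).conjTranspose * ω *
          ∑ k, x k • couplingField E W k).trace := by
      simp only [conjTranspose_sum, conjTranspose_smul, couplingField_conjTranspose,
        Finset.sum_mul, Finset.mul_sum, trace_sum, smul_mul_assoc, mul_smul_comm, trace_smul,
        smul_eq_mul, dotProduct, mulVec]
      rw [Finset.sum_comm]
      refine Finset.sum_congr rfl fun k _ => Finset.sum_congr rfl fun i _ => ?_
      rw [bathRates, of_apply, trace_mul_comm _ (couplingField E W k), ← mul_assoc (couplingField E W k),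
        Pi.star_apply]
      ring
    rw [h]
    exact (hω.conjTranspose_mul_mul_same _).trace_nonneg

end GaussianStationary

/-! ### The limit dynamics and the equivalence. -/

theorem theorem3 (L K : ℕ) (E : Identification)
    (RS : Matrix (Fin L ⊕ Fin L) (Fin L ⊕ Fin L) ℝ) (hRS : RS.transpose = -RS)
    (RB : Matrix (Fin K ⊕ Fin K) (Fin K ⊕ Fin K) ℝ) (hRB : RB.transpose = -RB)
    (W : Matrix (Fin L ⊕ Fin L) (Fin K ⊕ Fin K) ℝ)
    (ω : FockOp K) (hω : IsQuasiFree ω)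
    (TS : Matrix (Fin L ⊕ Fin L) (Fin L ⊕ Fin L) ℂ) (hTS : TS = imagMatrix RS)
    (TB : Matrix (Fin K ⊕ Fin K) (Fin K ⊕ Fin K) ℂ) (hTB : TB = imagMatrix RB)
    (Θ : Matrix (Fin L ⊕ Fin L) (Fin K ⊕ Fin K) ℂ) (hΘ : Θ = imagMatrix W) :
    (∀ t : ℝ, 0 ≤ t → ∀ ρ : FockOp L,
      Filter.Tendsto (fun τ : ℝ => repeatedInteraction E TS TB Θ ω τ t ρ)
        (𝓝[>] (0 : ℝ)) (𝓝 (evolution E TS TB Θ ω t ρ))) ∧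
    List.TFAE [
      ∃ ρinf : FockOp L,
        IsStationaryState (evolution E TS TB Θ ω) ρinf ∧
        (∀ σ : FockOp L, IsStationaryState (evolution E TS TB Θ ω) σ → σ = ρinf) ∧
        IsQuasiFree ρinf ∧
        (∀ ρ : FockOp L, IsState ρ →
          Filter.Tendsto (fun t : ℝ => evolution E TS TB Θ ω t ρ) Filter.atTop (𝓝 ρinf)),
      ∀ (μ : ℂ) (v : Fin L ⊕ Fin L → ℂ),
        Module.End.HasEigenvector (Matrix.toLin' TS) μ v →
          v ∉ LinearMap.ker (Matrix.toLin' Θ.conjTranspose),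
      (⨆ k ∈ Finset.range (2 * L + 1),
        LinearMap.range (Matrix.toLin' (TS ^ k * Θ))) = ⊤] := by
  subst hTS hTB hΘ
  have hlim := fun (t : ℝ) (ht : 0 ≤ t) (ρ : FockOp L) =>
    tendsto_repeatedInteraction E (imagMatrix RS) (imagMatrix RB) W hω ht ρ
  -- `evolution` is a `limUnder`, so it is meaningful only through the convergence established for t
  -- ≥ 0.
  have hev : ∀ t : ℝ, 0 ≤ t → ∀ ρ : FockOp L,
      evolution E (imagMatrix RS) (imagMatrix RB) (imagMatrix W) ω t ρ =
        matrixFlow (lindbladian (sysField E) (imagMatrix RS) (bathRates E W ω)) t ρ :=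
    fun t ht ρ => (hlim t ht ρ).limUnder_eq
  have hTh := imagMatrix_isHermitian hRS
  have hTt := imagMatrix_transpose hRS
  refine ⟨fun t ht ρ => by rw [hev t ht]; exact hlim t ht ρ, ?_⟩
  tfae_have 2 ↔ 3 :=
    (iSup_range_eq_top_iff (imagMatrix RS) hTh (imagMatrix W) (by simp [two_mul])).symm
  tfae_have 2 → 1 := by
    intro H
    obtain ⟨ρinf, hqf, hzero⟩ := exists_isQuasiFree_lindbladian_eq_zero E hTh hTt
      (posSemidef_bathRates E W hω.isState.1)
    have hstat : ∀ t : ℝ, matrixFlow (lindbladian (sysField E) (imagMatrix RS)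
        (bathRates E W ω)) t ρinf = ρinf := matrixFlow_of_eq_zero _ hzero
    have hconv : ∀ ρ : FockOp L, IsState ρ → Filter.Tendsto (fun t : ℝ =>
        evolution E (imagMatrix RS) (imagMatrix RB) (imagMatrix W) ω t ρ) Filter.atTop
        (𝓝 ρinf) := by
      intro ρ hρ
      -- The difference of two states is traceless, so its orbit decays, while ρinf does not move.
      have h1 := (tendsto_matrixFlow_of_trace_eq_zero E hRS hRB W hω H (X := ρ - ρinf)
        (by rw [Matrix.trace_sub, hρ.2, hqf.isState.2, sub_self])).add_const ρinf
      rw [zero_add] at h1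
      refine h1.congr' ?_
      filter_upwards [Filter.eventually_ge_atTop 0] with t ht
      rw [hev t ht, map_sub, hstat, sub_add_cancel]
    refine ⟨ρinf, ⟨hqf.isState, fun t ht => by rw [hev t ht, hstat]⟩, fun σ hσ => ?_, hqf, hconv⟩
    -- A stationary state is the limit of its own constant orbit, so convergence to ρinf gives
    -- uniqueness.
    refine tendsto_nhds_unique (tendsto_const_nhds.congr' ?_) (hconv σ hσ.1)
    filter_upwards [Filter.eventually_ge_atTop 0] with t ht
    exact (hσ.2 t ht).symm
  tfae_have 1 → 2 := by
    rintro ⟨ρinf, -, -, -, hconv⟩ μ v hv hker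
    rw [LinearMap.mem_ker, Matrix.toLin'_apply] at hker
    refine not_relaxing_of_eigenvector (isMajoranaFamily_sysField E) hTh hTt hv.2 (μ := μ)
      (M := bathRates E W ω) (by simpa using hv.apply_eq_smul) ?_ ρinf fun ρ hρ => ?_
    · rw [bathRates_add_transpose E W hω.isState.2, Matrix.smul_mulVec, ← Matrix.mulVec_mulVec,
        hker, Matrix.mulVec_zero, smul_zero]
    · refine (hconv ρ hρ).congr' ?_
      filter_upwards [Filter.eventually_ge_atTop 0] with t ht
      exact hev t ht ρ
  tfae_finish
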